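/- **Theorem (Source Identity).** Let $\omega_1\neq 0$ be a fixed complex number. For $\beta\in\mathbb C$ put $\omega_3=\pi\mathrm i\,\beta/(2\omega_1)$ (so $\beta=2\omega_1\omega_3/(\pi\mathrm i)$), $\tau=\omega_3/\omega_1$, $\omega_0=0$, $\omega_2=-\omega_1-\omega_3$, $R=2\omega_1/\pi$, and consider only $\beta$ with $\operatorname{Im}\tau>0$. Let $\wp$ and $\zeta$ be the Weierstrass functions of the lattice $2\omega_1\mathbb Z+2\omega_3\mathbb Z$, let $e_\nu=\wp(\omega_\nu)$ ($\nu=1,2,3$) and $\eta_1=\zeta(\omega_1)$, and let $$\theta_1(x)=2\sum_{n\ge0}(-1)^n e^{\pi\mathrm i\tau(n+1/2)^2}\sin\frac{(2n+1)x}{R},\qquad \theta_2(x)=2\sum_{n\ge0}e^{\pi\mathrm i\tau(n+1/2)^2}\cos\frac{(2n+1)x}{R},$$ $$\theta_3(x)=1+2\sum_{n\ge1}e^{\pi\mathrm i\tau n^2}\cos\frac{2nx}{R},\qquad \theta_4(x)=1+2\sum_{n\ge1}(-1)^n e^{\pi\mathrm i\tau n^2}\cos\frac{2nx}{R}.$$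 Let $\mathcal N$ be a positive integer, let $\lambda$, $d_\nu$ ($\nu=0,1,2,3$) and $m_J\neq0$ ($J=1,\dots,\mathcal N$) be complex constants, and let $X=(X_1,\dots,X_{\mathcal N})$ be complex variables. Put $$g_{\nu,J}=m_Jd_\nu+\tfrac{\lambda}{2}m_J^2,\qquad \gamma_{J,K}=\lambda(m_J+m_K)(\lambda m_Jm_K-1),$$ $$|d|=\sum_{\nu=0}^3d_\nu,\qquad |m|=\sum_{J=1}^{\mathcal N}m_J,\qquad |m^2|=\sum_{J=1}^{\mathcal N}m_J^2.$$ Let $$\Phi_0(X)=\Bigl(\prod_{J=1}^{\mathcal N}\prod_{\nu=0}^3\theta_{\nu+1}(X_J)^{g_{\nu,J}}\Bigr)\prod_{1\le J<K\le\mathcal N}\theta_1(X_J-X_K)^{m_Jm_K\lambda}\,\theta_1(X_J+X_K)^{m_Jm_K\lambda},$$ as a function of $(\beta,X)$ on any open set $U\subseteq\mathbb C\times\mathbb C^{\mathcal N}$ on which $\operatorname{Im}\tau>0$, none of the theta functions in the product vanishes, and a continuous branch of each of the powers has been chosen (arbitrarily). Let $$\mathcal H=\sum_{J=1}^{\mathcal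 N}\frac1{m_J}\Bigl(-\frac{\partial^2}{\partial X_J^2}+\sum_{\nu=0}^3g_{\nu,J}(g_{\nu,J}-1)\wp(X_J+\omega_\nu)\Bigr)+\sum_{1\le J<K\le\mathcal N}\gamma_{J,K}\bigl\{\wp(X_J-X_K)+\wp(X_J+X_K)\bigr\}$$ and $$\mathcal E_0=(2\lambda|m|+|d|)\bigl\{\mathcal N-\lambda(|m|^2+|m^2|)-|m|\,|d|\bigr\}\frac{\eta_1}{\omega_1}+|m|\bigl\{(d_0d_1+d_2d_3)e_1+(d_0d_2+d_1d_3)e_2+(d_0d_3+d_1d_2)e_3\bigr\}.$$ Then $\Phi_0$ is holomorphic on $U$, and at every point of $U$, with $\partial/\partial\beta$ taken at fixed $\omega_1$ and $X$, $$\Bigl\{(4\lambda|m|+2|d|)\frac{\partial}{\partial\beta}+\mathcal H-\mathcal E_0\Bigr\}\Phi_0=0 .$$ -/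

import Mathlib

noncomputable section

namespace SourceIdentity

/-! ### Weierstrass functions

The lattice is `L.lattice`, spanned by the periods `L.ω₁ = 2 ω₁` and `L.ω₂ = 2 ω₃`; the Weierstrass
function `℘` of this lattice is `L.weierstrassP`. -/

/-- The pair of periods `(2 ω₁, 2 ω₃)` for half-periods with `Im (ω₃ / ω₁) > 0`. -/
def periodPair (ω₁ ω₃ : ℂ) (h : 0 < (ω₃ / ω₁).im) : PeriodPair where
  ω₁ := 2 * ω₁
  ω₂ := 2 * ω₃
  indep := by
    have h1 : ω₁ ≠ 0 := by
      rintro rfl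
      simp at h
    rw [LinearIndependent.pair_iff]
    intro s t hst
    have hst' : (s : ℂ) + t * (ω₃ / ω₁) = 0 := by
      have h2 : (s : ℂ) * (2 * ω₁) + t * (2 * ω₃) = 0 := by
        simpa [Complex.real_smul] using hst
      field_simp
      linear_combination h2 / 2
    have him := congrArg Complex.im hst'
    have hre := congrArg Complex.re hst'
    simp only [Complex.add_im, Complex.ofReal_im, Complex.im_ofReal_mul, zero_add,
      Complex.zero_im, mul_eq_zero, h.ne', or_false] at him
    subst him
    simpa using hre

/-- The Weierstrass zeta function of the lattice. The summand of `l = 0` is `1 / z`, because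
`1 / 0 = 0`. -/
def zeta (L : PeriodPair) (z : ℂ) : ℂ :=
  ∑' l : L.lattice, (1 / (z - l) + 1 / (l : ℂ) + z / (l : ℂ) ^ 2)

/-- The half-periods `ω₀ = 0`, `ω₁`, `ω₂ = - ω₁ - ω₃`, `ω₃`. -/
def halfPeriod (L : PeriodPair) : Fin 4 → ℂ :=
  ![0, L.ω₁ / 2, -(L.ω₁ / 2) - L.ω₂ / 2, L.ω₂ / 2]

/-- `e_ν = ℘(ω_ν)`; it is used for `ν = 1, 2, 3`. -/
def e (L : PeriodPair) (ν : Fin 4) : ℂ := L.weierstrassP (halfPeriod L ν)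

/-- `η_ν = ζ(ω_ν)`; it is used for `ν = 1`. -/
def eta (L : PeriodPair) (ν : Fin 4) : ℂ := zeta L (halfPeriod L ν)

/-! ### The variable `β` and the theta functions -/

/-- The half-period `ω₃`, expressed through the fixed `ω₁` and `β = 2 ω₁ ω₃ / (π i)`. -/
def omega3 (ω₁ β : ℂ) : ℂ := Real.pi * Complex.I * β / (2 * ω₁)

/-- `τ = ω₃ / ω₁`. -/
def tau (ω₁ β : ℂ) : ℂ := omega3 ω₁ β / ω₁

/-- `R = 2 ω₁ / π`. -/
def radius (ω₁ : ℂ) : ℂ := 2 * ω₁ / Real.pi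

/-- The Jacobi theta functions: `theta ω₁ β ν x` is `θ_{ν+1}(x) = ϑ_{ν+1}(x / R, exp (π i τ))`,
`ν = 0, 1, 2, 3`. -/
def theta (ω₁ β : ℂ) (ν : Fin 4) (x : ℂ) : ℂ :=
  ![2 * ∑' n : ℕ, (-1) ^ n *
        Complex.exp (tau ω₁ β * Real.pi * Complex.I * ((n : ℂ) + 1 / 2) ^ 2) *
        Complex.sin ((2 * n + 1) * x / radius ω₁),
    2 * ∑' n : ℕ,
        Complex.exp (tau ω₁ β * Real.pi * Complex.I * ((n : ℂ) + 1 / 2) ^ 2) *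
        Complex.cos ((2 * n + 1) * x / radius ω₁),
    1 + 2 * ∑' n : ℕ,
        Complex.exp (tau ω₁ β * Real.pi * Complex.I * ((n : ℂ) + 1) ^ 2) *
        Complex.cos (2 * (n + 1) * x / radius ω₁),
    1 + 2 * ∑' n : ℕ, (-1) ^ (n + 1) *
        Complex.exp (tau ω₁ β * Real.pi * Complex.I * ((n : ℂ) + 1) ^ 2) *
        Complex.cos (2 * (n + 1) * x / radius ω₁)] ν

/-! ### Complex powers -/

/-- `P` is a (continuous, single-valued) branch of the power `f ^ a` on `U`: near each point of `U`
it is `exp (a * ℓ)` for a logarithm `ℓ` of `f` that is continuous at the point. In particular `f`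
has no zero on `U`. -/
def IsPowerBranchOn {E : Type*} [TopologicalSpace E] (P f : E → ℂ) (a : ℂ) (U : Set E) : Prop :=
  ∀ p ∈ U, ∃ ℓ : E → ℂ, ContinuousAt ℓ p ∧
    ∀ᶠ q in nhds p, Complex.exp (ℓ q) = f q ∧ P q = Complex.exp (a * ℓ q)

/-! ### Coupling parameters, the operator, the function and the constant -/

variable {N : ℕ}

/-- `g_{ν,J} = m_J d_ν + (λ / 2) m_J²`. -/
def coupling (lam : ℂ) (d : Fin 4 → ℂ) (m : Fin N → ℂ) (ν : Fin 4) (J : Fin N) : ℂ :=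
  m J * d ν + lam / 2 * m J ^ 2

/-- `γ_{J,K} = λ (m_J + m_K) (λ m_J m_K - 1)`. -/
def pairCoupling (lam : ℂ) (m : Fin N → ℂ) (J K : Fin N) : ℂ :=
  lam * (m J + m K) * (lam * m J * m K - 1)

/-- The generalized Inozemtsev operator `𝓗`, applied to a function `F` of `X`. -/
def inozemtsev (L : PeriodPair) (lam : ℂ) (d : Fin 4 → ℂ) (m : Fin N → ℂ)
    (F : (Fin N → ℂ) → ℂ) (X : Fin N → ℂ) : ℂ :=
  (∑ J, 1 / m J *
    (-iteratedDeriv 2 (fun t : ℂ => F (Function.update X J t)) (X J) +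
      (∑ ν, coupling lam d m ν J * (coupling lam d m ν J - 1) *
        L.weierstrassP (X J + halfPeriod L ν)) * F X)) +
  (∑ J, ∑ K ∈ Finset.Ioi J, pairCoupling lam m J K *
    (L.weierstrassP (X J - X K) + L.weierstrassP (X J + X K))) * F X

/-- `Φ` is, on the set `U` of points `(β, X)`, the product
`∏_J ∏_ν θ_{ν+1}(X_J)^{g_{ν,J}} * ∏_{J<K} θ₁(X_J - X_K)^{m_J m_K λ} θ₁(X_J + X_K)^{m_J m_K λ}`,
for some choice of a branch of each of the powers. -/
def IsSourceFunction (ω₁ lam : ℂ) (d : Fin 4 → ℂ) (m : Fin N → ℂ)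
    (U : Set (ℂ × (Fin N → ℂ))) (Φ : ℂ × (Fin N → ℂ) → ℂ) : Prop :=
  ∃ (T : Fin 4 → Fin N → ℂ × (Fin N → ℂ) → ℂ) (S S' : Fin N → Fin N → ℂ × (Fin N → ℂ) → ℂ),
    (∀ ν J, IsPowerBranchOn (T ν J) (fun p => theta ω₁ p.1 ν (p.2 J)) (coupling lam d m ν J) U) ∧
    (∀ J K, J < K → IsPowerBranchOn (S J K) (fun p => theta ω₁ p.1 0 (p.2 J - p.2 K))
      (m J * m K * lam) U) ∧
    (∀ J K, J < K → IsPowerBranchOn (S' J K) (fun p => theta ω₁ p.1 0 (p.2 J + p.2 K))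
      (m J * m K * lam) U) ∧
    ∀ p ∈ U, Φ p = (∏ J, ∏ ν, T ν J p) * ∏ J, ∏ K ∈ Finset.Ioi J, (S J K p * S' J K p)

/-- The constant `𝓔₀`. -/
def energy (L : PeriodPair) (lam : ℂ) (d : Fin 4 → ℂ) (m : Fin N → ℂ) : ℂ :=
  (2 * lam * (∑ J, m J) + ∑ ν, d ν) *
      ((N : ℂ) - lam * ((∑ J, m J) ^ 2 + ∑ J, m J ^ 2) - (∑ J, m J) * (∑ ν, d ν)) *
      (eta L 1 / halfPeriod L 1) +
    (∑ J, m J) *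
      ((d 0 * d 1 + d 2 * d 3) * e L 1 + (d 0 * d 2 + d 1 * d 3) * e L 2 +
        (d 0 * d 3 + d 1 * d 2) * e L 3)

end SourceIdentity

end

open SourceIdentity

/-! Divide the equation by Φ₀. Let ℓ = θ₁'/θ₁ and let l_ν be the logarithmic derivative of θ_{ν+1};
up to an additive constant, l_ν is ℓ translated by ω_ν (`exists_theta_eq`). One has ℓ' = -η₁/ω₁ - ℘
(`IsOddTheta.hasDerivAt_logDeriv`), and the heat equation 2 ∂θ/∂β = ∂²θ/∂x² (`hasDerivAt_theta_fst`)
gives ∂(log θ₁)/∂β = (ℓ' + ℓ²)/2, and likewise for the other theta functions. So every derivative of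
Φ₀ is Φ₀ times a polynomial in values of ℓ, l_ν and ℘, the chosen branches drop out, and the theorem
becomes the algebraic identity `SourceRelations.identity`.

That identity rests on the addition theorem (ℓ(u+v) - ℓ(u) - ℓ(v))² = ℘(u) + ℘(v) + ℘(u+v)
(`IsOddTheta.sq_logDeriv_add`), which trades mixed products for squares and values of ℘. Add to each
X_J the image point -X_J with the same mass. Then ∂(log Φ₀)/∂X_J is m_J times Σ d_ν l_ν(X_J) plus λ
times the sum of μ_k ℓ(X_J - Y_k) over all 2𝒩 points; the interaction with the own image is ℓ(2X_J)
= ½ Σ l_ν(X_J), which is exactly the term λm_J²/2 of g_{ν,J}. In the weighted sum of the squares of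
these derivatives, the products ℓℓ are symmetrized over triples (`sum_mul_sq_sum`), the products lℓ
over pairs (`sum_mul_mul_sum`), and the products l_μ l_ν at one point are treated by the addition
theorem at half-periods (`sq_sum_mul_fin_four`). The remaining squares carry the factor |d| + 2λ|m|
and cancel against the β-derivative; the values of ℘ cancel against the potentials; the constants
are 𝓔₀.

The facts about θ₁ come from a dimension bound. Any three entire functions with the multipliers of
θ₁² are linearly dependent, because their Fourier coefficients obey a two-step recursion
(`IsSecondOrder.exists_linear_relation`). As θ² and θ²℘ are independent, θ(x+v)θ(x-v) and θθ'' - θ'²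
are explicit combinations of them: this is the sigma formula and the formula for ℓ'. Derivatives of
the sigma formula give the addition theorem and the duplication formula. -/

namespace SourceIdentity

/-! ### Fourier coefficients and the dimension bound for theta functions of second order. -/

open Complex MeasureTheory

/-- A shift of contour without contours: an entire g has a primitive G, and b ↦ G(1+b) - G(b) is
constant because its derivative is g(1+b) - g(b) = 0. The shift a may be complex. -/
theorem intervalIntegral_add_eq_of_periodic {g : ℂ → ℂ} (hg : Differentiable ℂ g)
    (hper : ∀ z, g (z + 1) = g z) (a : ℂ) :
    ∫ x : ℝ in (0 : ℝ)..1, g (x + a) = ∫ x : ℝ in (0 : ℝ)..1, g x := by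
  obtain ⟨G, hG⟩ := hg.isExactOn_univ
  have hG' : ∀ z, HasDerivAt G (g z) z := fun z => hG z (Set.mem_univ z)
  have key : ∀ b : ℂ, ∫ x : ℝ in (0 : ℝ)..1, g (x + b) = G (1 + b) - G b := by
    intro b
    have := intervalIntegral.integral_eq_sub_of_hasDerivAt (a := (0 : ℝ)) (b := 1)
      (f := fun x : ℝ => G (x + b)) (f' := fun x : ℝ => g (x + b))
      (fun x _ => by
        have h1 : HasDerivAt (fun z : ℂ => G (z + b)) (g (x + b)) x :=
          (hG' (x + b)).comp_add_const _ _
        exact h1.comp_ofReal)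
      (Continuous.intervalIntegrable (by have := hg.continuous; fun_prop) _ _)
    simpa using this
  have hconst : ∀ b c : ℂ, G (1 + b) - G b = G (1 + c) - G c := by
    refine is_const_of_deriv_eq_zero (f := fun b => G (1 + b) - G b) ?_ ?_
    · intro b
      exact (((hG' (1 + b)).comp_const_add _ _).sub (hG' b)).differentiableAt
    · intro b
      have h := (((hG' (1 + b)).comp_const_add _ _).fun_sub (hG' b)).deriv
      rw [h, add_comm, hper, sub_self]
  have h0 := key 0
  simp only [add_zero] at h0
  rw [key a, h0, hconst a 0]
  simp

/-- The Fourier coefficient of index `n` of a function of period `1`. -/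
noncomputable def fourierInt (h : ℂ → ℂ) (n : ℤ) : ℂ :=
  ∫ x : ℝ in (0 : ℝ)..1, h x * exp (-(2 * Real.pi * I * n * x))

theorem exp_two_pi_mul_add_one (n : ℤ) (z : ℂ) :
    exp (-(2 * Real.pi * I * n * (z + 1))) = exp (-(2 * Real.pi * I * n * z)) := by
  have : -(2 * Real.pi * I * n * (z + 1)) =
      -(2 * Real.pi * I * n * z) + ((-n : ℤ) : ℂ) * (2 * Real.pi * I) := by
    push_cast; ring
  rw [this, exp_add, exp_int_mul_two_pi_mul_I, mul_one]

/-- Moving the segment of integration by τ brings in the multiplier, whose exponential factor raises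
the index by k. -/
theorem fourierInt_shift {h : ℂ → ℂ} (hd : Differentiable ℂ h) (h1 : ∀ z, h (z + 1) = h z)
    {τ C : ℂ} (k : ℤ) (hτ : ∀ z, h (z + τ) = C * exp (-(2 * Real.pi * I * k * z)) * h z) (n : ℤ) :
    fourierInt h n = C * exp (-(2 * Real.pi * I * n * τ)) * fourierInt h (n + k) := by
  have hs := intervalIntegral_add_eq_of_periodic
    (g := fun z => h z * exp (-(2 * Real.pi * I * n * z))) (by fun_prop)
    (fun z => by simp only [h1, exp_two_pi_mul_add_one]) τ
  rw [fourierInt, ← hs, fourierInt, ← intervalIntegral.integral_const_mul]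
  congr 1 with x
  rw [hτ]
  have : exp (-(2 * Real.pi * I * n * (x + τ))) * exp (-(2 * Real.pi * I * k * x)) =
      exp (-(2 * Real.pi * I * n * τ)) * exp (-(2 * Real.pi * I * (n + k : ℤ) * x)) := by
    rw [← exp_add, ← exp_add]
    congr 1
    push_cast
    ring
  linear_combination C * h x * this

/-- Vanishing coefficients are summable, so the Fourier series converges pointwise to h on the real
line; the identity theorem carries h = 0 to the whole plane. -/
theorem eq_zero_of_fourierInt_eq_zero {h : ℂ → ℂ} (hd : Differentiable ℂ h)
    (h1 : ∀ z, h (z + 1) = h z) (hc : ∀ n, fourierInt h n = 0) (z : ℂ) : h z = 0 := by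
  have : Fact ((0 : ℝ) < 1) := ⟨one_pos⟩
  have hper : Function.Periodic (fun x : ℝ => h x) 1 := fun x => by
    simp only [ofReal_add, ofReal_one, h1]
  let f : C(AddCircle (1 : ℝ), ℂ) := ⟨hper.lift, by
    refine continuous_coinduced_dom.mpr ?_
    have := hd.continuous
    change Continuous (fun x : ℝ => h x)
    fun_prop⟩
  have hf : ∀ x : ℝ, f (x : AddCircle (1 : ℝ)) = h x := fun x => rfl
  have hcoef : fourierCoeff f = 0 := by
    funext n
    rw [fourierCoeff_eq_intervalIntegral _ n 0]
    have : ∫ x in (0 : ℝ)..0 + 1, (fourier (-n) (x : AddCircle (1 : ℝ)) : ℂ) • f x =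
        fourierInt h n := by
      rw [fourierInt, zero_add]
      congr 1 with x
      rw [hf, fourier_coe_apply, smul_eq_mul, mul_comm]
      congr 2
      push_cast
      ring
    rw [this, hc]
    simp
  have hreal : ∀ x : ℝ, h x = 0 := by
    intro x
    have hs := has_pointwise_sum_fourier_series_of_summable (f := f)
      (by rw [hcoef]; exact summable_zero) (x : AddCircle (1 : ℝ))
    rw [hcoef] at hs
    simp only [Pi.zero_apply, zero_smul] at hs
    rw [← hf]
    exact hs.unique hasSum_zero
  have hana : AnalyticOnNhd ℂ h Set.univ := hd.differentiableOn.analyticOnNhd isOpen_univ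
  have hfreq : ∃ᶠ w in nhdsWithin (0 : ℂ) {0}ᶜ, h w = (fun _ => (0 : ℂ)) w := by
    have ht : Filter.Tendsto (fun x : ℝ => (x : ℂ)) (nhdsWithin (0 : ℝ) {0}ᶜ)
        (nhdsWithin (0 : ℂ) {0}ᶜ) := by
      refine tendsto_nhdsWithin_iff.mpr ⟨?_, ?_⟩
      · have : Filter.Tendsto (fun x : ℝ => (x : ℂ)) (nhds 0) (nhds ((0 : ℝ) : ℂ)) :=
          continuous_ofReal.tendsto 0
        exact (by simpa using this : Filter.Tendsto (fun x : ℝ => (x : ℂ)) (nhds 0)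
          (nhds 0)).mono_left nhdsWithin_le_nhds
      · filter_upwards [self_mem_nhdsWithin] with x hx
        simpa using hx
    exact ht.frequently (Filter.Frequently.of_forall hreal)
  exact congrFun (hana.eq_of_frequently_eq (fun _ _ => analyticAt_const) hfreq) z

/-- The recursion ties the coefficient of index n to that of index n + 2 by a nonzero factor, so one
coefficient of each parity determines the rest. -/
theorem eq_zero_of_two_fourierInt_eq_zero {h : ℂ → ℂ} (hd : Differentiable ℂ h)
    (h1 : ∀ z, h (z + 1) = h z) {τ C : ℂ} (hC : C ≠ 0)
    (hτ : ∀ z, h (z + τ) = C * exp (-(2 * Real.pi * I * (2 : ℤ) * z)) * h z)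
    (c0 : fourierInt h 0 = 0) (c1 : fourierInt h 1 = 0) (z : ℂ) : h z = 0 := by
  refine eq_zero_of_fourierInt_eq_zero hd h1 ?_ z
  have hshift : ∀ n, fourierInt h n = 0 ↔ fourierInt h (n + 2) = 0 := fun n => by
    rw [fourierInt_shift hd h1 2 hτ n]
    simp [hC]
  have hall : ∀ n : ℤ, fourierInt h n = 0 ∧ fourierInt h (n + 1) = 0 := by
    intro n
    induction n using Int.induction_on with
    | zero => exact ⟨c0, by simpa using c1⟩
    | succ k ih => exact ⟨ih.2, by have := (hshift _).mp ih.1; rwa [add_assoc]⟩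
    | pred k ih =>
      refine ⟨(hshift _).mpr ?_, by simpa using ih.1⟩
      have : (-(k : ℤ) - 1 + 2) = -k + 1 := by ring
      rw [this]
      exact ih.2
  exact fun n => (hall n).1

/-- The entire functions with period `p` and multiplier `C * exp (-4 π i x / p)` for `q`: theta
functions of second order. -/
structure IsSecondOrder (p q C : ℂ) (f : ℂ → ℂ) : Prop where
  differentiable : Differentiable ℂ f
  add_fst : ∀ x, f (x + p) = f x
  add_snd : ∀ x, f (x + q) = C * exp (-(4 * Real.pi * I * x / p)) * f x

/-- The map from three coefficients to the Fourier coefficients 0 and 1 of the combination goes from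
dimension 3 to dimension 2, so it has a kernel. The variable is rescaled to z = x/p, with τ = q/p.
-/
theorem IsSecondOrder.exists_linear_relation {p q C : ℂ} (hp : p ≠ 0) (hC : C ≠ 0)
    {f : Fin 3 → ℂ → ℂ} (hf : ∀ i, IsSecondOrder p q C (f i)) :
    ∃ c : Fin 3 → ℂ, c ≠ 0 ∧ ∀ x, ∑ i, c i * f i x = 0 := by
  let Λ : (Fin 3 → ℂ) →ₗ[ℂ] (Fin 2 → ℂ) := Matrix.mulVecLin
    (Matrix.of fun (j : Fin 2) (i : Fin 3) => fourierInt (fun z => f i (p * z)) (j : ℕ))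
  have hker : LinearMap.ker Λ ≠ ⊥ := LinearMap.ker_ne_bot_of_finrank_lt (by simp)
  obtain ⟨c, hcmem, hc0⟩ := (Submodule.ne_bot_iff _).mp hker
  refine ⟨c, hc0, fun x => ?_⟩
  set h : ℂ → ℂ := fun z => ∑ i, c i * f i (p * z) with hh
  have hcoef : ∀ n : ℤ, fourierInt h n = ∑ i, c i * fourierInt (fun z => f i (p * z)) n := by
    intro n
    simp only [fourierInt, hh, Finset.sum_mul, mul_assoc]
    rw [intervalIntegral.integral_finsetSum]
    · simp only [intervalIntegral.integral_const_mul]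
    · intro i _
      refine Continuous.intervalIntegrable ?_ _ _
      have := (hf i).differentiable.continuous
      fun_prop
  have hz : ∀ j : Fin 2, fourierInt h ((j : ℕ) : ℤ) = 0 := by
    intro j
    have hj : Λ c = 0 := hcmem
    have hj' := congrFun hj j
    simp only [Λ, Matrix.mulVecLin_apply, Matrix.mulVec, dotProduct, Matrix.of_apply,
      Pi.zero_apply] at hj'
    rw [hcoef, ← hj']
    exact Finset.sum_congr rfl fun i _ => mul_comm _ _
  have key := eq_zero_of_two_fourierInt_eq_zero (h := h) (τ := q / p) (C := C) ?_ ?_ hC ?_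
    (by simpa using hz 0) (by simpa using hz 1) (x / p)
  · simpa [hh, mul_div_cancel₀ _ hp, mul_div_cancel_left₀, mul_div_assoc', hp] using key
  · have := fun i => (hf i).differentiable
    fun_prop
  · intro z
    simp only [hh, mul_add, mul_one, (hf _).add_fst]
  · intro z
    simp only [hh, Finset.mul_sum]
    refine Finset.sum_congr rfl fun i _ => ?_
    rw [show p * (z + q / p) = p * z + q by field_simp, (hf i).add_snd,
      show 4 * Real.pi * I * (p * z) / p = 2 * Real.pi * I * (2 : ℤ) * z by
        push_cast; field_simp; ring]
    ring

end SourceIdentity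

/-! ### The odd theta function: zeros, sigma formula, derivative of the logarithmic derivative. -/

namespace SourceIdentity

open Complex PeriodPair Filter Topology

/-- The properties that characterize the Jacobi function `θ₁`, for the periods `L.ω₁`, `L.ω₂`. -/
structure IsOddTheta (L : PeriodPair) (θ : ℂ → ℂ) : Prop where
  differentiable : Differentiable ℂ θ
  neg : ∀ x, θ (-x) = -θ x
  add_fst : ∀ x, θ (x + L.ω₁) = -θ x
  add_snd : ∀ x, θ (x + L.ω₂) = -exp (-(Real.pi * I * (2 * x + L.ω₂) / L.ω₁)) * θ x
  exists_ne_zero : ∃ x, θ x ≠ 0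

theorem _root_.PeriodPair.ω₁_ne_zero (L : PeriodPair) : L.ω₁ ≠ 0 := by
  intro h
  exact L.ω₁_div_two_notMem_lattice (by simp [h])

namespace IsOddTheta

variable {L : PeriodPair} {θ : ℂ → ℂ}

/-- The shifts with a multiplier of the form exp(ax + b) form a subgroup, and both periods belong to
it. -/
theorem exists_multiplier (h : IsOddTheta L θ) {l : ℂ} (hl : l ∈ L.lattice) :
    ∃ a b : ℂ, ∀ x, θ (x + l) = exp (a * x + b) * θ x := by
  let S : AddSubgroup ℂ :=
    { carrier := {l | ∃ a b : ℂ, ∀ x, θ (x + l) = exp (a * x + b) * θ x}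
      zero_mem' := ⟨0, 0, by simp⟩
      add_mem' := by
        rintro l k ⟨a, b, hab⟩ ⟨c, d, hcd⟩
        refine ⟨c + a, c * l + d + b, fun x => ?_⟩
        rw [← add_assoc, hcd, hab, ← mul_assoc, ← exp_add]
        ring_nf
      neg_mem' := by
        rintro l ⟨a, b, hab⟩
        refine ⟨-a, a * l - b, fun x => ?_⟩
        have := hab (x + -l)
        rw [neg_add_cancel_right] at this
        rw [this, ← mul_assoc, ← exp_add]
        ring_nf
        simp }
  have h1 : L.ω₁ ∈ S := ⟨0, Real.pi * I, fun x => by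
    simp [h.add_fst, exp_pi_mul_I]⟩
  have h2 : L.ω₂ ∈ S := ⟨-(2 * Real.pi * I / L.ω₁),
    -(Real.pi * I * L.ω₂ / L.ω₁) + Real.pi * I, fun x => by
    rw [h.add_snd, ← add_assoc, exp_add, exp_pi_mul_I]
    ring_nf⟩
  obtain ⟨m, n, rfl⟩ := mem_lattice.mp hl
  have := S.add_mem (S.zsmul_mem h1 m) (S.zsmul_mem h2 n)
  have h3 : (m : ℂ) * L.ω₁ + n * L.ω₂ ∈ S := by simpa using this
  exact h3

theorem zero (h : IsOddTheta L θ) : θ 0 = 0 := by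
  have := h.neg 0
  rw [neg_zero] at this
  exact self_eq_neg.mp this

theorem eq_zero_of_mem (h : IsOddTheta L θ) {l : ℂ} (hl : l ∈ L.lattice) : θ l = 0 := by
  obtain ⟨a, b, hab⟩ := h.exists_multiplier hl
  have := hab 0
  rwa [zero_add, h.zero, mul_zero] at this

theorem notMem_of_ne_zero (h : IsOddTheta L θ) {x : ℂ} (hx : θ x ≠ 0) : x ∉ L.lattice :=
  fun hm => hx (h.eq_zero_of_mem hm)

theorem analyticOnNhd (h : IsOddTheta L θ) : AnalyticOnNhd ℂ θ Set.univ :=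
  h.differentiable.differentiableOn.analyticOnNhd isOpen_univ

theorem deriv_differentiable (h : IsOddTheta L θ) : Differentiable ℂ (deriv θ) := fun x =>
  (h.analyticOnNhd.deriv x (Set.mem_univ x)).differentiableAt

theorem deriv_add (h : IsOddTheta L θ) {l a b : ℂ}
    (hab : ∀ x, θ (x + l) = exp (a * x + b) * θ x) (x : ℂ) :
    deriv θ (x + l) = exp (a * x + b) * (deriv θ x + a * θ x) := by
  have h1 : HasDerivAt (fun x => θ (x + l)) (deriv θ (x + l)) x :=
    (h.differentiable (x + l)).hasDerivAt.comp_add_const _ _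
  have h2 : HasDerivAt (fun x => exp (a * x + b) * θ x)
      (exp (a * x + b) * (a * 1) * θ x + exp (a * x + b) * deriv θ x) x :=
    (((hasDerivAt_id x).const_mul a).add_const b).cexp.mul (h.differentiable x).hasDerivAt
  rw [← funext hab] at h2
  rw [h1.unique h2]
  ring

theorem deriv_deriv_add (h : IsOddTheta L θ) {l a b : ℂ}
    (hab : ∀ x, θ (x + l) = exp (a * x + b) * θ x) (x : ℂ) :
    deriv (deriv θ) (x + l) =
      exp (a * x + b) * (deriv (deriv θ) x + 2 * a * deriv θ x + a ^ 2 * θ x) := by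
  have h1 : HasDerivAt (fun x => deriv θ (x + l)) (deriv (deriv θ) (x + l)) x :=
    (h.deriv_differentiable (x + l)).hasDerivAt.comp_add_const _ _
  have h2 : HasDerivAt (fun x => exp (a * x + b) * (deriv θ x + a * θ x))
      (exp (a * x + b) * (a * 1) * (deriv θ x + a * θ x) +
        exp (a * x + b) * (deriv (deriv θ) x + a * deriv θ x)) x :=
    (((hasDerivAt_id x).const_mul a).add_const b).cexp.mul
      ((h.deriv_differentiable x).hasDerivAt.add ((h.differentiable x).hasDerivAt.const_mul a))
  rw [← funext (h.deriv_add hab)] at h2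
  rw [h1.unique h2]
  ring

end IsOddTheta

theorem _root_.PeriodPair.isOpen_compl_lattice (L : PeriodPair) :
    IsOpen ((L.lattice : Set ℂ)ᶜ) := L.isClosed_lattice.isOpen_compl

theorem _root_.PeriodPair.eventually_notMem (L : PeriodPair) {x : ℂ} (hx : x ∉ L.lattice) :
    ∀ᶠ z in 𝓝 x, z ∉ L.lattice := L.isOpen_compl_lattice.mem_nhds hx

theorem _root_.PeriodPair.eventually_punctured_notMem (L : PeriodPair) (x : ℂ) :
    ∀ᶠ z in 𝓝[≠] x, z ∉ L.lattice := by
  have := L.compl_lattice_sdiff_singleton_mem_nhds x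
  filter_upwards [mem_nhdsWithin_of_mem_nhds this, self_mem_nhdsWithin] with z hz hz' hm
  exact hz ⟨hm, hz'⟩

theorem _root_.PeriodPair.differentiableAt_weierstrassP (L : PeriodPair) {x : ℂ}
    (hx : x ∉ L.lattice) : DifferentiableAt ℂ ℘[L] x :=
  L.differentiableOn_weierstrassP.differentiableAt (L.isOpen_compl_lattice.mem_nhds hx)

open Classical in
/-- The entire function `θ² ℘`. -/
noncomputable def sqMulWeierstrassP (L : PeriodPair) (θ : ℂ → ℂ) (z : ℂ) : ℂ :=
  if z ∈ L.lattice then deriv θ z ^ 2 else θ z ^ 2 * ℘[L] z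

namespace IsOddTheta

variable {L : PeriodPair} {θ : ℂ → ℂ}

/-- At a lattice point z write θ(w) = (w - z)φ(w) with φ the difference quotient. The double pole of
℘ leaves φ², whose value at z is θ'(z)²; this explains the value chosen on the lattice. -/
theorem sqMulWeierstrassP_differentiable (h : IsOddTheta L θ) :
    Differentiable ℂ (sqMulWeierstrassP L θ) := by
  intro z
  by_cases hz : z ∈ L.lattice
  · have hφ : Differentiable ℂ (dslope θ z) := by
      rw [← differentiableOn_univ]
      exact (differentiableOn_dslope (Filter.univ_mem)).mpr h.differentiable.differentiableOn
    have hP : DifferentiableAt ℂ ℘[L - z] z :=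
      (L.differentiableOn_weierstrassPExcept z).differentiableAt
        (L.compl_lattice_sdiff_singleton_mem_nhds z)
    have hd : DifferentiableAt ℂ
        (fun w => θ w ^ 2 * (℘[L - z] w - 1 / z ^ 2) + dslope θ z w ^ 2) z := by
      have := h.differentiable z
      have := hφ z
      fun_prop
    refine hd.congr_of_eventuallyEq ?_
    have hev := L.eventually_punctured_notMem z
    rw [eventually_nhdsWithin_iff] at hev
    filter_upwards [hev] with w hw
    by_cases hwz : w = z
    · subst hwz
      simp [sqMulWeierstrassP, hz, h.eq_zero_of_mem hz]
    · have hθ : θ w = (w - z) * dslope θ z w := by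
        rw [dslope_of_ne _ hwz, slope_def_field, h.eq_zero_of_mem hz, sub_zero,
          mul_div_cancel₀ _ (sub_ne_zero.mpr hwz)]
      have := sub_ne_zero.mpr hwz
      have hPe := L.weierstrassPExcept_add ⟨z, hz⟩ w
      simp only at hPe
      rw [sqMulWeierstrassP, if_neg (hw hwz), ← hPe, hθ]
      field_simp
      ring
  · have hd : DifferentiableAt ℂ (fun w => θ w ^ 2 * ℘[L] w) z :=
      ((h.differentiable z).pow 2).mul (L.differentiableAt_weierstrassP hz)
    refine hd.congr_of_eventuallyEq ?_
    filter_upwards [L.eventually_notMem hz] with w hw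
    rw [sqMulWeierstrassP, if_neg hw]

theorem sqMulWeierstrassP_add (h : IsOddTheta L θ) {l a b : ℂ} (hl : l ∈ L.lattice)
    (hab : ∀ x, θ (x + l) = exp (a * x + b) * θ x) (x : ℂ) :
    sqMulWeierstrassP L θ (x + l) = exp (a * x + b) ^ 2 * sqMulWeierstrassP L θ x := by
  by_cases hx : x ∈ L.lattice
  · rw [sqMulWeierstrassP, if_pos (add_mem hx hl), sqMulWeierstrassP, if_pos hx,
      h.deriv_add hab, h.eq_zero_of_mem hx]
    ring
  · have hx' : x + l ∉ L.lattice := fun hm => hx ((add_mem_cancel_right hl).mp hm)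
    have hP := L.weierstrassP_add_coe x ⟨l, hl⟩
    simp only at hP
    rw [sqMulWeierstrassP, if_neg hx', sqMulWeierstrassP, if_neg hx, hab, hP]
    ring

theorem mult_fst (h : IsOddTheta L θ) (x : ℂ) :
    θ (x + L.ω₁) = exp (0 * x + Real.pi * I) * θ x := by
  simp [h.add_fst, exp_pi_mul_I]

theorem mult_snd (h : IsOddTheta L θ) (x : ℂ) :
    θ (x + L.ω₂) = exp (-(2 * Real.pi * I / L.ω₁) * x +
      (-(Real.pi * I * L.ω₂ / L.ω₁) + Real.pi * I)) * θ x := by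
  rw [h.add_snd, ← add_assoc, exp_add, exp_pi_mul_I]
  ring_nf

/-- Second order theta functions with the multipliers of `θ²`. -/
abbrev SecondOrder (L : PeriodPair) (f : ℂ → ℂ) : Prop :=
  IsSecondOrder L.ω₁ L.ω₂ (exp (-(2 * Real.pi * I * L.ω₂ / L.ω₁))) f

theorem sq_mult_fst (x : ℂ) : exp (0 * x + Real.pi * I) ^ 2 = 1 := by
  simp [exp_pi_mul_I]

theorem sq_mult_snd (x : ℂ) :
    exp (-(2 * Real.pi * I / L.ω₁) * x + (-(Real.pi * I * L.ω₂ / L.ω₁) + Real.pi * I)) ^ 2 =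
      exp (-(2 * Real.pi * I * L.ω₂ / L.ω₁)) * exp (-(4 * Real.pi * I * x / L.ω₁)) := by
  rw [← add_assoc, exp_add, exp_pi_mul_I, mul_pow, ← exp_nat_mul, ← exp_add]
  have := L.ω₁_ne_zero
  simp only [even_two, Even.neg_pow, one_pow, mul_one]
  congr 1
  field_simp
  push_cast
  ring

theorem secondOrder_of_mult {f : ℂ → ℂ} (hf : Differentiable ℂ f)
    (h1 : ∀ x, f (x + L.ω₁) = exp (0 * x + Real.pi * I) ^ 2 * f x)
    (h2 : ∀ x, f (x + L.ω₂) = exp (-(2 * Real.pi * I / L.ω₁) * x +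
      (-(Real.pi * I * L.ω₂ / L.ω₁) + Real.pi * I)) ^ 2 * f x) : SecondOrder L f where
  differentiable := hf
  add_fst x := by rw [h1, sq_mult_fst, one_mul]
  add_snd x := by rw [h2, sq_mult_snd]

theorem secondOrder_sqMulWeierstrassP (h : IsOddTheta L θ) :
    SecondOrder L (sqMulWeierstrassP L θ) :=
  secondOrder_of_mult h.sqMulWeierstrassP_differentiable
    (h.sqMulWeierstrassP_add L.ω₁_mem_lattice h.mult_fst)
    (h.sqMulWeierstrassP_add L.ω₂_mem_lattice h.mult_snd)

theorem secondOrder_sq (h : IsOddTheta L θ) : SecondOrder L (fun x => θ x ^ 2) :=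
  secondOrder_of_mult (h.differentiable.pow 2) (fun x => by rw [h.mult_fst, mul_pow])
    (fun x => by rw [h.mult_snd, mul_pow])

theorem secondOrder_wronskian (h : IsOddTheta L θ) :
    SecondOrder L (fun x => θ x * deriv (deriv θ) x - deriv θ x ^ 2) :=
  secondOrder_of_mult ((h.differentiable.mul
      (fun x => (h.analyticOnNhd.deriv.deriv x (Set.mem_univ x)).differentiableAt)).sub
      (h.deriv_differentiable.pow 2))
    (fun x => by
      rw [h.mult_fst, h.deriv_add h.mult_fst, h.deriv_deriv_add h.mult_fst]; ring)
    (fun x => by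
      rw [h.mult_snd, h.deriv_add h.mult_snd, h.deriv_deriv_add h.mult_snd]; ring)

theorem secondOrder_mul_translates (h : IsOddTheta L θ) (v : ℂ) :
    SecondOrder L (fun x => θ (x + v) * θ (x - v)) where
  differentiable := by have := h.differentiable; fun_prop
  add_fst x := by
    rw [add_right_comm, h.add_fst, add_sub_right_comm, h.add_fst]; ring
  add_snd x := by
    rw [← sq_mult_snd, add_right_comm, h.mult_snd, add_sub_right_comm, h.mult_snd, sq, ← exp_add,
      mul_mul_mul_comm, ← exp_add]
    ring_nf

theorem eventually_ne_zero (h : IsOddTheta L θ) (x : ℂ) : ∀ᶠ z in 𝓝[≠] x, θ z ≠ 0 := by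
  rcases (h.analyticOnNhd x (Set.mem_univ x)).eventually_eq_zero_or_eventually_ne_zero with h0 | h0
  · obtain ⟨y, hy⟩ := h.exists_ne_zero
    exact absurd (congrFun (h.analyticOnNhd.eq_of_eventuallyEq (g := fun _ => 0)
      (fun _ _ => analyticAt_const) h0) y) hy
  · exact h0

theorem tendsto_sq_mul_weierstrassP (L : PeriodPair) :
    Tendsto (fun z => z ^ 2 * ℘[L] z) (𝓝[≠] 0) (𝓝 1) := by
  have hP : ContinuousAt (L.weierstrassPExcept 0) 0 :=
    ((L.differentiableOn_weierstrassPExcept 0).differentiableAt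
      (L.compl_lattice_sdiff_singleton_mem_nhds 0)).continuousAt
  have hc : ContinuousAt (fun z => z ^ 2 * L.weierstrassPExcept 0 z + 1) 0 := by fun_prop
  have ht : Tendsto (fun z => z ^ 2 * L.weierstrassPExcept 0 z + 1) (𝓝[≠] 0) (𝓝 1) := by
    simpa using hc.tendsto.mono_left nhdsWithin_le_nhds
  refine ht.congr' ?_
  filter_upwards [self_mem_nhdsWithin] with z hz
  have hz' : z ≠ 0 := hz
  have hPe := L.weierstrassPExcept_add ⟨0, zero_mem _⟩ z
  simp only at hPe
  -- The term of ℘ for l = 0 is 1/z² - 1/0², and the second fraction has the default value 0.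
  have h0 : (1 : ℂ) / 0 ^ 2 = 0 := by simp
  rw [← hPe, sub_zero, h0, sub_zero]
  field_simp

theorem weierstrassP_linear_relation {a b : ℂ}
    (hab : ∀ᶠ z in 𝓝[≠] (0 : ℂ), a + b * ℘[L] z = 0) : a = 0 ∧ b = 0 := by
  have ht : Tendsto (fun z : ℂ => z ^ 2 * (a + b * ℘[L] z)) (𝓝[≠] 0) (𝓝 b) := by
    have h1 : Tendsto (fun z : ℂ => z ^ 2 * a) (𝓝[≠] 0) (𝓝 0) := by
      have : ContinuousAt (fun z : ℂ => z ^ 2 * a) 0 := by fun_prop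
      simpa using this.tendsto.mono_left nhdsWithin_le_nhds
    have := h1.add ((tendsto_sq_mul_weierstrassP L).const_mul b)
    rw [zero_add, mul_one] at this
    refine this.congr fun z => by ring
  have hb : b = 0 := by
    refine tendsto_nhds_unique (ht.congr' ?_) tendsto_const_nhds
    filter_upwards [hab] with z hz
    rw [hz, mul_zero]
  subst hb
  obtain ⟨z, hz⟩ := hab.exists
  exact ⟨by simpa using hz, rfl⟩

/-- f, θ² and θ²℘ are linearly dependent, and f occurs in the relation because 1 and ℘ are
independent near the pole 0. The value at 0, where θ² vanishes and θ²℘ is continued by θ'(0)²,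
identifies the coefficient β. -/
theorem exists_eq_sq_mul (h : IsOddTheta L θ) {f : ℂ → ℂ} (hf : SecondOrder L f) :
    ∃ α β : ℂ, (∀ x, x ∉ L.lattice → f x = θ x ^ 2 * (α + β * ℘[L] x)) ∧
      f 0 = β * deriv θ 0 ^ 2 := by
  obtain ⟨c, hc, hrel⟩ := IsSecondOrder.exists_linear_relation L.ω₁_ne_zero (exp_ne_zero _)
    (f := ![f, fun x => θ x ^ 2, sqMulWeierstrassP L θ]) (by
      intro i
      fin_cases i
      · exact hf
      · exact h.secondOrder_sq
      · exact h.secondOrder_sqMulWeierstrassP)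
  simp only [Fin.sum_univ_three, Matrix.cons_val_zero, Matrix.cons_val_one, Matrix.cons_val]
    at hrel
  have hoff : ∀ x, x ∉ L.lattice → c 0 * f x + θ x ^ 2 * (c 1 + c 2 * ℘[L] x) = 0 := by
    intro x hx
    have := hrel x
    rw [sqMulWeierstrassP, if_neg hx] at this
    linear_combination this
  have hc0 : c 0 ≠ 0 := by
    intro h0
    have : c 1 = 0 ∧ c 2 = 0 := by
      refine weierstrassP_linear_relation (L := L) ?_
      filter_upwards [h.eventually_ne_zero 0, L.eventually_punctured_notMem 0] with z hz hz'
      have := hoff z hz'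
      rw [h0, zero_mul, zero_add] at this
      exact (mul_eq_zero.mp this).resolve_left (pow_ne_zero 2 hz)
    refine hc (funext fun i => ?_)
    fin_cases i
    · exact h0
    · exact this.1
    · exact this.2
  refine ⟨-c 1 / c 0, -c 2 / c 0, fun x hx => ?_, ?_⟩
  · have := hoff x hx
    field_simp
    linear_combination this
  · have := hrel 0
    rw [sqMulWeierstrassP, if_pos (zero_mem _), h.zero] at this
    field_simp
    linear_combination this

/-- For f(x) = θ(x+v)θ(x-v), the value f(0) = -θ(v)² gives β and the zero at x = v gives α. If θ'(0)
were 0, the first of these would force θ(v) = 0. -/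
theorem exists_sigma (h : IsOddTheta L θ) {v : ℂ} (hv : θ v ≠ 0) :
    deriv θ 0 ≠ 0 ∧ ∀ u, u ∉ L.lattice →
      deriv θ 0 ^ 2 * (θ (u + v) * θ (u - v)) = -θ u ^ 2 * θ v ^ 2 * (℘[L] u - ℘[L] v) := by
  obtain ⟨α, β, h1, h2⟩ := h.exists_eq_sq_mul (h.secondOrder_mul_translates v)
  simp only [zero_add, zero_sub, h.neg] at h2
  have hβ := h1 v (h.notMem_of_ne_zero hv)
  rw [sub_self, h.zero, mul_zero] at hβ
  have hα : α = -β * ℘[L] v := by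
    have := (mul_eq_zero.mp hβ.symm).resolve_left (pow_ne_zero 2 hv)
    linear_combination this
  refine ⟨fun h0 => hv ?_, fun u hu => ?_⟩
  · rw [h0] at h2
    simpa using h2
  · rw [h1 u hu, hα]
    linear_combination -θ u ^ 2 * (℘[L] u - ℘[L] v) * h2

theorem deriv_zero_ne_zero (h : IsOddTheta L θ) : deriv θ 0 ≠ 0 := by
  obtain ⟨v, hv⟩ := h.exists_ne_zero
  exact (h.exists_sigma hv).1

/-- A zero x off the lattice would, by the sigma formula, make the product θ(v)θ(x+v)θ(x-v) vanish
for all v, although none of these three entire functions is identically zero. No count of zeros is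
needed. -/
theorem eq_zero_iff (h : IsOddTheta L θ) {x : ℂ} : θ x = 0 ↔ x ∈ L.lattice := by
  refine ⟨fun hx => ?_, h.eq_zero_of_mem⟩
  by_contra hm
  have hprod : ∀ v, θ v * (θ (x + v) * θ (x - v)) = 0 := by
    intro v
    by_cases hv : θ v = 0
    · rw [hv, zero_mul]
    · have := (h.exists_sigma hv).2 x hm
      rw [hx] at this
      simpa [hv, h.deriv_zero_ne_zero] using this
  have hd := h.differentiable
  have e1 : AnalyticOnNhd ℂ (fun v => θ (x + v)) Set.univ :=
    Differentiable.differentiableOn (by fun_prop) |>.analyticOnNhd isOpen_univ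
  have e2 : AnalyticOnNhd ℂ (fun v => θ (x - v)) Set.univ :=
    Differentiable.differentiableOn (by fun_prop) |>.analyticOnNhd isOpen_univ
  obtain ⟨y, hy⟩ := h.exists_ne_zero
  rcases h.analyticOnNhd.eq_zero_or_eq_zero_of_mul_eq_zero (e1.mul e2)
    (fun v _ => hprod v) isPreconnected_univ with h0 | h0
  · exact hy (h0 y (Set.mem_univ y))
  · rcases e1.eq_zero_or_eq_zero_of_mul_eq_zero e2 h0 isPreconnected_univ with h0 | h0
    · exact hy (by simpa using h0 (y - x) (Set.mem_univ _))
    · exact hy (by simpa using h0 (x - y) (Set.mem_univ _))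

theorem ne_zero_iff (h : IsOddTheta L θ) {x : ℂ} : θ x ≠ 0 ↔ x ∉ L.lattice :=
  h.eq_zero_iff.not

theorem sigma (h : IsOddTheta L θ) {u v : ℂ} (hu : u ∉ L.lattice) (hv : v ∉ L.lattice) :
    deriv θ 0 ^ 2 * (θ (u + v) * θ (u - v)) = -θ u ^ 2 * θ v ^ 2 * (℘[L] u - ℘[L] v) :=
  (h.exists_sigma (h.ne_zero_iff.mpr hv)).2 u hu

theorem weierstrassP_ne (h : IsOddTheta L θ) {u v : ℂ} (hu : u ∉ L.lattice) (hv : v ∉ L.lattice)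
    (hs : u + v ∉ L.lattice) (hd : u - v ∉ L.lattice) : ℘[L] u - ℘[L] v ≠ 0 := by
  intro h0
  have := h.sigma hu hv
  rw [h0, mul_zero] at this
  simp [h.deriv_zero_ne_zero, h.ne_zero_iff.mpr hs, h.ne_zero_iff.mpr hd] at this

/-- The numerator θθ'' - θ'² of (θ'/θ)' is a theta function of second order with value -θ'(0)² at 0,
so its coefficient of θ²℘ is -1. The constant B is identified in `hasDerivAt_logDeriv`. -/
theorem exists_hasDerivAt_logDeriv (h : IsOddTheta L θ) :
    ∃ B : ℂ, ∀ x, x ∉ L.lattice → HasDerivAt (logDeriv θ) (B - ℘[L] x) x := by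
  obtain ⟨α, β, h1, h2⟩ := h.exists_eq_sq_mul h.secondOrder_wronskian
  have hβ : β = -1 := by
    rw [h.zero, zero_mul, zero_sub] at h2
    refine mul_right_cancel₀ (pow_ne_zero 2 h.deriv_zero_ne_zero) ?_
    linear_combination -h2
  refine ⟨α, fun x hx => ?_⟩
  have hθ := h.ne_zero_iff.mpr hx
  have := (h.deriv_differentiable x).hasDerivAt.div (h.differentiable x).hasDerivAt hθ
  refine this.congr_deriv ?_
  have := h1 x hx
  rw [hβ] at this
  field_simp
  linear_combination this

end IsOddTheta

end SourceIdentity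

/-! ### The addition theorem, half-periods and duplication. -/

namespace SourceIdentity

open Complex PeriodPair Filter Topology

theorem _root_.PeriodPair.hasDerivAt_weierstrassP (L : PeriodPair) {x : ℂ}
    (hx : x ∉ L.lattice) : HasDerivAt ℘[L] (℘'[L] x) x := by
  rw [← L.deriv_weierstrassP]
  exact (L.differentiableAt_weierstrassP hx).hasDerivAt

theorem _root_.PeriodPair.differentiableAt_derivWeierstrassP (L : PeriodPair) {x : ℂ}
    (hx : x ∉ L.lattice) : DifferentiableAt ℂ ℘'[L] x :=
  L.differentiableOn_derivWeierstrassP.differentiableAt (L.isOpen_compl_lattice.mem_nhds hx)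

theorem _root_.PeriodPair.eventually_punctured_two_mul_notMem (L : PeriodPair) (x : ℂ) :
    ∀ᶠ z in 𝓝[≠] x, 2 * z ∉ L.lattice := by
  have ht : Tendsto (fun z : ℂ => 2 * z) (𝓝[≠] x) (𝓝[≠] (2 * x)) := by
    refine tendsto_nhdsWithin_iff.mpr ⟨?_, ?_⟩
    · have : ContinuousAt (fun z : ℂ => 2 * z) x := by fun_prop
      exact this.tendsto.mono_left nhdsWithin_le_nhds
    · filter_upwards [self_mem_nhdsWithin] with z hz
      simpa using hz
  exact ht.eventually (L.eventually_punctured_notMem _)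

namespace IsOddTheta

variable {L : PeriodPair} {θ : ℂ → ℂ}

theorem hasDerivAt (h : IsOddTheta L θ) {x : ℂ} (hx : x ∉ L.lattice) :
    HasDerivAt θ (logDeriv θ x * θ x) x := by
  have := h.ne_zero_iff.mpr hx
  rw [logDeriv_apply, div_mul_cancel₀ _ this]
  exact (h.differentiable x).hasDerivAt

/-- The derivative of the sigma formula in u at u = v, where both sides vanish. -/
theorem theta_two_mul (h : IsOddTheta L θ) {v : ℂ} (hv : v ∉ L.lattice) :
    deriv θ 0 ^ 3 * θ (2 * v) = -θ v ^ 4 * ℘'[L] v := by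
  have hd : ∀ x, HasDerivAt θ (deriv θ x) x := fun x => (h.differentiable x).hasDerivAt
  have h1 : HasDerivAt (fun u => deriv θ 0 ^ 2 * (θ (u + v) * θ (u - v)))
      (deriv θ 0 ^ 2 * (deriv θ (v + v) * θ (v - v) + θ (v + v) * deriv θ (v - v))) v :=
    (((hd _).comp_add_const _ _).mul ((hd _).comp_sub_const _ _)).const_mul _
  have h2 : HasDerivAt (fun u => -(θ u ^ 2) * (θ v ^ 2) * (℘[L] u - ℘[L] v))
      (-((2 : ℕ) * θ v ^ (2 - 1) * deriv θ v) * θ v ^ 2 * (℘[L] v - ℘[L] v) +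
        -(θ v ^ 2) * θ v ^ 2 * ℘'[L] v) v :=
    ((((hd v).pow 2).neg.mul_const _)).mul ((L.hasDerivAt_weierstrassP hv).sub_const _)
  have heq : (fun u => deriv θ 0 ^ 2 * (θ (u + v) * θ (u - v))) =ᶠ[𝓝 v]
      (fun u => -(θ u ^ 2) * (θ v ^ 2) * (℘[L] u - ℘[L] v)) := by
    filter_upwards [L.eventually_notMem hv] with u hu
    rw [h.sigma hu hv]
  have := h1.unique (h2.congr_of_eventuallyEq heq)
  rw [sub_self, sub_self, h.zero, ← two_mul] at this
  linear_combination this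

theorem derivWeierstrassP_eq_zero_iff (h : IsOddTheta L θ) {v : ℂ} (hv : v ∉ L.lattice) :
    ℘'[L] v = 0 ↔ 2 * v ∈ L.lattice := by
  have h1 := h.theta_two_mul hv
  have h2 := h.ne_zero_iff.mpr hv
  rw [← h.eq_zero_iff]
  constructor
  · intro h0
    rw [h0, mul_zero] at h1
    simpa [h.deriv_zero_ne_zero] using h1
  · intro h0
    rw [h0, mul_zero] at h1
    simpa [h2] using h1.symm

/-- Differentiating the cubic equation of ℘ gives this after division by 2℘'. The zeros of ℘', the
points with 2x in the lattice, are isolated and are reached by continuity. -/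
theorem hasDerivAt_derivWeierstrassP (h : IsOddTheta L θ) {x : ℂ} (hx : x ∉ L.lattice) :
    HasDerivAt ℘'[L] (6 * ℘[L] x ^ 2 - L.g₂ / 2) x := by
  have hgen : ∀ z, z ∉ L.lattice → 2 * z ∉ L.lattice →
      deriv ℘'[L] z = 6 * ℘[L] z ^ 2 - L.g₂ / 2 := by
    intro z hz hz2
    have hne : ℘'[L] z ≠ 0 := (h.derivWeierstrassP_eq_zero_iff hz).not.mpr hz2
    have hP := L.hasDerivAt_weierstrassP hz
    have hP' := (L.differentiableAt_derivWeierstrassP hz).hasDerivAt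
    have h1 := hP'.fun_pow 2
    have h2 := (((hP.fun_pow 3).const_mul 4).fun_sub (hP.const_mul L.g₂)).sub_const L.g₃
    have heq : (fun w => ℘'[L] w ^ 2) =ᶠ[𝓝 z]
        (fun w => 4 * ℘[L] w ^ 3 - L.g₂ * ℘[L] w - L.g₃) := by
      filter_upwards [L.eventually_notMem hz] with w hw
      exact L.derivWeierstrassP_sq w hw
    have h3 := h1.unique (h2.congr_of_eventuallyEq heq)
    refine mul_left_cancel₀ (mul_ne_zero two_ne_zero hne) ?_
    push_cast at h3
    linear_combination h3
  have hP := (L.differentiableAt_weierstrassP hx).continuousAt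
  have hd := L.differentiableAt_derivWeierstrassP hx
  have hc : ContinuousAt (deriv ℘'[L]) x :=
    (L.analyticOnNhd_derivWeierstrassP x hx).deriv.continuousAt
  have hr : ContinuousAt (fun z => 6 * ℘[L] z ^ 2 - L.g₂ / 2) x := by fun_prop
  have : deriv ℘'[L] x = 6 * ℘[L] x ^ 2 - L.g₂ / 2 := by
    refine tendsto_nhds_unique (hc.tendsto.mono_left nhdsWithin_le_nhds)
      ((hr.tendsto.mono_left nhdsWithin_le_nhds).congr' ?_ : Tendsto _ (𝓝[≠] x) _)
    filter_upwards [L.eventually_punctured_notMem x, L.eventually_punctured_two_mul_notMem x]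
      with z hz hz2
    exact (hgen z hz hz2).symm
  rw [← this]
  exact hd.hasDerivAt

theorem deriv_neg_eq (h : IsOddTheta L θ) (x : ℂ) : deriv θ (-x) = deriv θ x := by
  have h1 : HasDerivAt (fun x => θ (-x)) (-deriv θ (-x)) x := by
    simpa [Function.comp_def] using
      (h.differentiable (-x)).hasDerivAt.comp x (hasDerivAt_neg x)
  rw [show (fun x => θ (-x)) = fun x => -θ x from funext h.neg] at h1
  exact neg_injective (h1.unique (h.differentiable x).hasDerivAt.neg)

theorem logDeriv_neg_eq (h : IsOddTheta L θ) (x : ℂ) : logDeriv θ (-x) = -logDeriv θ x := by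
  rw [logDeriv_apply, logDeriv_apply, h.deriv_neg_eq, h.neg, div_neg]

/-- The logarithmic derivative of the sigma formula in u, with denominators cleared. -/
theorem derivWeierstrassP_eq (h : IsOddTheta L θ) {u v : ℂ} (hu : u ∉ L.lattice)
    (hv : v ∉ L.lattice) (hs : u + v ∉ L.lattice) (hm : u - v ∉ L.lattice) :
    ℘'[L] u = (℘[L] u - ℘[L] v) *
      (logDeriv θ (u + v) + logDeriv θ (u - v) - 2 * logDeriv θ u) := by
  have h1 := (((h.hasDerivAt hs).comp_add_const _ _).fun_mul
    ((h.hasDerivAt hm).comp_sub_const _ _)).const_mul (deriv θ 0 ^ 2)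
  have h2 := (((h.hasDerivAt hu).fun_pow 2).fun_neg.mul_const (θ v ^ 2)).fun_mul
    ((L.hasDerivAt_weierstrassP hu).sub_const (℘[L] v))
  have heq : (fun u => deriv θ 0 ^ 2 * (θ (u + v) * θ (u - v))) =ᶠ[𝓝 u]
      (fun u => -(θ u ^ 2) * (θ v ^ 2) * (℘[L] u - ℘[L] v)) := by
    filter_upwards [L.eventually_notMem hu] with u hu
    rw [h.sigma hu hv]
  have h3 := h1.unique (h2.congr_of_eventuallyEq heq)
  have hσ := h.sigma hu hv
  have hu0 := h.ne_zero_iff.mpr hu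
  have hv0 := h.ne_zero_iff.mpr hv
  refine mul_left_cancel₀ (mul_ne_zero (pow_ne_zero 2 hu0) (pow_ne_zero 2 hv0)) ?_
  push_cast at h3
  linear_combination h3 - (logDeriv θ (u + v) + logDeriv θ (u - v)) * hσ

/-- Subtracting the previous formula with u and v exchanged removes the terms in u - v, since ℓ is
odd. -/
theorem derivWeierstrassP_sub (h : IsOddTheta L θ) {u v : ℂ} (hu : u ∉ L.lattice)
    (hv : v ∉ L.lattice) (hs : u + v ∉ L.lattice) (hm : u - v ∉ L.lattice) :
    ℘'[L] u - ℘'[L] v = 2 * (℘[L] u - ℘[L] v) *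
      (logDeriv θ (u + v) - logDeriv θ u - logDeriv θ v) := by
  have hm' : v - u ∉ L.lattice := by rwa [← neg_sub, neg_mem_iff]
  have h1 := h.derivWeierstrassP_eq hu hv hs hm
  have h2 := h.derivWeierstrassP_eq hv hu (by rwa [add_comm]) hm'
  rw [← neg_sub u v, h.logDeriv_neg_eq, add_comm v u] at h2
  linear_combination h1 - h2

/-- The u-derivative of `derivWeierstrassP_sub`. In the derivatives of ℓ(u+v) and ℓ(u) the unknown
constant B cancels. -/
theorem weierstrassP_deriv_addition (h : IsOddTheta L θ) {u v : ℂ} (hu : u ∉ L.lattice)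
    (hv : v ∉ L.lattice) (hs : u + v ∉ L.lattice) (hm : u - v ∉ L.lattice) :
    6 * ℘[L] u ^ 2 - L.g₂ / 2 =
      2 * ℘'[L] u * (logDeriv θ (u + v) - logDeriv θ u - logDeriv θ v) +
      2 * (℘[L] u - ℘[L] v) * (℘[L] u - ℘[L] (u + v)) := by
  obtain ⟨B, hB⟩ := h.exists_hasDerivAt_logDeriv
  have h1 := (h.hasDerivAt_derivWeierstrassP hu).sub_const (℘'[L] v)
  have h2 := (((L.hasDerivAt_weierstrassP hu).sub_const (℘[L] v)).const_mul 2).fun_mul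
    ((((hB _ hs).comp_add_const _ _).fun_sub (hB u hu)).sub_const (logDeriv θ v))
  have hs' : ∀ᶠ w in 𝓝 u, w + v ∉ L.lattice :=
    (by fun_prop : ContinuousAt (fun w => w + v) u).eventually (L.eventually_notMem hs)
  have hm' : ∀ᶠ w in 𝓝 u, w - v ∉ L.lattice :=
    (by fun_prop : ContinuousAt (fun w => w - v) u).eventually (L.eventually_notMem hm)
  have heq : (fun w => ℘'[L] w - ℘'[L] v) =ᶠ[𝓝 u] (fun w => 2 * (℘[L] w - ℘[L] v) *
      (logDeriv θ (w + v) - logDeriv θ w - logDeriv θ v)) := by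
    filter_upwards [L.eventually_notMem hu, hs', hm'] with w h1 h2 h3
    exact h.derivWeierstrassP_sub h1 hv h2 h3
  rw [h1.unique (h2.congr_of_eventuallyEq heq)]
  ring

/-- Exchange u and v in `weierstrassP_deriv_addition` and subtract; with `derivWeierstrassP_sub`
everything is divisible by 4(℘(u) - ℘(v)). -/
theorem sq_logDeriv_add_of_sub_notMem (h : IsOddTheta L θ) {u v : ℂ} (hu : u ∉ L.lattice)
    (hv : v ∉ L.lattice) (hs : u + v ∉ L.lattice) (hm : u - v ∉ L.lattice) :
    (logDeriv θ (u + v) - logDeriv θ u - logDeriv θ v) ^ 2 =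
      ℘[L] u + ℘[L] v + ℘[L] (u + v) := by
  have hm' : v - u ∉ L.lattice := by rwa [← neg_sub, neg_mem_iff]
  have h1 := h.weierstrassP_deriv_addition hu hv hs hm
  have h2 := h.weierstrassP_deriv_addition hv hu (by rwa [add_comm]) hm'
  have h3 := h.derivWeierstrassP_sub hu hv hs hm
  rw [add_comm v u] at h2
  have hΔ := h.weierstrassP_ne hu hv hs hm
  refine mul_left_cancel₀ (mul_ne_zero (by norm_num : (4 : ℂ) ≠ 0) hΔ) ?_
  linear_combination h2 - h1 - 2 * (logDeriv θ (u + v) - logDeriv θ u - logDeriv θ v) * h3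

/-- The addition theorem: `(ζ(u+v) - ζ(u) - ζ(v))² = ℘(u) + ℘(v) + ℘(u+v)`, in terms of the
logarithmic derivative of the theta function. -/
theorem sq_logDeriv_add (h : IsOddTheta L θ) {u v : ℂ} (hu : u ∉ L.lattice)
    (hv : v ∉ L.lattice) (hs : u + v ∉ L.lattice) :
    (logDeriv θ (u + v) - logDeriv θ u - logDeriv θ v) ^ 2 =
      ℘[L] u + ℘[L] v + ℘[L] (u + v) := by
  obtain ⟨B, hB⟩ := h.exists_hasDerivAt_logDeriv
  -- The condition on u - v was only needed to divide. Both sides are continuous in v, and nearby w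
  -- ≠ v satisfy u - w ∉ Λ.
  have hadd : ContinuousAt (fun w => u + w) v := by fun_prop
  have c1 : ContinuousAt (fun w => logDeriv θ (u + w)) v :=
    ContinuousAt.comp' (f := fun w => u + w) (hB _ hs).continuousAt hadd
  have c2 := (hB v hv).continuousAt
  have c3 : ContinuousAt (fun w => ℘[L] (u + w)) v :=
    ContinuousAt.comp' (f := fun w => u + w)
      (L.differentiableAt_weierstrassP hs).continuousAt hadd
  have c4 := (L.differentiableAt_weierstrassP hv).continuousAt
  have k1 : ContinuousAt
      (fun w => (logDeriv θ (u + w) - logDeriv θ u - logDeriv θ w) ^ 2) v := by fun_prop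
  have k2 : ContinuousAt (fun w => ℘[L] u + ℘[L] w + ℘[L] (u + w)) v := by fun_prop
  refine tendsto_nhds_unique (k1.tendsto.mono_left nhdsWithin_le_nhds)
    ((k2.tendsto.mono_left nhdsWithin_le_nhds).congr' ?_ : Tendsto _ (𝓝[≠] v) _)
  have hsub : ∀ᶠ w in 𝓝[≠] v, u - w ∉ L.lattice := by
    have ht : Tendsto (fun w : ℂ => u - w) (𝓝[≠] v) (𝓝[≠] (u - v)) := by
      refine tendsto_nhdsWithin_iff.mpr ⟨?_, ?_⟩
      · have : ContinuousAt (fun w : ℂ => u - w) v := by fun_prop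
        exact this.tendsto.mono_left nhdsWithin_le_nhds
      · filter_upwards [self_mem_nhdsWithin] with z hz
        simpa using hz
    exact ht.eventually (L.eventually_punctured_notMem _)
  filter_upwards [hsub, mem_nhdsWithin_of_mem_nhds (L.eventually_notMem hv),
    mem_nhdsWithin_of_mem_nhds (hadd.eventually (L.eventually_notMem hs))] with w h1 h2 h3
  exact (h.sq_logDeriv_add_of_sub_notMem hu h2 h3 h1).symm

theorem logDeriv_add_of_mult (h : IsOddTheta L θ) {l a b : ℂ}
    (hab : ∀ x, θ (x + l) = exp (a * x + b) * θ x) {x : ℂ} (hx : x ∉ L.lattice) :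
    logDeriv θ (x + l) = logDeriv θ x + a := by
  rw [logDeriv_apply, logDeriv_apply, h.deriv_add hab, hab,
    mul_div_mul_left _ _ (exp_ne_zero _), add_div, mul_div_cancel_right₀ _ (h.ne_zero_iff.mpr hx)]

theorem logDeriv_add_fst (h : IsOddTheta L θ) {x : ℂ} (hx : x ∉ L.lattice) :
    logDeriv θ (x + L.ω₁) = logDeriv θ x := by
  rw [h.logDeriv_add_of_mult h.mult_fst hx, add_zero]

theorem logDeriv_add_snd (h : IsOddTheta L θ) {x : ℂ} (hx : x ∉ L.lattice) :
    logDeriv θ (x + L.ω₂) = logDeriv θ x - 2 * (Real.pi * I / L.ω₁) := by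
  rw [h.logDeriv_add_of_mult h.mult_snd hx]
  ring

end IsOddTheta

/-! ### Half-periods -/

theorem halfPeriod_add_self_mem (L : PeriodPair) (ν : Fin 4) :
    2 * halfPeriod L ν ∈ L.lattice := by
  fin_cases ν
  · simp [halfPeriod]
  · simpa [halfPeriod, mul_div_cancel₀] using L.ω₁_mem_lattice
  · have := neg_mem (add_mem L.ω₁_mem_lattice L.ω₂_mem_lattice)
    have e : 2 * halfPeriod L 2 = -(L.ω₁ + L.ω₂) := by simp [halfPeriod]; ring
    exact e ▸ this
  · simpa [halfPeriod, mul_div_cancel₀] using L.ω₂_mem_lattice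

theorem _root_.PeriodPair.notMem_of_rat (L : PeriodPair) {x : ℂ} (a b : ℚ)
    (hx : x = a * L.ω₁ + b * L.ω₂) (hab : ¬(a.den = 1 ∧ b.den = 1)) : x ∉ L.lattice := by
  rw [hx, mul_ω₁_add_mul_ω₂_mem_lattice]
  exact hab

theorem halfPeriod_sub_notMem (L : PeriodPair) {μ ν : Fin 4} (h : μ ≠ ν) :
    halfPeriod L μ - halfPeriod L ν ∉ L.lattice := by
  refine L.notMem_of_rat ((![0, 1 / 2, -1 / 2, 0] : Fin 4 → ℚ) μ - ![0, 1 / 2, -1 / 2, 0] ν)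
    ((![0, 0, -1 / 2, 1 / 2] : Fin 4 → ℚ) μ - ![0, 0, -1 / 2, 1 / 2] ν) ?_ ?_
  · fin_cases μ <;> fin_cases ν <;> simp [halfPeriod] <;> ring
  · fin_cases μ <;> fin_cases ν <;> first | exact absurd rfl h | norm_num

theorem halfPeriod_add_notMem (L : PeriodPair) {μ ν : Fin 4} (h : μ ≠ ν) :
    halfPeriod L μ + halfPeriod L ν ∉ L.lattice := by
  intro hm
  refine halfPeriod_sub_notMem L h ?_
  have := sub_mem hm (halfPeriod_add_self_mem L ν)
  convert this using 1
  ring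

theorem halfPeriod_notMem (L : PeriodPair) {ν : Fin 4} (h : ν ≠ 0) :
    halfPeriod L ν ∉ L.lattice := by
  have := halfPeriod_sub_notMem L h
  simpa [halfPeriod] using this

/-- The logarithmic derivative of the exponential factor in
`θ_{ν+1}(x) = c * exp (k_ν x) * θ₁(x + ω_ν)`. -/
noncomputable def halfShift (L : PeriodPair) : Fin 4 → ℂ :=
  ![0, 0, -(Real.pi * I / L.ω₁), Real.pi * I / L.ω₁]

/-- The logarithmic derivative of `θ_{ν+1}`, in terms of `θ₁`. -/
noncomputable def thetaLog (L : PeriodPair) (θ : ℂ → ℂ) (ν : Fin 4) (x : ℂ) : ℂ :=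
  logDeriv θ (x + halfPeriod L ν) + halfShift L ν

@[simp] theorem thetaLog_zero (L : PeriodPair) (θ : ℂ → ℂ) (x : ℂ) :
    thetaLog L θ 0 x = logDeriv θ x := by
  simp [thetaLog, halfPeriod, halfShift]

namespace IsOddTheta

variable {L : PeriodPair} {θ : ℂ → ℂ}

theorem logDeriv_add_two_halfPeriod (h : IsOddTheta L θ) (ν : Fin 4) {x : ℂ}
    (hx : x ∉ L.lattice) :
    logDeriv θ (x + 2 * halfPeriod L ν) = logDeriv θ x - 2 * halfShift L ν := by
  fin_cases ν
  · simp [halfPeriod, halfShift]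
  · simpa [halfPeriod, halfShift, mul_div_cancel₀] using h.logDeriv_add_fst hx
  · set y := x + 2 * halfPeriod L 2 with hy
    have hm := halfPeriod_add_self_mem L 2
    have hy0 : y ∉ L.lattice := fun hm' => hx ((add_mem_cancel_right hm).mp hm')
    have hx2 : x = y + L.ω₁ + L.ω₂ := by simp [hy, halfPeriod]; ring
    have hy1 : y + L.ω₁ ∉ L.lattice :=
      fun hm' => hy0 ((add_mem_cancel_right L.ω₁_mem_lattice).mp hm')
    have e1 := h.logDeriv_add_snd hy1
    rw [← hx2, h.logDeriv_add_fst hy0] at e1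
    change logDeriv θ y = _
    rw [e1]
    simp [halfShift]
  · simpa [halfPeriod, halfShift, mul_div_cancel₀] using h.logDeriv_add_snd hx

theorem thetaLog_neg (h : IsOddTheta L θ) (ν : Fin 4) {x : ℂ}
    (hx : x + halfPeriod L ν ∉ L.lattice) : thetaLog L θ ν (-x) = -thetaLog L θ ν x := by
  have hx' : x - halfPeriod L ν ∉ L.lattice := fun hm => hx (by
    have := add_mem hm (halfPeriod_add_self_mem L ν)
    convert this using 1
    ring)
  have h1 := h.logDeriv_add_two_halfPeriod ν hx'
  rw [show x - halfPeriod L ν + 2 * halfPeriod L ν = x + halfPeriod L ν by ring] at h1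
  rw [thetaLog, thetaLog, h1, show -x + halfPeriod L ν = -(x - halfPeriod L ν) by ring,
    h.logDeriv_neg_eq]
  ring

/-- The arguments ω_μ - ω_ν and ω_ν - ω_μ are opposite and differ by a period, so oddness and the
quasi-periods fix the value. It is exactly what the constants `halfShift` compensate in
`sq_thetaLog_sub`. -/
theorem logDeriv_halfPeriod_sub (h : IsOddTheta L θ) {μ ν : Fin 4} (hμν : μ ≠ ν) :
    logDeriv θ (halfPeriod L μ - halfPeriod L ν) = halfShift L ν - halfShift L μ := by
  have hm := halfPeriod_sub_notMem L hμν.symm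
  have hm2 : halfPeriod L ν - halfPeriod L μ + 2 * halfPeriod L μ ∉ L.lattice :=
    fun h' => hm ((add_mem_cancel_right (halfPeriod_add_self_mem L μ)).mp h')
  have h1 := h.logDeriv_add_two_halfPeriod μ hm
  have hm3 := halfPeriod_sub_notMem L hμν
  have h2 := h.logDeriv_add_two_halfPeriod ν hm3
  rw [show halfPeriod L ν - halfPeriod L μ + 2 * halfPeriod L μ =
    halfPeriod L μ - halfPeriod L ν + 2 * halfPeriod L ν by ring, h2,
    ← neg_sub (halfPeriod L μ), h.logDeriv_neg_eq] at h1
  linear_combination h1 / 2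

theorem sq_thetaLog_sub (h : IsOddTheta L θ) {μ ν : Fin 4} (hμν : μ ≠ ν) {x : ℂ}
    (hμ : x + halfPeriod L μ ∉ L.lattice) (hν : x + halfPeriod L ν ∉ L.lattice) :
    (thetaLog L θ μ x - thetaLog L θ ν x) ^ 2 =
      ℘[L] (x + halfPeriod L μ) + ℘[L] (x + halfPeriod L ν) +
        ℘[L] (halfPeriod L μ - halfPeriod L ν) := by
  have e : x + halfPeriod L ν + (halfPeriod L μ - halfPeriod L ν) = x + halfPeriod L μ := by ring
  have h1 := h.sq_logDeriv_add hν (halfPeriod_sub_notMem L hμν) (by rwa [e])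
  rw [e, h.logDeriv_halfPeriod_sub hμν] at h1
  rw [thetaLog, thetaLog]
  linear_combination h1

/-- The addition theorem at x - y and y + ω_ν; the two constants `halfShift` cancel. -/
theorem sq_thetaLog_sub_sub (h : IsOddTheta L θ) (ν : Fin 4) {x y : ℂ}
    (hx : x + halfPeriod L ν ∉ L.lattice) (hy : y + halfPeriod L ν ∉ L.lattice)
    (hxy : x - y ∉ L.lattice) :
    (logDeriv θ (x - y) + thetaLog L θ ν y - thetaLog L θ ν x) ^ 2 =
      ℘[L] (x - y) + ℘[L] (y + halfPeriod L ν) + ℘[L] (x + halfPeriod L ν) := by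
  have e : x - y + (y + halfPeriod L ν) = x + halfPeriod L ν := by ring
  have h1 := h.sq_logDeriv_add hxy hy (by rwa [e])
  rw [e] at h1
  rw [thetaLog, thetaLog]
  linear_combination h1

theorem sq_logDeriv_triple (h : IsOddTheta L θ) {x y z : ℂ}
    (hxy : x - y ∉ L.lattice) (hyz : y - z ∉ L.lattice) (hzx : z - x ∉ L.lattice) :
    (logDeriv θ (x - y) + logDeriv θ (y - z) + logDeriv θ (z - x)) ^ 2 =
      ℘[L] (x - y) + ℘[L] (y - z) + ℘[L] (z - x) := by
  have e : x - y + (y - z) = -(z - x) := by ring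
  have h1 := h.sq_logDeriv_add hxy hyz (by rwa [e, neg_mem_iff])
  rw [e, h.logDeriv_neg_eq, weierstrassP_neg] at h1
  linear_combination h1

theorem e_root (h : IsOddTheta L θ) {ν : Fin 4} (hν : ν ≠ 0) :
    4 * e L ν ^ 3 - L.g₂ * e L ν - L.g₃ = 0 := by
  have hn := halfPeriod_notMem L hν
  rw [e, ← L.derivWeierstrassP_sq _ hn,
    (h.derivWeierstrassP_eq_zero_iff hn).mpr (halfPeriod_add_self_mem L ν)]
  ring

theorem e_ne (h : IsOddTheta L θ) {μ ν : Fin 4} (hμ : μ ≠ 0) (hν : ν ≠ 0) (hμν : μ ≠ ν) :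
    e L μ - e L ν ≠ 0 :=
  h.weierstrassP_ne (halfPeriod_notMem L hμ) (halfPeriod_notMem L hν)
    (halfPeriod_add_notMem L hμν) (halfPeriod_sub_notMem L hμν)

/-- Vieta's formulas: the e_ν are three distinct roots of 4t³ - g₂t - g₃, and the differences of the
three equations are divided by e_μ - e_ν. -/
theorem e_symmetric (h : IsOddTheta L θ) : e L 1 + e L 2 + e L 3 = 0 ∧
    L.g₂ = -4 * (e L 1 * e L 2 + e L 1 * e L 3 + e L 2 * e L 3) ∧
    L.g₃ = 4 * (e L 1 * e L 2 * e L 3) := by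
  have r1 := h.e_root (ν := 1) (by decide)
  have r2 := h.e_root (ν := 2) (by decide)
  have r3 := h.e_root (ν := 3) (by decide)
  have n12 := h.e_ne (μ := 1) (ν := 2) (by decide) (by decide) (by decide)
  have n13 := h.e_ne (μ := 1) (ν := 3) (by decide) (by decide) (by decide)
  have n23 := h.e_ne (μ := 2) (ν := 3) (by decide) (by decide) (by decide)
  have g12 : 4 * (e L 1 ^ 2 + e L 1 * e L 2 + e L 2 ^ 2) = L.g₂ :=
    mul_left_cancel₀ n12 (by linear_combination r1 - r2)
  have g13 : 4 * (e L 1 ^ 2 + e L 1 * e L 3 + e L 3 ^ 2) = L.g₂ :=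
    mul_left_cancel₀ n13 (by linear_combination r1 - r3)
  have hs : e L 1 + e L 2 + e L 3 = 0 :=
    mul_left_cancel₀ n23 (by linear_combination (g12 - g13) / 4)
  have h3 : e L 3 = -e L 1 - e L 2 := by linear_combination hs
  have hg2 : L.g₂ = -4 * (e L 1 * e L 2 + e L 1 * e L 3 + e L 2 * e L 3) := by
    rw [← g12, h3]; ring
  refine ⟨hs, hg2, ?_⟩
  have : L.g₃ = 4 * e L 1 ^ 3 - L.g₂ * e L 1 := by linear_combination -r1
  rw [this, hg2, h3]
  ring

/-- If 2x = mω₁ + nω₂ in terms of the full periods, the parities of m and n single out the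
half-period that brings x into the lattice. -/
theorem two_mul_notMem {x : ℂ} (hx : ∀ ν, x + halfPeriod L ν ∉ L.lattice) :
    2 * x ∉ L.lattice := by
  intro hm
  obtain ⟨m, n, hmn⟩ := mem_lattice.mp hm
  have key : ∀ a b : ℤ, ∀ ν, x + halfPeriod L ν = a * L.ω₁ + b * L.ω₂ → False := by
    intro a b ν hab
    exact hx ν (mem_lattice.mpr ⟨a, b, hab.symm⟩)
  rcases Int.even_or_odd' m with ⟨a, rfl | rfl⟩ <;> rcases Int.even_or_odd' n with ⟨b, rfl | rfl⟩ <;>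
    push_cast at hmn
  · refine key a b 0 ?_
    simp only [halfPeriod, Matrix.cons_val]
    linear_combination -hmn / 2
  · refine key a (b + 1) 3 ?_
    simp only [halfPeriod, Matrix.cons_val]
    push_cast
    linear_combination -hmn / 2
  · refine key (a + 1) b 1 ?_
    simp only [halfPeriod, Matrix.cons_val]
    push_cast
    linear_combination -hmn / 2
  · refine key a b 2 ?_
    simp only [halfPeriod, Matrix.cons_val]
    linear_combination -hmn / 2

/-- The logarithmic form of "θ₁(2x) is proportional to the product of the four θ_ν(x)". By
`theta_two_mul`, 2ℓ(2x) = 4ℓ(x) + ℘''/℘'; by the addition formula at ω_ν, l_ν - ℓ = ½ ℘'/(℘ - e_ν).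
The factorization ℘'² = 4∏(℘ - e_ν) shows that the latter sum to ℘''/℘'. -/
theorem two_mul_logDeriv_two_mul (h : IsOddTheta L θ) {x : ℂ}
    (hx : ∀ ν, x + halfPeriod L ν ∉ L.lattice) :
    2 * logDeriv θ (2 * x) = ∑ ν, thetaLog L θ ν x := by
  have hx0 : x ∉ L.lattice := by simpa [halfPeriod] using hx 0
  have h2x := two_mul_notMem hx
  have hx' : ∀ ν, x - halfPeriod L ν ∉ L.lattice := fun ν hm => hx ν (by
    have := add_mem hm (halfPeriod_add_self_mem L ν)
    convert this using 1
    ring)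
  have hP0 : ℘'[L] x ≠ 0 := (h.derivWeierstrassP_eq_zero_iff hx0).not.mpr h2x
  have key : ∀ ν : Fin 4, ν ≠ 0 →
      ℘'[L] x = 2 * (℘[L] x - e L ν) * (thetaLog L θ ν x - logDeriv θ x) := by
    intro ν hν
    have hn := halfPeriod_notMem L hν
    have h1 := h.derivWeierstrassP_sub hx0 hn (hx ν) (hx' ν)
    have h2 := h.logDeriv_halfPeriod_sub hν
    rw [show halfPeriod L 0 = 0 by simp [halfPeriod], sub_zero,
      show halfShift L 0 = 0 by simp [halfShift]] at h2
    rw [(h.derivWeierstrassP_eq_zero_iff hn).mpr (halfPeriod_add_self_mem L ν), h2] at h1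
    rw [thetaLog, e]
    linear_combination h1
  have hdup : 2 * logDeriv θ (2 * x) * ℘'[L] x =
      4 * logDeriv θ x * ℘'[L] x + (6 * ℘[L] x ^ 2 - L.g₂ / 2) := by
    have d1 := ((h.hasDerivAt h2x).comp x ((hasDerivAt_id x).const_mul 2)).const_mul
      (deriv θ 0 ^ 3)
    have d2 := ((h.hasDerivAt hx0).fun_pow 4).fun_neg.fun_mul (h.hasDerivAt_derivWeierstrassP hx0)
    have heq : (fun y => deriv θ 0 ^ 3 * (θ ∘ fun y => 2 * id y) y) =ᶠ[𝓝 x]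
        (fun y => -θ y ^ 4 * ℘'[L] y) := by
      filter_upwards [L.eventually_notMem hx0] with y hy
      exact h.theta_two_mul hy
    have h3 := d1.unique (d2.congr_of_eventuallyEq heq)
    have h4 := h.theta_two_mul hx0
    refine mul_left_cancel₀ (pow_ne_zero 4 (h.ne_zero_iff.mpr hx0)) ?_
    push_cast at h3
    linear_combination -h3 + 2 * logDeriv θ (2 * x) * h4
  obtain ⟨s1, s2, s3⟩ := h.e_symmetric
  have k1 := key 1 (by decide)
  have k2 := key 2 (by decide)
  have k3 := key 3 (by decide)
  have hsq := L.derivWeierstrassP_sq x hx0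
  rw [Fin.sum_univ_four, thetaLog_zero]
  set p := ℘[L] x
  set p' := ℘'[L] x
  set a1 := thetaLog L θ 1 x - logDeriv θ x with ha1
  set a2 := thetaLog L θ 2 x - logDeriv θ x with ha2
  set a3 := thetaLog L θ 3 x - logDeriv θ x with ha3
  have hcubic : p' ^ 2 = 4 * ((p - e L 1) * (p - e L 2) * (p - e L 3)) := by
    rw [hsq, s2, s3]
    linear_combination 4 * p ^ 2 * s1
  have hΔ : ∀ {i : Fin 4} {a : ℂ}, p' = 2 * (p - e L i) * a → p - e L i ≠ 0 := by
    intro i a hi h0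
    rw [h0] at hi
    exact hP0 (by simpa using hi)
  have m1 : p' * a1 = 2 * ((p - e L 2) * (p - e L 3)) :=
    mul_left_cancel₀ (hΔ k1) (by linear_combination hcubic / 2 - p' / 2 * k1)
  have m2 : p' * a2 = 2 * ((p - e L 1) * (p - e L 3)) :=
    mul_left_cancel₀ (hΔ k2) (by linear_combination hcubic / 2 - p' / 2 * k2)
  have m3 : p' * a3 = 2 * ((p - e L 1) * (p - e L 2)) :=
    mul_left_cancel₀ (hΔ k3) (by linear_combination hcubic / 2 - p' / 2 * k3)
  refine mul_right_cancel₀ hP0 ?_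
  rw [hdup, s2]
  linear_combination -m1 - m2 - m3 + 4 * p * s1

theorem four_mul_weierstrassP_two_mul (h : IsOddTheta L θ) {x : ℂ}
    (hx : ∀ ν, x + halfPeriod L ν ∉ L.lattice) :
    4 * ℘[L] (2 * x) = ∑ ν, ℘[L] (x + halfPeriod L ν) := by
  obtain ⟨B, hB⟩ := h.exists_hasDerivAt_logDeriv
  have d1 := ((hB _ (two_mul_notMem hx)).comp x ((hasDerivAt_id x).const_mul 2)).const_mul 2
  have d2 : HasDerivAt (fun y => ∑ ν, thetaLog L θ ν y)
      (∑ ν, (B - ℘[L] (x + halfPeriod L ν))) x :=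
    HasDerivAt.fun_sum fun ν _ => ((hB _ (hx ν)).comp_add_const _ _).add_const _
  have heq : (fun y => 2 * (logDeriv θ ∘ fun y => 2 * id y) y) =ᶠ[𝓝 x]
      (fun y => ∑ ν, thetaLog L θ ν y) := by
    have : ∀ᶠ y in 𝓝 x, ∀ ν, y + halfPeriod L ν ∉ L.lattice := by
      rw [eventually_all]
      exact fun ν => (by fun_prop : ContinuousAt (fun w => w + halfPeriod L ν) x).eventually
        (L.eventually_notMem (hx ν))
    filter_upwards [this] with y hy
    exact h.two_mul_logDeriv_two_mul hy
  have h3 := d1.unique (d2.congr_of_eventuallyEq heq)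
  rw [Finset.sum_sub_distrib, Finset.sum_const, Finset.card_univ, Fintype.card_fin] at h3
  simp only [nsmul_eq_mul] at h3
  push_cast at h3
  linear_combination -h3

end IsOddTheta

end SourceIdentity

/-! ### The Weierstrass zeta function and the constant η₁/ω₁. -/

namespace SourceIdentity

open Complex PeriodPair Filter Topology

/-- The three fractions combine to z²/(l²(z - l)), of order |l|⁻³. -/
theorem norm_zeta_summand_le (r : ℝ) (hr : 0 < r) (z : ℂ) (hz : ‖z‖ < r) (l : ℂ)
    (hl : 2 * r ≤ ‖l‖) :
    ‖1 / (z - l) + 1 / l + z / l ^ 2‖ ≤ 2 * r ^ 2 * ‖l‖ ^ (-3 : ℝ) := by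
  have hl0 : 0 < ‖l‖ := by linarith
  have hl0' : l ≠ 0 := norm_pos_iff.mp hl0
  have hsub : ‖l‖ / 2 ≤ ‖z - l‖ := by
    rw [norm_sub_rev]
    exact le_trans (by linarith) (norm_sub_norm_le l z)
  have hzl : z - l ≠ 0 := norm_pos_iff.mp (by linarith)
  have e : 1 / (z - l) + 1 / l + z / l ^ 2 = z ^ 2 / (l ^ 2 * (z - l)) := by
    field_simp
    ring
  rw [e, norm_div, norm_mul, norm_pow, norm_pow]
  calc ‖z‖ ^ 2 / (‖l‖ ^ 2 * ‖z - l‖) ≤ r ^ 2 / (‖l‖ ^ 2 * (‖l‖ / 2)) := by gcongr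
    _ = 2 * r ^ 2 / ‖l‖ ^ 3 := by field_simp
    _ = _ := by
      rw [div_eq_mul_inv]
      norm_cast

theorem hasSumLocallyUniformly_zeta (L : PeriodPair) :
    HasSumLocallyUniformly
      (fun (l : L.lattice) (z : ℂ) => 1 / (z - l) + 1 / (l : ℂ) + z / (l : ℂ) ^ 2) (zeta L) := by
  refine L.hasSumLocallyUniformly_aux (u := fun r l => 2 * r ^ 2 * ‖l‖ ^ (-3 : ℝ)) _
    (fun _ _ => (ZLattice.summable_norm_rpow _ _ (by simp; norm_num)).mul_left _) fun r hr =>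
    Filter.eventually_atTop.mpr ⟨2 * r, ?_⟩
  rintro _ hl z hz l rfl
  exact norm_zeta_summand_le r hr z hz l hl

theorem hasDerivAt_zeta_summand {z l : ℂ} (h : z - l ≠ 0) :
    HasDerivAt (fun z => 1 / (z - l) + 1 / l + z / l ^ 2) (-(1 / (z - l) ^ 2 - 1 / l ^ 2)) z := by
  have h1 := (((hasDerivAt_id z).sub_const l).fun_inv h).add_const (1 / l)
  have h2 := h1.fun_add ((hasDerivAt_id z).div_const (l ^ 2))
  simp only [id, one_div] at h2 ⊢
  refine h2.congr_deriv ?_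
  rw [neg_div, one_div]
  ring

theorem sub_ne_zero_of_notMem {L : PeriodPair} {z : ℂ} (hz : z ∈ ((L.lattice : Set ℂ))ᶜ)
    (l : L.lattice) : z - l ≠ 0 := fun h => hz (by
  rw [sub_eq_zero.mp h]
  exact l.2)

theorem differentiableOn_zeta_summand (L : PeriodPair) (s : Finset L.lattice) :
    DifferentiableOn ℂ (fun z => ∑ l ∈ s, (1 / (z - l) + 1 / (l : ℂ) + z / (l : ℂ) ^ 2))
      ((L.lattice : Set ℂ))ᶜ :=
  .fun_sum fun l _ _ hz =>
    (hasDerivAt_zeta_summand (sub_ne_zero_of_notMem hz l)).differentiableAt.differentiableWithinAt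

theorem hasDerivAt_zeta (L : PeriodPair) {z : ℂ} (hz : z ∉ L.lattice) :
    HasDerivAt (zeta L) (-℘[L] z) z := by
  have hlu := (hasSumLocallyUniformly_zeta L).hasSumLocallyUniformlyOn
    (s := ((L.lattice : Set ℂ))ᶜ)
  have hdiff : DifferentiableOn ℂ (zeta L) ((L.lattice : Set ℂ))ᶜ :=
    hlu.differentiableOn (.of_forall (differentiableOn_zeta_summand L)) L.isOpen_compl_lattice
  have hderiv := ((hasSumLocallyUniformly_zeta L).tendstoLocallyUniformlyOn
    (s := ((L.lattice : Set ℂ))ᶜ)).deriv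
    (.of_forall (differentiableOn_zeta_summand L)) L.isOpen_compl_lattice
  have h1 := hderiv.tendsto_at (show z ∈ ((L.lattice : Set ℂ))ᶜ from hz)
  have h2 := (L.hasSum_weierstrassP z).neg
  have : deriv (zeta L) z = -℘[L] z := by
    refine tendsto_nhds_unique h1 (h2.congr fun s => ?_)
    refine ((HasDerivAt.fun_sum fun l _ =>
      hasDerivAt_zeta_summand (sub_ne_zero_of_notMem hz l)).deriv).symm
  rw [← this]
  exact (hdiff.differentiableAt (L.isOpen_compl_lattice.mem_nhds hz)).hasDerivAt

theorem zeta_neg (L : PeriodPair) (z : ℂ) : zeta L (-z) = -zeta L z := by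
  rw [zeta, zeta, ← tsum_neg, ← (Equiv.neg L.lattice).tsum_eq]
  congr 1 with l
  have : -z - -(l : ℂ) = -(z - l) := by ring
  simp only [Equiv.neg_apply, NegMemClass.coe_neg, this, div_neg, neg_sq]
  ring

namespace IsOddTheta

variable {L : PeriodPair} {θ : ℂ → ℂ}

/-- `θ'/θ` has derivative `-η₁/ω₁ - ℘`. -/
theorem hasDerivAt_logDeriv (h : IsOddTheta L θ) {x : ℂ} (hx : x ∉ L.lattice) :
    HasDerivAt (logDeriv θ) (-(eta L 1 / halfPeriod L 1) - ℘[L] x) x := by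
  obtain ⟨B, hB⟩ := h.exists_hasDerivAt_logDeriv
  -- D is locally constant, and the complement of a countable set in the plane is connected. D is
  -- odd and takes the same value at ±ω₁, hence vanishes there; as ℓ(ω₁) = 0, this gives B =
  -- -ζ(ω₁)/ω₁.
  set D : ℂ → ℂ := fun z => logDeriv θ z - zeta L z - B * z with hD
  have hDd : ∀ z, z ∉ L.lattice → HasDerivAt D 0 z := by
    intro z hz
    refine (((hB z hz).sub (hasDerivAt_zeta L hz)).sub
      ((hasDerivAt_id z).const_mul B)).congr_deriv ?_
    ring
  have hcount : (L.lattice : Set ℂ).Countable := by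
    have : Countable L.lattice := L.latticeEquivProd.toEquiv.countable_iff.mpr inferInstance
    exact Set.to_countable _
  have hconn : IsPreconnected ((L.lattice : Set ℂ)ᶜ) :=
    (hcount.isPathConnected_compl_of_one_lt_rank
      (by rw [Complex.rank_real_complex]; norm_num)).isConnected.isPreconnected
  have hn : halfPeriod L 1 ∉ L.lattice := halfPeriod_notMem L (by decide)
  have hn' : -halfPeriod L 1 ∉ L.lattice := by rwa [neg_mem_iff]
  have heq : D (-halfPeriod L 1) = D (halfPeriod L 1) :=
    L.isOpen_compl_lattice.is_const_of_deriv_eq_zero hconn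
      (fun z hz => (hDd z hz).differentiableAt.differentiableWithinAt)
      (fun z hz => (hDd z hz).deriv) hn' hn
  have hl : logDeriv θ (halfPeriod L 1) = 0 := by
    have := h.logDeriv_halfPeriod_sub (μ := 1) (ν := 0) (by decide)
    simpa [halfPeriod, halfShift] using this
  have hne : halfPeriod L 1 ≠ 0 := by
    intro h0
    rw [h0] at hn
    exact hn (zero_mem _)
  simp only [hD, h.logDeriv_neg_eq, zeta_neg, hl] at heq
  have hBe : B = -(eta L 1 / halfPeriod L 1) := by
    rw [eta]
    field_simp
    linear_combination heq / 2
  rw [← hBe]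
  exact hB x hx

end IsOddTheta

/-- Since ω₁ + ω₂ + ω₃ = 0, the difference of two nonzero half-periods is the third one up to sign
and periods. -/
theorem weierstrassP_halfPeriod_sub (L : PeriodPair) :
    ℘[L] (halfPeriod L 1 - halfPeriod L 0) = e L 1 ∧
    ℘[L] (halfPeriod L 2 - halfPeriod L 0) = e L 2 ∧
    ℘[L] (halfPeriod L 3 - halfPeriod L 0) = e L 3 ∧
    ℘[L] (halfPeriod L 2 - halfPeriod L 1) = e L 3 ∧
    ℘[L] (halfPeriod L 3 - halfPeriod L 1) = e L 2 ∧
    ℘[L] (halfPeriod L 3 - halfPeriod L 2) = e L 1 := by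
  have h0 : halfPeriod L 0 = 0 := by simp [halfPeriod]
  have h1 : halfPeriod L 1 = L.ω₁ / 2 := by simp [halfPeriod]
  have h2 : halfPeriod L 2 = -(L.ω₁ / 2) - L.ω₂ / 2 := by simp [halfPeriod]
  have h3 : halfPeriod L 3 = L.ω₂ / 2 := by simp [halfPeriod]
  have w1 := L.ω₁_mem_lattice
  have w2 := L.ω₂_mem_lattice
  simp only [h0, sub_zero, e, true_and]
  refine ⟨?_, ?_, ?_⟩
  · rw [h1, h2, h3, ← L.weierstrassP_neg,
      ← L.weierstrassP_sub_coe _ ⟨L.ω₁, w1⟩]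
    congr 1
    ring
  · rw [h1, h2, h3, ← L.weierstrassP_sub_coe _ ⟨L.ω₂, w2⟩]
    congr 1
    ring
  · rw [h1, h2, h3, ← L.weierstrassP_sub_coe _ ⟨L.ω₂, w2⟩]
    congr 1
    ring

end SourceIdentity

/-! ### Theta series: the heat equation and characteristics. -/

namespace SourceIdentity

open Complex Filter Topology

/-! ### The heat equation for `jacobiTheta₂` -/

theorem hasDerivAt_jacobiTheta₂'_term (n : ℤ) (z τ : ℂ) :
    HasDerivAt (fun z => jacobiTheta₂'_term n z τ)
      (2 * Real.pi * I * n * jacobiTheta₂'_term n z τ) z := by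
  have h1 : HasDerivAt (fun z => exp (2 * Real.pi * I * n * z + Real.pi * I * n ^ 2 * τ))
      (exp (2 * Real.pi * I * n * z + Real.pi * I * n ^ 2 * τ) * (2 * Real.pi * I * n * 1)) z :=
    (((hasDerivAt_id z).const_mul _).add_const _).cexp
  refine (h1.const_mul (2 * Real.pi * I * n)).congr_deriv ?_
  rw [jacobiTheta₂'_term, jacobiTheta₂_term]
  ring

theorem hasSum_jacobiTheta₂_fderiv_snd (z : ℂ) {τ : ℂ} (hτ : 0 < τ.im) :
    HasSum (fun n : ℤ => Real.pi * I * n ^ 2 * jacobiTheta₂_term n z τ)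
      (jacobiTheta₂_fderiv z τ (0, 1)) := by
  have h1 : HasSum (fun n => jacobiTheta₂_term_fderiv n z τ (0, 1))
      (jacobiTheta₂_fderiv z τ (0, 1)) :=
    (hasSum_jacobiTheta₂_term_fderiv z hτ).mapL
      (ContinuousLinearMap.apply ℂ ℂ ((0, 1) : ℂ × ℂ))
  refine h1.congr_fun fun n => ?_
  simp [jacobiTheta₂_term_fderiv, jacobiTheta₂_term, mul_comm]

theorem jacobiTheta₂_fderiv_fst (z : ℂ) {τ : ℂ} (hτ : 0 < τ.im) :
    jacobiTheta₂_fderiv z τ (1, 0) = jacobiTheta₂' z τ := by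
  have h : HasDerivAt (fun x => jacobiTheta₂ x τ) (jacobiTheta₂_fderiv z τ (1, 0)) z :=
    (((hasFDerivAt_jacobiTheta₂ z hτ).comp z (hasFDerivAt_prodMk_left z τ)).hasDerivAt :)
  exact h.unique (hasDerivAt_jacobiTheta₂_fst z hτ)

/-- The heat equation, term by term: (2πin)² = 4πi · πin². -/
theorem hasDerivAt_jacobiTheta₂' (z : ℂ) {τ : ℂ} (hτ : 0 < τ.im) :
    HasDerivAt (fun z => jacobiTheta₂' z τ)
      (4 * Real.pi * I * jacobiTheta₂_fderiv z τ (0, 1)) z := by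
  obtain ⟨S, hz⟩ := exists_gt |z.im|
  -- On a horizontal strip the Gaussian decay in n dominates all terms uniformly.
  let V : Set ℂ := {u | |u.im| < S}
  have hVo : IsOpen V := (continuous_abs.comp continuous_im).isOpen_preimage _ isOpen_Iio
  have hVp : IsPreconnected V := by
    refine Convex.isPreconnected ?_
    simpa only [V, abs_lt, Set.ofPred_and] using
      (convex_halfSpace_im_gt _).inter (convex_halfSpace_im_lt _)
  have hu : Summable fun n : ℤ => 4 * Real.pi ^ 2 *
      ((|n| ^ 2 : ℝ) * Real.exp (-Real.pi * (τ.im * n ^ 2 - 2 * S * |n|))) :=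
    (summable_pow_mul_jacobiTheta₂_term_bound S hτ 2).mul_left _
  have hbound : ∀ (n : ℤ), ∀ y ∈ V, ‖2 * Real.pi * I * n * jacobiTheta₂'_term n y τ‖ ≤
      4 * Real.pi ^ 2 * ((|n| ^ 2 : ℝ) *
        Real.exp (-Real.pi * (τ.im * n ^ 2 - 2 * S * |n|))) := by
    intro n y hy
    have h1 := norm_jacobiTheta₂'_term_le hτ (le_of_lt hy) le_rfl n
    have hπ : (0 : ℝ) ≤ Real.pi := Real.pi_pos.le
    rw [norm_mul]
    have h2 : ‖(2 * Real.pi * I * n : ℂ)‖ = 2 * Real.pi * |(n : ℝ)| := by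
      simp [abs_of_nonneg hπ]
    rw [h2]
    refine (mul_le_mul_of_nonneg_left h1 (by positivity)).trans (le_of_eq ?_)
    push_cast
    ring
  have hd := hasDerivAt_tsum_of_isPreconnected hu hVo hVp
    (fun n y _ => hasDerivAt_jacobiTheta₂'_term n y τ) hbound (show z ∈ V from hz)
    ((summable_jacobiTheta₂'_term_iff z τ).mpr hτ) (show z ∈ V from hz)
  refine hd.congr_deriv ?_
  rw [← (hasSum_jacobiTheta₂_fderiv_snd z hτ).tsum_eq, ← tsum_mul_left]
  congr 1 with n
  rw [jacobiTheta₂'_term]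
  ring

/-- The integral over [0, 1] is the constant Fourier coefficient, which is 1. -/
theorem exists_jacobiTheta₂_ne_zero {τ : ℂ} (hτ : 0 < τ.im) : ∃ z, jacobiTheta₂ z τ ≠ 0 := by
  by_contra! h0
  have hterm : ∀ (n : ℤ) (x : ℝ), jacobiTheta₂_term n x τ =
      exp (Real.pi * I * n ^ 2 * τ) * exp ((2 * Real.pi * I * n) * x) := fun n x => by
    rw [jacobiTheta₂_term, exp_add, mul_comm]
  have hint := intervalIntegral.hasSum_integral_of_dominated_convergence (a := 0) (b := 1)
    (μ := MeasureTheory.volume) (F := fun (n : ℤ) (x : ℝ) => jacobiTheta₂_term n x τ)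
    (f := fun x : ℝ => jacobiTheta₂ x τ) (bound := fun n _ => ‖jacobiTheta₂_term n 0 τ‖)
    (fun n => by
      simp only [hterm]
      exact (by fun_prop : Continuous fun x : ℝ =>
        exp (Real.pi * I * n ^ 2 * τ) * exp ((2 * Real.pi * I * n) * x)).aestronglyMeasurable)
    (fun n => .of_forall fun x _ => by
      rw [norm_jacobiTheta₂_term, norm_jacobiTheta₂_term]
      simp)
    (.of_forall fun x _ => ((summable_jacobiTheta₂_term_iff 0 τ).mpr hτ).norm)
    (intervalIntegrable_const)
    (.of_forall fun x _ => hasSum_jacobiTheta₂_term x hτ)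
  simp only [h0, intervalIntegral.integral_zero] at hint
  have hval : ∀ n : ℤ, ∫ x : ℝ in (0 : ℝ)..1, jacobiTheta₂_term n x τ = if n = 0 then 1 else 0 := by
    intro n
    split_ifs with hn
    · simp [hn, jacobiTheta₂_term]
    · simp only [hterm]
      have hc : 2 * Real.pi * I * n ≠ 0 := by simp [hn, Real.pi_ne_zero]
      rw [intervalIntegral.integral_const_mul, integral_exp_mul_complex hc]
      have : (2 * Real.pi * I * n : ℂ) = n * (2 * Real.pi * I) := by ring
      simp [this, exp_int_mul_two_pi_mul_I]
  simp only [hval] at hint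
  exact one_ne_zero ((hasSum_ite_eq (0 : ℤ) (1 : ℂ)).unique hint)

/-! ### Theta functions with characteristics -/

/-- The theta function with characteristics `a`, `b`. -/
noncomputable def charTheta (a b z τ : ℂ) : ℂ :=
  exp (Real.pi * I * a ^ 2 * τ + 2 * Real.pi * I * a * (z + b)) *
    jacobiTheta₂ (z + a * τ + b) τ

theorem hasSum_charTheta (a b z : ℂ) {τ : ℂ} (hτ : 0 < τ.im) :
    HasSum (fun n : ℤ => exp (Real.pi * I * (n + a) ^ 2 * τ + 2 * Real.pi * I * (n + a) * (z + b)))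
      (charTheta a b z τ) := by
  refine ((hasSum_jacobiTheta₂_term (z + a * τ + b) hτ).mul_left
    (exp (Real.pi * I * a ^ 2 * τ + 2 * Real.pi * I * a * (z + b)))).congr_fun fun n => ?_
  rw [jacobiTheta₂_term, ← exp_add]
  ring_nf

theorem hasDerivAt_comp_add_add {f : ℂ → ℂ} {f' z b c : ℂ} (h : HasDerivAt f f' (z + b + c)) :
    HasDerivAt (fun z => f (z + b + c)) f' z := by
  simp only [add_assoc] at h ⊢
  exact h.comp_add_const _ _

theorem hasDerivAt_charTheta_fst (a b z : ℂ) {τ : ℂ} (hτ : 0 < τ.im) :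
    HasDerivAt (fun z => charTheta a b z τ)
      (exp (Real.pi * I * a ^ 2 * τ + 2 * Real.pi * I * a * (z + b)) *
        (2 * Real.pi * I * a * jacobiTheta₂ (z + a * τ + b) τ +
          jacobiTheta₂' (z + a * τ + b) τ)) z := by
  have hE : HasDerivAt (fun z => exp (Real.pi * I * a ^ 2 * τ + 2 * Real.pi * I * a * (z + b)))
      _ z := ((((hasDerivAt_id z).add_const b).const_mul _).const_add _).cexp
  have hJ := hasDerivAt_comp_add_add (hasDerivAt_jacobiTheta₂_fst (z + a * τ + b) hτ)
  refine (hE.mul hJ).congr_deriv ?_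
  simp only [id]
  ring

theorem hasDerivAt_deriv_charTheta (a b z : ℂ) {τ : ℂ} (hτ : 0 < τ.im) :
    HasDerivAt (fun z => exp (Real.pi * I * a ^ 2 * τ + 2 * Real.pi * I * a * (z + b)) *
        (2 * Real.pi * I * a * jacobiTheta₂ (z + a * τ + b) τ +
          jacobiTheta₂' (z + a * τ + b) τ))
      (4 * Real.pi * I * (exp (Real.pi * I * a ^ 2 * τ + 2 * Real.pi * I * a * (z + b)) *
        (Real.pi * I * a ^ 2 * jacobiTheta₂ (z + a * τ + b) τ +
          a * jacobiTheta₂' (z + a * τ + b) τ +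
          jacobiTheta₂_fderiv (z + a * τ + b) τ (0, 1)))) z := by
  have hE : HasDerivAt (fun z => exp (Real.pi * I * a ^ 2 * τ + 2 * Real.pi * I * a * (z + b)))
      _ z := ((((hasDerivAt_id z).add_const b).const_mul _).const_add _).cexp
  have hJ := hasDerivAt_comp_add_add (hasDerivAt_jacobiTheta₂_fst (z + a * τ + b) hτ)
  have hJ' := hasDerivAt_comp_add_add (hasDerivAt_jacobiTheta₂' (z + a * τ + b) hτ)
  refine (hE.mul ((hJ.const_mul (2 * Real.pi * I * a)).add hJ')).congr_deriv ?_
  simp only [id, Pi.add_apply]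
  ring

theorem hasDerivAt_charTheta_snd (a b z : ℂ) {τ : ℂ} (hτ : 0 < τ.im) :
    HasDerivAt (fun τ => charTheta a b z τ)
      (exp (Real.pi * I * a ^ 2 * τ + 2 * Real.pi * I * a * (z + b)) *
        (Real.pi * I * a ^ 2 * jacobiTheta₂ (z + a * τ + b) τ +
          a * jacobiTheta₂' (z + a * τ + b) τ +
          jacobiTheta₂_fderiv (z + a * τ + b) τ (0, 1))) τ := by
  have hE : HasDerivAt (fun τ => exp (Real.pi * I * a ^ 2 * τ + 2 * Real.pi * I * a * (z + b)))
      _ τ := (((hasDerivAt_id τ).const_mul _).add_const _).cexp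
  have hγ : HasDerivAt (fun τ => (z + a * τ + b, τ)) ((a, 1) : ℂ × ℂ) τ := by
    have := ((((hasDerivAt_id τ).const_mul a).const_add z).add_const b).prodMk (hasDerivAt_id τ)
    simpa using this
  have hJ : HasDerivAt (fun τ => jacobiTheta₂ (z + a * τ + b) τ) _ τ :=
    HasFDerivAt.comp_hasDerivAt (l := fun p : ℂ × ℂ => jacobiTheta₂ p.1 p.2)
      (f := fun τ => (z + a * τ + b, τ)) τ (hasFDerivAt_jacobiTheta₂ (z + a * τ + b) hτ) hγ
  have hsplit : jacobiTheta₂_fderiv (z + a * τ + b) τ (a, 1) =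
      a * jacobiTheta₂' (z + a * τ + b) τ + jacobiTheta₂_fderiv (z + a * τ + b) τ (0, 1) := by
    rw [show ((a, 1) : ℂ × ℂ) = a • ((1, 0) : ℂ × ℂ) + (0, 1) by simp, map_add, map_smul,
      smul_eq_mul, jacobiTheta₂_fderiv_fst _ hτ]
  refine (hE.mul hJ).congr_deriv ?_
  rw [hsplit]
  simp only [id]
  ring

theorem differentiableAt_charTheta (a b z : ℂ) {τ : ℂ} (hτ : 0 < τ.im) :
    DifferentiableAt ℂ (fun p : ℂ × ℂ => charTheta a b p.1 p.2) (z, τ) := by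
  unfold charTheta
  refine DifferentiableAt.mul (by fun_prop) ?_
  exact DifferentiableAt.comp (z, τ) (f := fun p : ℂ × ℂ => (p.1 + a * p.2 + b, p.2))
    (g := fun p : ℂ × ℂ => jacobiTheta₂ p.1 p.2)
    (hasFDerivAt_jacobiTheta₂ (z + a * τ + b) hτ).differentiableAt (by fun_prop)

/-! ### The four theta functions as theta functions with characteristics -/

theorem ne_zero_of_im_tau_pos {ω₁ β : ℂ} (h : 0 < (tau ω₁ β).im) : ω₁ ≠ 0 := by
  rintro rfl
  simp [tau] at h

/-- The sign with which `θ_{ν+1}` is a theta function with characteristics. -/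
noncomputable def charSign : Fin 4 → ℂ := ![-1, 1, 1, 1]

/-- The first characteristic of `θ_{ν+1}`. -/
noncomputable def charFst : Fin 4 → ℂ := ![1 / 2, 1 / 2, 0, 0]

/-- The second characteristic of `θ_{ν+1}`. -/
noncomputable def charSnd : Fin 4 → ℂ := ![1 / 2, 0, 0, 1 / 2]

theorem exp_add_exp_neg_eq_cos (A y : ℂ) :
    exp (A + y * I) + exp (A - y * I) = 2 * (exp A * cos y) := by
  rw [cos, exp_add, sub_eq_add_neg, exp_add, neg_mul]
  ring

theorem exp_sub_exp_neg_eq_sin (A y : ℂ) :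
    exp (A + y * I) - exp (A - y * I) = 2 * I * (exp A * sin y) := by
  rw [sin, exp_add, sub_eq_add_neg A, exp_add, neg_mul]
  linear_combination (-exp A * (exp (-(y * I)) - exp (y * I))) * I_sq

theorem exp_nat_mul_pi_mul_I (n : ℕ) : exp (n * (Real.pi * I)) = (-1) ^ n := by
  rw [exp_nat_mul, exp_pi_mul_I]

theorem exp_pi_mul_I_half : exp (Real.pi * I / 2) = I := by
  rw [show (Real.pi * I / 2 : ℂ) = Real.pi / 2 * I by ring, exp_pi_div_two_mul_I]

theorem theta_eq_charTheta {ω₁ β : ℂ} (h : 0 < (tau ω₁ β).im) (ν : Fin 4) (x : ℂ) :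
    theta ω₁ β ν x =
      charSign ν * charTheta (charFst ν) (charSnd ν) (x / (2 * ω₁)) (tau ω₁ β) := by
  have hω := ne_zero_of_im_tau_pos h
  have hπ : (Real.pi : ℂ) ≠ 0 := ofReal_ne_zero.mpr Real.pi_ne_zero
  have hs := hasSum_charTheta (charFst ν) (charSnd ν) (x / (2 * ω₁)) h
  have harg : ∀ c : ℂ, c * x / radius ω₁ = c * Real.pi * (x / (2 * ω₁)) := fun c => by
    rw [radius]
    field_simp
  simp only [theta, harg]
  generalize x / (2 * ω₁) = z at *
  generalize tau ω₁ β = τ at *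
  fin_cases ν
  · simp only [charSign, charFst, charSnd, Fin.zero_eta, Fin.isValue, Matrix.cons_val] at hs ⊢
    -- The exponents n + 1/2 and -(n+1) + 1/2 are opposite, so the terms n and -(n+1) pair up to a
    -- sine.
    have h2 := hs.nat_add_neg_add_one
    have h3 : HasSum (fun n : ℕ => (-1) ^ n * exp (τ * Real.pi * I * ((n : ℂ) + 1 / 2) ^ 2) *
        sin ((2 * n + 1) * Real.pi * z)) (charTheta (1 / 2) (1 / 2) z τ * (-1 / 2)) := by
      refine (h2.mul_right (-1 / 2)).congr_fun fun n => ?_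
      have e1 : exp (Real.pi * I * (((n : ℤ) : ℂ) + 1 / 2) ^ 2 * τ +
          2 * Real.pi * I * (((n : ℤ) : ℂ) + 1 / 2) * (z + 1 / 2)) = I * (-1) ^ n *
          exp (τ * Real.pi * I * ((n : ℂ) + 1 / 2) ^ 2 + (2 * n + 1) * Real.pi * z * I) := by
        have : I * (-1) ^ n = exp (Real.pi * I / 2) * exp (n * (Real.pi * I)) := by
          rw [exp_nat_mul_pi_mul_I, exp_pi_mul_I_half]
        rw [this, ← exp_add, ← exp_add]
        push_cast
        ring_nf
      have e2 : exp (Real.pi * I * (((-((n : ℤ) + 1) : ℤ) : ℂ) + 1 / 2) ^ 2 * τ +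
          2 * Real.pi * I * (((-((n : ℤ) + 1) : ℤ) : ℂ) + 1 / 2) * (z + 1 / 2)) = -(I * (-1) ^ n *
          exp (τ * Real.pi * I * ((n : ℂ) + 1 / 2) ^ 2 - (2 * n + 1) * Real.pi * z * I)) := by
        have : I * (-1) ^ n = -(exp (-(Real.pi * I / 2)) * exp (-(n * (Real.pi * I)))) := by
          rw [exp_neg, exp_neg, exp_nat_mul_pi_mul_I, exp_pi_mul_I_half, inv_I, ← inv_pow]
          norm_num
        rw [this, neg_mul, neg_neg, ← exp_add, ← exp_add]
        push_cast
        ring_nf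
      rw [e1, e2, ← sub_eq_add_neg, ← mul_sub, exp_sub_exp_neg_eq_sin]
      linear_combination ((-1) ^ n * exp (τ * Real.pi * I * ((n : ℂ) + 1 / 2) ^ 2) *
        sin ((2 * n + 1) * Real.pi * z)) * I_sq
    rw [h3.tsum_eq]
    ring
  · simp only [charSign, charFst, charSnd, Fin.mk_one, Fin.isValue, Matrix.cons_val] at hs ⊢
    have h2 := hs.nat_add_neg_add_one
    have h3 : HasSum (fun n : ℕ => exp (τ * Real.pi * I * ((n : ℂ) + 1 / 2) ^ 2) *
        cos ((2 * n + 1) * Real.pi * z)) (charTheta (1 / 2) 0 z τ * (1 / 2)) := by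
      refine (h2.mul_right (1 / 2)).congr_fun fun n => ?_
      have e := exp_add_exp_neg_eq_cos (τ * Real.pi * I * ((n : ℂ) + 1 / 2) ^ 2)
        ((2 * n + 1) * Real.pi * z)
      rw [mul_one_div, eq_div_iff two_ne_zero, mul_comm, ← e]
      push_cast
      ring_nf
    rw [h3.tsum_eq]
    ring
  · simp only [charSign, charFst, charSnd, Fin.reduceFinMk, Matrix.cons_val] at hs ⊢
    -- Pairing n with -n counts n = 0 twice, so the pair removed at n = 0 is 1 + 1 and the remaining
    -- sum is `charTheta` - 1.
    have h2 := (hasSum_nat_add_iff' 1).mpr hs.nat_add_neg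
    have h3 : HasSum (fun n : ℕ => exp (τ * Real.pi * I * ((n : ℂ) + 1) ^ 2) *
        cos (2 * (n + 1) * Real.pi * z)) ((charTheta 0 0 z τ - 1) * (1 / 2)) := by
      have h4 := h2.mul_right (1 / 2)
      simp only [Finset.range_one, Finset.sum_singleton, Nat.cast_zero, Int.cast_zero, neg_zero,
        add_zero, ne_eq, OfNat.ofNat_ne_zero, not_false_eq_true, zero_pow, mul_zero, zero_mul,
        exp_zero] at h4
      rw [show charTheta 0 0 z τ - 1 = charTheta 0 0 z τ + 1 - (1 + 1) by ring]
      refine h4.congr_fun fun n => ?_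
      have e := exp_add_exp_neg_eq_cos (τ * Real.pi * I * ((n : ℂ) + 1) ^ 2)
        (2 * (n + 1) * Real.pi * z)
      rw [mul_one_div, eq_div_iff two_ne_zero, mul_comm, ← e]
      push_cast
      ring_nf
    rw [h3.tsum_eq]
    ring
  · simp only [charSign, charFst, charSnd, Fin.reduceFinMk, Matrix.cons_val] at hs ⊢
    have h2 := (hasSum_nat_add_iff' 1).mpr hs.nat_add_neg
    have h3 : HasSum (fun n : ℕ => (-1) ^ (n + 1) * exp (τ * Real.pi * I * ((n : ℂ) + 1) ^ 2) *
        cos (2 * (n + 1) * Real.pi * z)) ((charTheta 0 (1 / 2) z τ - 1) * (1 / 2)) := by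
      have h4 := h2.mul_right (1 / 2)
      simp only [Finset.range_one, Finset.sum_singleton, Nat.cast_zero, Int.cast_zero, neg_zero,
        add_zero, ne_eq, OfNat.ofNat_ne_zero, not_false_eq_true, zero_pow, mul_zero, zero_mul,
        exp_zero] at h4
      rw [show charTheta 0 (1 / 2) z τ - 1 = charTheta 0 (1 / 2) z τ + 1 - (1 + 1) by ring]
      refine h4.congr_fun fun n => ?_
      have e := exp_add_exp_neg_eq_cos (τ * Real.pi * I * ((n : ℂ) + 1) ^ 2)
        (2 * (n + 1) * Real.pi * z)
      have e1 : exp (Real.pi * I * ((((n + 1 : ℕ) : ℤ) : ℂ)) ^ 2 * τ +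
          2 * Real.pi * I * (((n + 1 : ℕ) : ℤ) : ℂ) * (z + 1 / 2)) = (-1) ^ (n + 1) *
          exp (τ * Real.pi * I * ((n : ℂ) + 1) ^ 2 + 2 * (n + 1) * Real.pi * z * I) := by
        rw [← exp_nat_mul_pi_mul_I, ← exp_add]
        push_cast
        ring_nf
      have e2 : exp (Real.pi * I * (((-((n + 1 : ℕ) : ℤ) : ℤ) : ℂ)) ^ 2 * τ +
          2 * Real.pi * I * ((-((n + 1 : ℕ) : ℤ) : ℤ) : ℂ) * (z + 1 / 2)) = (-1) ^ (n + 1) *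
          exp (τ * Real.pi * I * ((n : ℂ) + 1) ^ 2 - 2 * (n + 1) * Real.pi * z * I) := by
        have : (-1 : ℂ) ^ (n + 1) = exp (-((n + 1 : ℕ) * (Real.pi * I))) := by
          rw [exp_neg, exp_nat_mul_pi_mul_I, ← inv_pow]
          norm_num
        rw [this, ← exp_add]
        push_cast
        ring_nf
      rw [e1, e2]
      linear_combination -(1 / 2) * (-1) ^ (n + 1) * e
    rw [h3.tsum_eq]
    ring

end SourceIdentity

/-! ### The four theta functions in the variables β and x. -/

namespace SourceIdentity

open Complex Filter Topology PeriodPair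

theorem hasDerivAt_tau (ω₁ β : ℂ) : HasDerivAt (tau ω₁) (Real.pi * I / (2 * ω₁) / ω₁) β := by
  unfold tau omega3
  simpa using (((hasDerivAt_id β).const_mul (Real.pi * I : ℂ)).div_const (2 * ω₁)).div_const ω₁

theorem eventually_im_tau_pos {ω₁ β : ℂ} (h : 0 < (tau ω₁ β).im) :
    ∀ᶠ b in 𝓝 β, 0 < (tau ω₁ b).im :=
  (continuous_im.continuousAt.comp (hasDerivAt_tau ω₁ β).continuousAt).eventually
    (lt_mem_nhds h)

theorem differentiableAt_theta {ω₁ β : ℂ} (h : 0 < (tau ω₁ β).im) (ν : Fin 4) (x : ℂ) :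
    DifferentiableAt ℂ (fun p : ℂ × ℂ => theta ω₁ p.1 ν p.2) (β, x) := by
  have ht : DifferentiableAt ℂ (fun p : ℂ × ℂ => tau ω₁ p.1) (β, x) :=
    DifferentiableAt.comp (β, x) (f := Prod.fst) (g := tau ω₁)
      (hasDerivAt_tau ω₁ β).differentiableAt differentiableAt_fst
  have hx : DifferentiableAt ℂ (fun p : ℂ × ℂ => p.2 / (2 * ω₁)) (β, x) := by
    fun_prop
  have hc := differentiableAt_charTheta (charFst ν) (charSnd ν) (x / (2 * ω₁)) h
  have hev : ∀ᶠ p : ℂ × ℂ in 𝓝 (β, x), 0 < (tau ω₁ p.1).im :=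
    ((continuous_fst (X := ℂ) (Y := ℂ)).tendsto (β, x)).eventually (eventually_im_tau_pos h)
  have heq : (fun p : ℂ × ℂ => theta ω₁ p.1 ν p.2) =ᶠ[𝓝 (β, x)] fun p =>
      charSign ν * charTheta (charFst ν) (charSnd ν) (p.2 / (2 * ω₁)) (tau ω₁ p.1) :=
    hev.mono fun p hp => theta_eq_charTheta hp ν p.2
  have hγ : DifferentiableAt ℂ (fun p : ℂ × ℂ => (p.2 / (2 * ω₁), tau ω₁ p.1)) (β, x) :=
    hx.prodMk ht
  have h1 : DifferentiableAt ℂ (fun p : ℂ × ℂ =>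
      charTheta (charFst ν) (charSnd ν) (p.2 / (2 * ω₁)) (tau ω₁ p.1)) (β, x) :=
    DifferentiableAt.comp (β, x) (f := fun p : ℂ × ℂ => (p.2 / (2 * ω₁), tau ω₁ p.1))
      (g := fun q : ℂ × ℂ => charTheta (charFst ν) (charSnd ν) q.1 q.2) hc hγ
  exact (h1.const_mul (charSign ν)).congr_of_eventuallyEq heq

theorem differentiable_theta_snd {ω₁ β : ℂ} (h : 0 < (tau ω₁ β).im) (ν : Fin 4) :
    Differentiable ℂ (theta ω₁ β ν) := fun x =>
  (differentiableAt_theta h ν x).comp x (f := fun x => (β, x)) (by fun_prop)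

/-- The heat equation `2 ∂θ/∂β = ∂²θ/∂x²`. -/
theorem hasDerivAt_theta_fst {ω₁ β : ℂ} (h : 0 < (tau ω₁ β).im) (ν : Fin 4) (x : ℂ) :
    HasDerivAt (fun b => theta ω₁ b ν x) (deriv (deriv (theta ω₁ β ν)) x / 2) β := by
  have hω := ne_zero_of_im_tau_pos h
  have hx : ∀ x, HasDerivAt (fun y => y / (2 * ω₁)) (1 / (2 * ω₁)) x := fun x =>
    (hasDerivAt_id x).div_const _
  have h1 : deriv (theta ω₁ β ν) = fun x => charSign ν * ((fun z =>
      exp (Real.pi * I * charFst ν ^ 2 * tau ω₁ β +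
        2 * Real.pi * I * charFst ν * (z + charSnd ν)) *
      (2 * Real.pi * I * charFst ν *
        jacobiTheta₂ (z + charFst ν * tau ω₁ β + charSnd ν) (tau ω₁ β) +
        jacobiTheta₂' (z + charFst ν * tau ω₁ β + charSnd ν) (tau ω₁ β))) (x / (2 * ω₁)) *
      (1 / (2 * ω₁))) := by
    funext y
    have := ((hasDerivAt_charTheta_fst (charFst ν) (charSnd ν) (y / (2 * ω₁)) h).comp y
      (hx y)).const_mul (charSign ν)
    rw [show theta ω₁ β ν = fun x => charSign ν *
      charTheta (charFst ν) (charSnd ν) (x / (2 * ω₁)) (tau ω₁ β) from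
      funext (theta_eq_charTheta h ν)]
    exact this.deriv
  have h2 := ((((hasDerivAt_deriv_charTheta (charFst ν) (charSnd ν) (x / (2 * ω₁)) h).comp x
      (hx x)).mul_const (1 / (2 * ω₁))).const_mul (charSign ν)).deriv
  have h3 := ((hasDerivAt_charTheta_snd (charFst ν) (charSnd ν) (x / (2 * ω₁)) h).comp β
      (hasDerivAt_tau ω₁ β)).const_mul (charSign ν)
  have h4 : HasDerivAt (fun b => theta ω₁ b ν x) _ β := h3.congr_of_eventuallyEq (by
    filter_upwards [eventually_im_tau_pos h] with b hb
    exact theta_eq_charTheta hb ν x)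
  -- With z = x/(2ω₁) and dτ/dβ = πi/(2ω₁²), the factor 4πi of the heat equation in (z, τ) becomes
  -- 2.
  refine h4.congr_deriv ?_
  rw [h1]
  erw [h2]
  field_simp
  ring

theorem charTheta_add_one (a b z τ : ℂ) :
    charTheta a b (z + 1) τ = exp (2 * Real.pi * I * a) * charTheta a b z τ := by
  rw [charTheta, charTheta, show z + 1 + a * τ + b = z + a * τ + b + 1 by ring,
    jacobiTheta₂_add_left, ← mul_assoc, ← exp_add]
  ring_nf

theorem charTheta_add_tau (a b z τ : ℂ) :
    charTheta a b (z + τ) τ =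
      exp (-(Real.pi * I * (2 * z + τ)) - 2 * Real.pi * I * b) * charTheta a b z τ := by
  rw [charTheta, charTheta, show z + τ + a * τ + b = z + a * τ + b + τ by ring,
    jacobiTheta₂_add_left', ← mul_assoc, ← mul_assoc, ← exp_add, ← exp_add]
  ring_nf

theorem theta_zero_neg (ω₁ β x : ℂ) : theta ω₁ β 0 (-x) = -theta ω₁ β 0 x := by
  have : ∀ n : ℕ, (2 * (n : ℂ) + 1) * -x / radius ω₁ = -((2 * n + 1) * x / radius ω₁) :=
    fun n => by rw [mul_neg, neg_div]
  simp only [theta, Matrix.cons_val_zero, this, sin_neg]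
  simp only [mul_neg, tsum_neg]

theorem isOddTheta_theta {ω₁ β : ℂ} (h : 0 < (tau ω₁ β).im) :
    IsOddTheta (periodPair ω₁ (omega3 ω₁ β) h) (theta ω₁ β 0) where
  differentiable := differentiable_theta_snd h 0
  neg := theta_zero_neg ω₁ β
  add_fst x := by
    have hω := ne_zero_of_im_tau_pos h
    rw [theta_eq_charTheta h, theta_eq_charTheta h]
    have e1 : (x + (periodPair ω₁ (omega3 ω₁ β) h).ω₁) / (2 * ω₁) = x / (2 * ω₁) + 1 := by
      simp only [periodPair]
      field_simp
    rw [e1, charTheta_add_one]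
    have e2 : exp (2 * Real.pi * I * charFst 0) = -1 := by
      rw [← exp_pi_mul_I]
      simp only [charFst, Matrix.cons_val]
      ring_nf
    rw [e2]
    ring
  add_snd x := by
    have hω := ne_zero_of_im_tau_pos h
    rw [theta_eq_charTheta h, theta_eq_charTheta h]
    have e1 : (x + (periodPair ω₁ (omega3 ω₁ β) h).ω₂) / (2 * ω₁) =
        x / (2 * ω₁) + tau ω₁ β := by
      simp only [periodPair, tau]
      field_simp
    rw [e1, charTheta_add_tau]
    have e2 : exp (-(Real.pi * I * (2 * (x / (2 * ω₁)) + tau ω₁ β)) -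
        2 * Real.pi * I * charSnd 0) =
        -exp (-(Real.pi * I * (2 * x + (periodPair ω₁ (omega3 ω₁ β) h).ω₂) /
          (periodPair ω₁ (omega3 ω₁ β) h).ω₁)) := by
      rw [exp_sub, show 2 * Real.pi * I * charSnd 0 = Real.pi * I by
        simp only [charSnd, Matrix.cons_val]; ring, exp_pi_mul_I, div_neg, div_one]
      simp only [periodPair, tau]
      congr 2
      field_simp
    rw [e2]
    ring
  exists_ne_zero := by
    have hω := ne_zero_of_im_tau_pos h
    obtain ⟨z, hz⟩ := exists_jacobiTheta₂_ne_zero h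
    refine ⟨2 * ω₁ * (z - charFst 0 * tau ω₁ β - charSnd 0), ?_⟩
    rw [theta_eq_charTheta h, mul_div_cancel_left₀ _ (mul_ne_zero two_ne_zero hω), charTheta,
      show z - charFst 0 * tau ω₁ β - charSnd 0 + charFst 0 * tau ω₁ β + charSnd 0 = z by ring]
    simp [charSign, hz, exp_ne_zero]

/-- A translation by a half-period only changes the characteristics, up to an exponential factor.
Zeros and logarithmic derivatives of all four functions are thereby reduced to θ₁. -/
theorem exists_theta_eq {ω₁ β : ℂ} (h : 0 < (tau ω₁ β).im) (ν : Fin 4) :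
    ∃ c : ℂ, c ≠ 0 ∧ ∀ x, theta ω₁ β ν x =
      c * exp (halfShift (periodPair ω₁ (omega3 ω₁ β) h) ν * x) *
        theta ω₁ β 0 (x + halfPeriod (periodPair ω₁ (omega3 ω₁ β) h) ν) := by
  have hω := ne_zero_of_im_tau_pos h
  have hω3 : omega3 ω₁ β = ω₁ * tau ω₁ β := by rw [tau, mul_div_cancel₀ _ hω]
  set τ := tau ω₁ β with hτ
  -- In the variable z = x/(2ω₁), `hp` is the half-period and `hs` the exponent. The factor exp(s +
  -- kz) appears when the argument of `jacobiTheta₂` must be moved by τ, which happens only for ν =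
  -- 3.
  have key : ∀ (a b s k : ℂ) (hp hs : ℂ),
      (∀ z, jacobiTheta₂ (z + 1 / 2 * τ + 1 / 2 + hp) τ =
        exp (s + k * z) * jacobiTheta₂ (z + a * τ + b) τ) →
      hs = (2 * Real.pi * I * a - k - Real.pi * I) →
      ∃ c : ℂ, c ≠ 0 ∧ ∀ z, charTheta a b z τ =
        c * exp (hs * z) * charTheta (1 / 2) (1 / 2) (z + hp) τ := by
    intro a b s k hp hs hj hk
    refine ⟨exp (Real.pi * I * a ^ 2 * τ + 2 * Real.pi * I * a * b - s -
      (Real.pi * I * (1 / 2) ^ 2 * τ + 2 * Real.pi * I * (1 / 2) * (hp + 1 / 2))),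
      exp_ne_zero _, fun z => ?_⟩
    rw [charTheta, charTheta,
      show z + hp + 1 / 2 * τ + 1 / 2 = z + 1 / 2 * τ + 1 / 2 + hp by ring, hj, hk,
      ← mul_assoc, ← mul_assoc, ← exp_add, ← exp_add, ← exp_add]
    ring_nf
  have conv : ∀ (hp hs : ℂ), halfPeriod (periodPair ω₁ (omega3 ω₁ β) h) ν = 2 * ω₁ * hp →
      halfShift (periodPair ω₁ (omega3 ω₁ β) h) ν = hs / (2 * ω₁) →
      (∃ c : ℂ, c ≠ 0 ∧ ∀ z, charTheta (charFst ν) (charSnd ν) z τ =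
        c * exp (hs * z) * charTheta (1 / 2) (1 / 2) (z + hp) τ) →
      ∃ c : ℂ, c ≠ 0 ∧ ∀ x, theta ω₁ β ν x =
        c * exp (halfShift (periodPair ω₁ (omega3 ω₁ β) h) ν * x) *
          theta ω₁ β 0 (x + halfPeriod (periodPair ω₁ (omega3 ω₁ β) h) ν) := by
    rintro hp hs e1 e2 ⟨c, hc, hcz⟩
    have hsign : charSign ν ≠ 0 := by fin_cases ν <;> simp [charSign]
    refine ⟨-charSign ν * c, mul_ne_zero (neg_ne_zero.mpr hsign) hc, fun x => ?_⟩
    rw [theta_eq_charTheta h, theta_eq_charTheta h, hcz, e1, e2]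
    have e3 : (x + 2 * ω₁ * hp) / (2 * ω₁) = x / (2 * ω₁) + hp := by field_simp
    have e4 : hs / (2 * ω₁) * x = hs * (x / (2 * ω₁)) := by ring
    rw [e3, e4]
    simp only [charSign, charFst, charSnd, Matrix.cons_val_zero]
    ring
  fin_cases ν
  · refine conv 0 0 (by simp [halfPeriod]) (by simp [halfShift])
      (key _ _ 0 0 0 0 (fun z => ?_) ?_)
    · simp [charFst, charSnd]
    · simp [charFst]; ring
  · refine conv (1 / 2) 0 ?_ (by simp [halfShift]) (key _ _ 0 0 (1 / 2) 0 (fun z => ?_) ?_)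
    · simp [halfPeriod, periodPair]; ring
    · simp only [charFst, charSnd, Fin.mk_one, Matrix.cons_val]
      rw [show z + 1 / 2 * τ + 1 / 2 + 1 / 2 = z + 1 / 2 * τ + 0 + 1 by ring,
        jacobiTheta₂_add_left]
      simp
    · simp [charFst]; ring
  · refine conv (-1 / 2 - τ / 2) (-(Real.pi * I)) ?_ ?_
      (key _ _ 0 0 (-1 / 2 - τ / 2) (-(Real.pi * I)) (fun z => ?_) ?_)
    · simp [halfPeriod, periodPair, hω3]; ring
    · simp [halfShift, periodPair]; ring
    · simp only [charFst, charSnd, Fin.reduceFinMk, Matrix.cons_val]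
      rw [show z + 1 / 2 * τ + 1 / 2 + (-1 / 2 - τ / 2) = z + 0 * τ + 0 by ring]
      simp
    · simp [charFst]
  · refine conv (τ / 2) (Real.pi * I) ?_ ?_
      (key _ _ (-Real.pi * I * (τ + 1)) (-(2 * Real.pi * I)) (τ / 2) (Real.pi * I)
        (fun z => ?_) ?_)
    · simp [halfPeriod, periodPair, hω3]; ring
    · simp [halfShift, periodPair]
    · simp only [charFst, charSnd, Fin.reduceFinMk, Matrix.cons_val]
      rw [show z + 1 / 2 * τ + 1 / 2 + τ / 2 = z + 0 * τ + 1 / 2 + τ by ring,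
        jacobiTheta₂_add_left']
      ring_nf
    · simp [charFst]; ring

theorem theta_ne_zero_iff {ω₁ β : ℂ} (h : 0 < (tau ω₁ β).im) (ν : Fin 4) (x : ℂ) :
    theta ω₁ β ν x ≠ 0 ↔
      x + halfPeriod (periodPair ω₁ (omega3 ω₁ β) h) ν ∉
        (periodPair ω₁ (omega3 ω₁ β) h).lattice := by
  obtain ⟨c, hc, hx⟩ := exists_theta_eq h ν
  rw [← (isOddTheta_theta h).ne_zero_iff, hx]
  simp [hc, exp_ne_zero]

theorem logDeriv_theta {ω₁ β : ℂ} (h : 0 < (tau ω₁ β).im) {ν : Fin 4} {x : ℂ}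
    (hx : theta ω₁ β ν x ≠ 0) :
    logDeriv (theta ω₁ β ν) x =
      thetaLog (periodPair ω₁ (omega3 ω₁ β) h) (theta ω₁ β 0) ν x := by
  obtain ⟨c, hc, hcx⟩ := exists_theta_eq h ν
  set k := halfShift (periodPair ω₁ (omega3 ω₁ β) h) ν with hk
  set s := halfPeriod (periodPair ω₁ (omega3 ω₁ β) h) ν with hs
  have h1 : HasDerivAt (fun x => c * exp (k * x) * theta ω₁ β 0 (x + s))
      (c * (exp (k * x) * (k * 1)) * theta ω₁ β 0 (x + s) +
        c * exp (k * x) * deriv (theta ω₁ β 0) (x + s)) x :=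
    ((((hasDerivAt_id x).const_mul k).cexp).const_mul c).mul
      ((differentiable_theta_snd h 0 (x + s)).hasDerivAt.comp_add_const _ _)
  have hne : theta ω₁ β 0 (x + s) ≠ 0 := fun h0 => hx (by rw [hcx, h0, mul_zero])
  rw [thetaLog, logDeriv_apply, logDeriv_apply, funext hcx, h1.deriv, ← hk, ← hs]
  have := exp_ne_zero (k * x)
  field_simp
  ring

end SourceIdentity

/-! ### Finite sums: symmetrization over triples and pairs. -/

namespace SourceIdentity

/-! ### Finite sums over triples -/

section Sums

variable {I : Type*} [Fintype I]

theorem sum_cyclic (f : I → I → I → ℂ) :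
    ∑ i, ∑ k, ∑ l, f k l i = ∑ i, ∑ k, ∑ l, f i k l := by
  rw [Finset.sum_comm]
  refine Finset.sum_congr rfl fun k _ => ?_
  rw [Finset.sum_comm]

variable [DecidableEq I]

/-- The left side is a sum over triples (i, k, l) of μᵢμₖμₗ LᵢₖLᵢₗ. Averaged over the cyclic
permutations, the products are the mixed terms of the square in `h3`, so for distinct indices they
become squares minus P. Triples with two equal indices are not covered by `h3`; the indicator `V`
records their correction and yields the last sum. -/
theorem sum_mul_sq_sum (μ : I → ℂ) (L P : I → I → ℂ) (hL : ∀ i k, L i k = -L k i)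
    (hP : ∀ i k, P i k = P k i) (hPd : ∀ i, P i i = 0)
    (h3 : ∀ i k l, i ≠ k → k ≠ l → l ≠ i →
      (L i k + L k l + L l i) ^ 2 = P i k + P k l + P l i) :
    ∑ i, μ i * (∑ k, μ k * L i k) ^ 2 =
      (∑ i, μ i) * (∑ i, ∑ k, μ i * μ k * (L i k ^ 2 - P i k)) / 2 +
        ∑ i, ∑ k, μ i ^ 2 * μ k * P i k := by
  set A : I → I → I → ℂ := fun i k l => μ i * μ k * μ l * (L i k * L i l) with hA
  set W : I → I → I → ℂ := fun i k l => μ i * μ k * μ l * (L i k ^ 2 - P i k) with hW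
  set V : I → I → I → ℂ := fun i k l => if i = k then μ i * μ k * μ l * P i l else 0 with hV
  have hLd : ∀ i, L i i = 0 := fun i => self_eq_neg.mp (hL i i)
  have hpt : ∀ i k l, A i k l + A k l i + A l i k =
      (W i k l + W k l i + W l i k) / 2 + (V i k l + V k l i + V l i k) := by
    intro i k l
    simp only [hA, hW, hV]
    by_cases h1 : i = k
    · subst h1
      by_cases h2 : i = l
      · subst h2
        simp [hLd, hPd]
      · rw [if_pos rfl, if_neg h2, if_neg (Ne.symm h2), hL l i, hP l i, hLd, hPd]
        ring
    · by_cases h2 : k = l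
      · subst h2
        rw [if_neg h1, if_pos rfl, if_neg (Ne.symm h1), hL k i, hP k i, hLd, hPd]
        ring
      · by_cases h4 : l = i
        · subst h4
          rw [if_neg h1, if_neg h2, if_pos rfl, hL l k, hP l k, hLd, hPd]
          ring
        · rw [if_neg h1, if_neg h2, if_neg h4]
          have := h3 i k l h1 h2 h4
          rw [hL k i, hL l k, hL i l]
          linear_combination -(μ i * μ k * μ l / 2) * this
  have hS : ∑ i, ∑ k, ∑ l, A i k l = (∑ i, ∑ k, ∑ l, W i k l) / 2 + ∑ i, ∑ k, ∑ l, V i k l := by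
    have hsum : ∑ i, ∑ k, ∑ l, (A i k l + A k l i + A l i k) =
        ∑ i, ∑ k, ∑ l, ((W i k l + W k l i + W l i k) / 2 + (V i k l + V k l i + V l i k)) := by
      simp only [hpt]
    have c2 : ∀ f : I → I → I → ℂ, ∑ i, ∑ k, ∑ l, f l i k = ∑ i, ∑ k, ∑ l, f i k l := fun f => by
      rw [← sum_cyclic f, ← sum_cyclic fun i k l => f k l i]
    simp only [Finset.sum_add_distrib, ← Finset.sum_div] at hsum
    rw [sum_cyclic A, sum_cyclic W, sum_cyclic V, c2 A, c2 W, c2 V] at hsum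
    linear_combination hsum / 3
  have eA : ∑ i, ∑ k, ∑ l, A i k l = ∑ i, μ i * (∑ k, μ k * L i k) ^ 2 := by
    refine Finset.sum_congr rfl fun i _ => ?_
    rw [sq, Finset.sum_mul_sum, Finset.mul_sum]
    refine Finset.sum_congr rfl fun k _ => ?_
    rw [Finset.mul_sum]
    refine Finset.sum_congr rfl fun l _ => ?_
    simp only [hA]
    ring
  have eW : ∑ i, ∑ k, ∑ l, W i k l =
      (∑ i, μ i) * (∑ i, ∑ k, μ i * μ k * (L i k ^ 2 - P i k)) := by
    rw [mul_comm, Finset.sum_mul]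
    refine Finset.sum_congr rfl fun i _ => ?_
    rw [Finset.sum_mul]
    refine Finset.sum_congr rfl fun k _ => ?_
    rw [Finset.mul_sum]
    refine Finset.sum_congr rfl fun l _ => ?_
    simp only [hW]
    ring
  have eV : ∑ i, ∑ k, ∑ l, V i k l = ∑ i, ∑ k, μ i ^ 2 * μ k * P i k := by
    refine Finset.sum_congr rfl fun i _ => ?_
    rw [Finset.sum_comm]
    refine Finset.sum_congr rfl fun l _ => ?_
    simp only [hV, Finset.sum_ite_eq, Finset.mem_univ, if_true]
    ring
  rw [← eA, hS, eW, eV]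

/-- The two-index analogue: exchange i and k, average, and use the square in `h2`. The leftover
double sum of μᵢlᵢμₖlₖ is (Σ μᵢlᵢ)² = 0 by `hl`, and the diagonal gives the last term. -/
theorem sum_mul_mul_sum (μ l p : I → ℂ) (L P : I → I → ℂ) (hL : ∀ i k, L i k = -L k i)
    (hPd : ∀ i, P i i = 0) (hl : ∑ i, μ i * l i = 0)
    (h2 : ∀ i k, i ≠ k → (L i k + l k - l i) ^ 2 = P i k + p k + p i) :
    ∑ i, μ i * l i * ∑ k, μ k * L i k =
      (∑ i, ∑ k, μ i * μ k * (L i k ^ 2 - P i k)) / 4 +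
        (∑ i, μ i) * (∑ i, μ i * (l i ^ 2 - p i)) / 2 + (∑ i, μ i ^ 2 * p i) / 2 := by
  have hLd : ∀ i, L i i = 0 := fun i => self_eq_neg.mp (hL i i)
  have hpt : ∀ i k, μ i * l i * (μ k * L i k) + μ k * l k * (μ i * L k i) =
      μ i * μ k * (L i k ^ 2 - P i k) / 2 + (μ k * (μ i * (l i ^ 2 - p i)) +
        μ i * (μ k * (l k ^ 2 - p k))) / 2 - μ i * l i * (μ k * l k) +
        (if i = k then μ i * μ k * p i else 0) := by
    intro i k
    by_cases h : i = k
    · subst h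
      rw [if_pos rfl, hLd, hPd]
      ring
    · rw [if_neg h, hL k i]
      linear_combination -(μ i * μ k / 2) * h2 i k h
  have hsum : ∑ i, ∑ k, (μ i * l i * (μ k * L i k) + μ k * l k * (μ i * L k i)) =
      ∑ i, ∑ k, (μ i * μ k * (L i k ^ 2 - P i k) / 2 + (μ k * (μ i * (l i ^ 2 - p i)) +
        μ i * (μ k * (l k ^ 2 - p k))) / 2 - μ i * l i * (μ k * l k) +
        (if i = k then μ i * μ k * p i else 0)) := by
    simp only [hpt]
  have e1 : ∑ i, ∑ k, μ k * l k * (μ i * L k i) = ∑ i, ∑ k, μ i * l i * (μ k * L i k) :=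
    Finset.sum_comm
  have e2 : ∑ i, ∑ k, μ i * (μ k * (l k ^ 2 - p k)) =
      (∑ i, μ i) * ∑ i, μ i * (l i ^ 2 - p i) := Finset.sum_mul_sum _ _ _ _ |>.symm
  have e3 : ∑ i, ∑ k, μ k * (μ i * (l i ^ 2 - p i)) =
      (∑ i, μ i) * ∑ i, μ i * (l i ^ 2 - p i) := by
    rw [Finset.sum_comm, e2]
  have e4 : ∑ i, ∑ k, μ i * l i * (μ k * l k) = 0 := by
    rw [← Finset.sum_mul_sum, hl, zero_mul]
  have e5 : ∑ i, ∑ k, (if i = k then μ i * μ k * p i else 0) = ∑ i, μ i ^ 2 * p i := by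
    refine Finset.sum_congr rfl fun i _ => ?_
    simp only [Finset.sum_ite_eq, Finset.mem_univ, if_true]
    ring
  simp only [Finset.sum_add_distrib, Finset.sum_sub_distrib, ← Finset.sum_div, e1, e2, e3, e4,
    e5] at hsum
  simp only [Finset.mul_sum] at hsum ⊢
  linear_combination hsum / 2

/-- The three parts of the expanded square, treated by `h1`, `sum_mul_mul_sum` and `sum_mul_sq_sum`.
The squares assemble into one bracket with the factor Σd + lam Σμ, which is why a single
β-derivative can cancel them. -/
theorem sum_mul_sq_add (μ : I → ℂ) (L P : I → I → ℂ) (d : Fin 4 → ℂ) (l p : Fin 4 → I → ℂ)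
    (lam ε : ℂ) (hL : ∀ i k, L i k = -L k i) (hP : ∀ i k, P i k = P k i) (hPd : ∀ i, P i i = 0)
    (h3 : ∀ i k l, i ≠ k → k ≠ l → l ≠ i →
      (L i k + L k l + L l i) ^ 2 = P i k + P k l + P l i)
    (hl : ∀ ν, ∑ i, μ i * l ν i = 0)
    (h2 : ∀ ν i k, i ≠ k → (L i k + l ν k - l ν i) ^ 2 = P i k + p ν k + p ν i)
    (h1 : ∀ i, (∑ ν, d ν * l ν i) ^ 2 =
      (∑ ν, d ν) * (∑ ν, d ν * (l ν i ^ 2 - p ν i)) + (∑ ν, d ν ^ 2 * p ν i) - ε) :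
    ∑ i, μ i * ((∑ ν, d ν * l ν i) + lam * ∑ k, μ k * L i k) ^ 2 =
      ((∑ ν, d ν) + lam * ∑ i, μ i) * ((∑ ν, d ν * ∑ i, μ i * (l ν i ^ 2 - p ν i)) +
        lam / 2 * ∑ i, ∑ k, μ i * μ k * (L i k ^ 2 - P i k)) +
      ((∑ ν, d ν ^ 2 * ∑ i, μ i * p ν i) + lam * (∑ ν, d ν * ∑ i, μ i ^ 2 * p ν i) +
        lam ^ 2 * ∑ i, ∑ k, μ i ^ 2 * μ k * P i k) - (∑ i, μ i) * ε := by
  have hC := sum_mul_sq_sum μ L P hL hP hPd h3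
  have hD := fun ν => sum_mul_mul_sum μ (l ν) (p ν) L P hL hPd (hl ν) (h2 ν)
  have e1 : ∑ i, μ i * ((∑ ν, d ν * l ν i) + lam * ∑ k, μ k * L i k) ^ 2 =
      (∑ i, μ i * (∑ ν, d ν * l ν i) ^ 2) +
      2 * lam * (∑ ν, d ν * ∑ i, μ i * l ν i * ∑ k, μ k * L i k) +
      lam ^ 2 * ∑ i, μ i * (∑ k, μ k * L i k) ^ 2 := by
    have : ∑ ν, d ν * ∑ i, μ i * l ν i * ∑ k, μ k * L i k =
        ∑ i, μ i * (∑ ν, d ν * l ν i) * ∑ k, μ k * L i k := by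
      simp only [Finset.mul_sum (Finset.univ : Finset I)]
      rw [Finset.sum_comm]
      refine Finset.sum_congr rfl fun i _ => ?_
      rw [Finset.sum_comm]
      refine Finset.sum_congr rfl fun k _ => ?_
      rw [Finset.mul_sum, Finset.sum_mul]
      exact Finset.sum_congr rfl fun ν _ => by ring
    rw [this, Finset.mul_sum, Finset.mul_sum, ← Finset.sum_add_distrib, ← Finset.sum_add_distrib]
    exact Finset.sum_congr rfl fun i _ => by ring
  have swap : ∀ (c : Fin 4 → ℂ) (f : Fin 4 → I → ℂ),
      ∑ i, μ i * ∑ ν, c ν * f ν i = ∑ ν, c ν * ∑ i, μ i * f ν i := by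
    intro c f
    simp only [Finset.mul_sum]
    rw [Finset.sum_comm]
    exact Finset.sum_congr rfl fun ν _ => Finset.sum_congr rfl fun i _ => by ring
  have e2 : ∑ i, μ i * (∑ ν, d ν * l ν i) ^ 2 =
      (∑ ν, d ν) * (∑ ν, d ν * ∑ i, μ i * (l ν i ^ 2 - p ν i)) +
        (∑ ν, d ν ^ 2 * ∑ i, μ i * p ν i) - (∑ i, μ i) * ε := by
    rw [← swap, ← swap, Finset.mul_sum, Finset.sum_mul, ← Finset.sum_add_distrib,
      ← Finset.sum_sub_distrib]
    exact Finset.sum_congr rfl fun i _ => by rw [h1]; ring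
  rw [e1, e2, hC]
  simp only [hD, Fin.sum_univ_four]
  ring

end Sums

/-- Each mixed product l_μ l_ν is half of l_μ² + l_ν² - (l_μ - l_ν)², and the last square is given.
The index of e is that of the half-period congruent to ±(ω_μ - ω_ν). -/
theorem sq_sum_mul_fin_four {d l p : Fin 4 → ℂ} {e₁ e₂ e₃ : ℂ}
    (h01 : (l 1 - l 0) ^ 2 = p 1 + p 0 + e₁) (h02 : (l 2 - l 0) ^ 2 = p 2 + p 0 + e₂)
    (h03 : (l 3 - l 0) ^ 2 = p 3 + p 0 + e₃) (h12 : (l 2 - l 1) ^ 2 = p 2 + p 1 + e₃)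
    (h13 : (l 3 - l 1) ^ 2 = p 3 + p 1 + e₂) (h23 : (l 3 - l 2) ^ 2 = p 3 + p 2 + e₁) :
    (∑ ν, d ν * l ν) ^ 2 =
      (∑ ν, d ν) * (∑ ν, d ν * (l ν ^ 2 - p ν)) + (∑ ν, d ν ^ 2 * p ν) -
      ((d 0 * d 1 + d 2 * d 3) * e₁ + (d 0 * d 2 + d 1 * d 3) * e₂ +
        (d 0 * d 3 + d 1 * d 2) * e₃) := by
  simp only [Fin.sum_univ_four]
  linear_combination -(d 0 * d 1) * h01 - d 0 * d 2 * h02 - d 0 * d 3 * h03 - d 1 * d 2 * h12 -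
    d 1 * d 3 * h13 - d 2 * d 3 * h23

theorem sum_sum_eq_diag_add {N : ℕ} (f : Fin N → Fin N → ℂ) :
    ∑ J, ∑ K, f J K = ∑ J, f J J + ∑ J, ∑ K ∈ Finset.Ioi J, (f J K + f K J) := by
  have h := Finset.sum_sum_Ioi_add_eq_sum_sum_off_diag (fun K J => f J K)
  rw [h, ← Finset.sum_add_distrib]
  refine Finset.sum_congr rfl fun J _ => ?_
  exact Fintype.sum_eq_add_sum_compl J _

end SourceIdentity

/-! ### The algebraic identity at the points ±X_J. -/

namespace SourceIdentity

/-- The algebraic relations between the logarithmic derivatives `ℓ`, `l ν` of the theta functions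
and the functions `P`, `p ν` (which are `℘` and its translates by half-periods) at the points
`X J`, `- X J`. -/
structure SourceRelations {N : ℕ} (X : Fin N → ℂ) (ℓ P : ℂ → ℂ) (l p : Fin 4 → ℂ → ℂ)
    (e₁ e₂ e₃ : ℂ) : Prop where
  odd : ∀ x, ℓ (-x) = -ℓ x
  even : ∀ x, P (-x) = P x
  -- The default value of ℘ at its pole; with it the diagonal terms i = k of the double sums vanish.
  zero : P 0 = 0
  sum_e : e₁ + e₂ + e₃ = 0
  half_odd : ∀ ν J, l ν (-X J) = -l ν (X J)
  half_even : ∀ ν J, p ν (-X J) = p ν (X J)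
  triple : ∀ i k j : Fin N ⊕ Fin N, i ≠ k → k ≠ j → j ≠ i →
    (ℓ (Sum.elim X (-X) i - Sum.elim X (-X) k) + ℓ (Sum.elim X (-X) k - Sum.elim X (-X) j) +
      ℓ (Sum.elim X (-X) j - Sum.elim X (-X) i)) ^ 2 =
    P (Sum.elim X (-X) i - Sum.elim X (-X) k) + P (Sum.elim X (-X) k - Sum.elim X (-X) j) +
      P (Sum.elim X (-X) j - Sum.elim X (-X) i)
  pair : ∀ ν, ∀ i k : Fin N ⊕ Fin N, i ≠ k →
    (ℓ (Sum.elim X (-X) i - Sum.elim X (-X) k) + l ν (Sum.elim X (-X) k) -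
      l ν (Sum.elim X (-X) i)) ^ 2 =
    P (Sum.elim X (-X) i - Sum.elim X (-X) k) + p ν (Sum.elim X (-X) k) +
      p ν (Sum.elim X (-X) i)
  half10 : ∀ J, (l 1 (X J) - l 0 (X J)) ^ 2 = p 1 (X J) + p 0 (X J) + e₁
  half20 : ∀ J, (l 2 (X J) - l 0 (X J)) ^ 2 = p 2 (X J) + p 0 (X J) + e₂
  half30 : ∀ J, (l 3 (X J) - l 0 (X J)) ^ 2 = p 3 (X J) + p 0 (X J) + e₃
  half21 : ∀ J, (l 2 (X J) - l 1 (X J)) ^ 2 = p 2 (X J) + p 1 (X J) + e₃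
  half31 : ∀ J, (l 3 (X J) - l 1 (X J)) ^ 2 = p 3 (X J) + p 1 (X J) + e₂
  half32 : ∀ J, (l 3 (X J) - l 2 (X J)) ^ 2 = p 3 (X J) + p 2 (X J) + e₁
  dup : ∀ J, 2 * ℓ (2 * X J) = ∑ ν, l ν (X J)
  dup' : ∀ J, 4 * P (2 * X J) = ∑ ν, p ν (X J)

namespace SourceRelations

variable {N : ℕ} {X : Fin N → ℂ} {ℓ P : ℂ → ℂ} {l p : Fin 4 → ℂ → ℂ} {e₁ e₂ e₃ : ℂ}

theorem sq_sum (h : SourceRelations X ℓ P l p e₁ e₂ e₃) (d : Fin 4 → ℂ) (J : Fin N) :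
    (∑ ν, d ν * l ν (X J)) ^ 2 =
      (∑ ν, d ν) * (∑ ν, d ν * (l ν (X J) ^ 2 - p ν (X J))) + (∑ ν, d ν ^ 2 * p ν (X J)) -
      ((d 0 * d 1 + d 2 * d 3) * e₁ + (d 0 * d 2 + d 1 * d 3) * e₂ +
        (d 0 * d 3 + d 1 * d 2) * e₃) :=
  sq_sum_mul_fin_four (l := fun ν => l ν (X J)) (p := fun ν => p ν (X J))
    (h.half10 J) (h.half20 J) (h.half30 J) (h.half21 J) (h.half31 J) (h.half32 J)

/-- All d_ν = 1 in `sq_sum`, combined with the duplication formulas; the e_ν enter only through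
their sum, which is 0. It converts the interaction of X_J with its own image into one-particle
terms. -/
theorem two_mul_sq_sub (h : SourceRelations X ℓ P l p e₁ e₂ e₃) (J : Fin N) :
    ℓ (2 * X J) ^ 2 - P (2 * X J) = ∑ ν, (l ν (X J) ^ 2 - p ν (X J)) := by
  have h1 := h.sq_sum (fun _ => 1) J
  have h2 := h.dup J
  have h3 := h.dup' J
  have h4 := h.sum_e
  simp only [Fin.sum_univ_four] at h1 h2 h3 ⊢
  linear_combination h1 / 4 - h3 / 4 - h4 / 2 +
    (2 * ℓ (2 * X J) + l 0 (X J) + l 1 (X J) + l 2 (X J) + l 3 (X J)) / 4 * h2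

theorem logDeriv_zero (h : SourceRelations X ℓ P l p e₁ e₂ e₃) : ℓ 0 = 0 := by
  have := h.odd 0
  rw [neg_zero] at this
  exact self_eq_neg.mp this

theorem sum_mul_sq (h : SourceRelations X ℓ P l p e₁ e₂ e₃) (m : Fin N → ℂ) (d : Fin 4 → ℂ)
    (lam : ℂ) :
    ∑ J, m J * ((∑ ν, d ν * l ν (X J)) +
        lam * ∑ K, m K * (ℓ (X J - X K) + ℓ (X J + X K))) ^ 2 =
      ((∑ ν, d ν) + 2 * lam * ∑ J, m J) *
        ((∑ J, ∑ ν, (m J * d ν + lam / 2 * m J ^ 2) * (l ν (X J) ^ 2 - p ν (X J))) +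
        lam * ∑ J, ∑ K ∈ Finset.Ioi J, m J * m K *
          ((ℓ (X J - X K) ^ 2 - P (X J - X K)) + (ℓ (X J + X K) ^ 2 - P (X J + X K)))) +
      (∑ J, ∑ ν, m J * (d ν + lam / 2 * m J) ^ 2 * p ν (X J)) +
      lam ^ 2 * (∑ J, ∑ K ∈ Finset.Ioi J, m J * m K * (m J + m K) *
        (P (X J - X K) + P (X J + X K))) -
      (∑ J, m J) * ((d 0 * d 1 + d 2 * d 3) * e₁ + (d 0 * d 2 + d 1 * d 3) * e₂ +
        (d 0 * d 3 + d 1 * d 2) * e₃) := by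
  -- The 2𝒩 points ±X_J with equal masses. Since l_ν is odd, Σ μᵢ l_ν(Yᵢ) = 0, as `sum_mul_sq_add`
  -- requires. The points X_J and -X_J contribute equally, whence the final division by 2.
  set Y : Fin N ⊕ Fin N → ℂ := Sum.elim X (-X) with hY
  set μ : Fin N ⊕ Fin N → ℂ := Sum.elim m m with hμ
  set ε := (d 0 * d 1 + d 2 * d 3) * e₁ + (d 0 * d 2 + d 1 * d 3) * e₂ +
        (d 0 * d 3 + d 1 * d 2) * e₃ with hε
  have key := sum_mul_sq_add μ (fun i k => ℓ (Y i - Y k)) (fun i k => P (Y i - Y k)) d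
    (fun ν i => l ν (Y i)) (fun ν i => p ν (Y i)) lam ε
    (fun i k => by rw [← neg_sub, h.odd]) (fun i k => by rw [← neg_sub, h.even])
    (fun i => by rw [sub_self, h.zero]) h.triple
    (fun ν => by simp [hμ, hY, Fintype.sum_sum_type, h.half_odd])
    h.pair
    (fun i => by
      rcases i with J | J
      · exact h.sq_sum d J
      · have := h.sq_sum d J
        simp only [hY, Sum.elim_inr, Pi.neg_apply, h.half_odd, h.half_even, neg_sq, mul_neg,
          Finset.sum_neg_distrib]
        exact this)
  simp only [Fintype.sum_sum_type, hμ, hY, Sum.elim_inl, Sum.elim_inr, Pi.neg_apply, h.half_odd,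
    h.half_even, neg_sq, sub_neg_eq_add] at key
  have g1 : ∀ J K, ℓ (-X J - X K) = -ℓ (X J + X K) := fun J K => by
    rw [← h.odd]; ring_nf
  have g2 : ∀ J K, ℓ (-X J + X K) = -ℓ (X J - X K) := fun J K => by
    rw [← h.odd]; ring_nf
  have g3 : ∀ J K, P (-X J - X K) = P (X J + X K) := fun J K => by
    rw [← h.even]; ring_nf
  have g4 : ∀ J K, P (-X J + X K) = P (X J - X K) := fun J K => by
    rw [← h.even]; ring_nf
  simp only [g1, g2, g3, g4, neg_sq] at key
  have hq : ∀ J, (∑ ν, d ν * -l ν (X J) + lam * (∑ K, m K * -ℓ (X J + X K) +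
      ∑ K, m K * -ℓ (X J - X K))) ^ 2 = (∑ ν, d ν * l ν (X J) +
      lam * (∑ K, m K * ℓ (X J - X K) + ∑ K, m K * ℓ (X J + X K))) ^ 2 := fun J => by
    simp only [mul_neg, Finset.sum_neg_distrib]
    ring
  simp only [hq] at key
  have c1 : ∀ (f : Fin N → Fin N → ℂ) (g : Fin N → Fin N → ℂ),
      ∑ J, (∑ K, f J K + ∑ K, g J K) = ∑ J, ∑ K, (f J K + g J K) := fun f g => by
    simp only [Finset.sum_add_distrib]
  have hG : ∑ J, (∑ K, m J * m K * (ℓ (X J - X K) ^ 2 - P (X J - X K)) +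
      ∑ K, m J * m K * (ℓ (X J + X K) ^ 2 - P (X J + X K))) =
      2 * (∑ J, ∑ K ∈ Finset.Ioi J, m J * m K *
          ((ℓ (X J - X K) ^ 2 - P (X J - X K)) + (ℓ (X J + X K) ^ 2 - P (X J + X K)))) +
      ∑ J, ∑ ν, m J ^ 2 * (l ν (X J) ^ 2 - p ν (X J)) := by
    rw [c1, sum_sum_eq_diag_add, add_comm, Finset.mul_sum]
    congr 1
    · refine Finset.sum_congr rfl fun J _ => ?_
      rw [Finset.mul_sum]
      refine Finset.sum_congr rfl fun K _ => ?_
      rw [← neg_sub (X J) (X K), h.odd, h.even, add_comm (X K)]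
      ring
    -- On the diagonal, X_J - X_J contributes nothing and X_J + X_J is removed by duplication.
    · refine Finset.sum_congr rfl fun J _ => ?_
      rw [sub_self, h.logDeriv_zero, h.zero, ← two_mul (X J), h.two_mul_sq_sub,
        ← Finset.mul_sum]
      ring
  have hG' : ∑ J, (∑ K, m J * m K * (ℓ (X J + X K) ^ 2 - P (X J + X K)) +
      ∑ K, m J * m K * (ℓ (X J - X K) ^ 2 - P (X J - X K))) =
      ∑ J, (∑ K, m J * m K * (ℓ (X J - X K) ^ 2 - P (X J - X K)) +
      ∑ K, m J * m K * (ℓ (X J + X K) ^ 2 - P (X J + X K))) :=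
    Finset.sum_congr rfl fun J _ => add_comm _ _
  have hP : ∑ J, (∑ K, m J ^ 2 * m K * P (X J - X K) + ∑ K, m J ^ 2 * m K * P (X J + X K)) =
      (∑ J, ∑ K ∈ Finset.Ioi J, m J * m K * (m J + m K) * (P (X J - X K) + P (X J + X K))) +
      ∑ J, ∑ ν, m J ^ 3 / 4 * p ν (X J) := by
    rw [c1, sum_sum_eq_diag_add, add_comm]
    congr 1
    · refine Finset.sum_congr rfl fun J _ => ?_
      refine Finset.sum_congr rfl fun K _ => ?_
      rw [← neg_sub (X J) (X K), h.even, add_comm (X K)]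
      ring
    · refine Finset.sum_congr rfl fun J _ => ?_
      rw [sub_self, h.zero, ← two_mul (X J), ← Finset.mul_sum, ← h.dup']
      ring
  have hP' : ∑ J, (∑ K, m J ^ 2 * m K * P (X J + X K) + ∑ K, m J ^ 2 * m K * P (X J - X K)) =
      ∑ J, (∑ K, m J ^ 2 * m K * P (X J - X K) + ∑ K, m J ^ 2 * m K * P (X J + X K)) :=
    Finset.sum_congr rfl fun J _ => add_comm _ _
  rw [hG', hG, hP', hP] at key
  have hLHS : ∑ J, m J * ((∑ ν, d ν * l ν (X J)) +
        lam * ∑ K, m K * (ℓ (X J - X K) + ℓ (X J + X K))) ^ 2 =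
      ∑ J, m J * (∑ ν, d ν * l ν (X J) +
        lam * (∑ K, m K * ℓ (X J - X K) + ∑ K, m K * ℓ (X J + X K))) ^ 2 := by
    simp only [mul_add, Finset.sum_add_distrib]
  rw [hLHS]
  have s1 : ∑ J, ∑ ν, (m J * d ν + lam / 2 * m J ^ 2) * (l ν (X J) ^ 2 - p ν (X J)) =
      (∑ ν, d ν * ∑ J, m J * (l ν (X J) ^ 2 - p ν (X J))) +
      lam / 2 * ∑ J, ∑ ν, m J ^ 2 * (l ν (X J) ^ 2 - p ν (X J)) := by
    simp only [Finset.mul_sum]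
    rw [Finset.sum_comm (s := (Finset.univ : Finset (Fin 4))), ← Finset.sum_add_distrib]
    refine Finset.sum_congr rfl fun J _ => ?_
    rw [← Finset.sum_add_distrib]
    exact Finset.sum_congr rfl fun ν _ => by ring
  have s2 : ∑ J, ∑ ν, m J * (d ν + lam / 2 * m J) ^ 2 * p ν (X J) =
      (∑ ν, d ν ^ 2 * ∑ J, m J * p ν (X J)) + lam * (∑ ν, d ν * ∑ J, m J ^ 2 * p ν (X J)) +
      lam ^ 2 * ∑ J, ∑ ν, m J ^ 3 / 4 * p ν (X J) := by
    simp only [Finset.mul_sum]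
    rw [Finset.sum_comm (s := (Finset.univ : Finset (Fin 4))),
      Finset.sum_comm (s := (Finset.univ : Finset (Fin 4))), ← Finset.sum_add_distrib,
      ← Finset.sum_add_distrib]
    refine Finset.sum_congr rfl fun J _ => ?_
    rw [← Finset.sum_add_distrib, ← Finset.sum_add_distrib]
    exact Finset.sum_congr rfl fun ν _ => by ring
  rw [s1, s2]
  have s3 : ∀ f : Fin 4 → Fin N → ℂ, ∀ c : Fin 4 → ℂ,
      ∑ ν, c ν * (∑ J, f ν J + ∑ J, f ν J) = 2 * ∑ ν, c ν * ∑ J, f ν J := fun f c => by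
    rw [Finset.mul_sum]
    exact Finset.sum_congr rfl fun ν _ => by ring
  simp only [s3] at key
  linear_combination key / 2

/-- The identity satisfied by the logarithmic derivatives of the source function. -/
theorem identity (h : SourceRelations X ℓ P l p e₁ e₂ e₃) {m : Fin N → ℂ} (hm : ∀ J, m J ≠ 0)
    (d : Fin 4 → ℂ) (lam B : ℂ) :
    (4 * lam * (∑ J, m J) + 2 * ∑ ν, d ν) *
      ((∑ J, ∑ ν, coupling lam d m ν J * ((B - p ν (X J) + l ν (X J) ^ 2) / 2)) +
        ∑ J, ∑ K ∈ Finset.Ioi J, (m J * m K * lam * ((B - P (X J - X K) + ℓ (X J - X K) ^ 2) / 2) +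
          m J * m K * lam * ((B - P (X J + X K) + ℓ (X J + X K) ^ 2) / 2))) +
    ((∑ J, 1 / m J * (-(((∑ ν, coupling lam d m ν J * l ν (X J)) +
          ∑ K ∈ {J}ᶜ, m J * m K * lam * (ℓ (X J - X K) + ℓ (X J + X K))) ^ 2 +
        ((∑ ν, coupling lam d m ν J * (B - p ν (X J))) +
          ∑ K ∈ {J}ᶜ, m J * m K * lam * ((B - P (X J - X K)) + (B - P (X J + X K))))) +
        ∑ ν, coupling lam d m ν J * (coupling lam d m ν J - 1) * p ν (X J))) +
      ∑ J, ∑ K ∈ Finset.Ioi J, pairCoupling lam m J K * (P (X J - X K) + P (X J + X K))) =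
    (2 * lam * (∑ J, m J) + ∑ ν, d ν) *
      ((N : ℂ) - lam * ((∑ J, m J) ^ 2 + ∑ J, m J ^ 2) - (∑ J, m J) * (∑ ν, d ν)) * (-B) +
    (∑ J, m J) *
      ((d 0 * d 1 + d 2 * d 3) * e₁ + (d 0 * d 2 + d 1 * d 3) * e₂ +
        (d 0 * d 3 + d 1 * d 2) * e₃) := by
  have key := h.sum_mul_sq m d lam
  set M := ∑ J, m J with hM
  set D := ∑ ν, d ν with hD
  -- the first derivatives
  have hA : ∀ J, (∑ ν, coupling lam d m ν J * l ν (X J)) +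
      ∑ K ∈ {J}ᶜ, m J * m K * lam * (ℓ (X J - X K) + ℓ (X J + X K)) =
      m J * ((∑ ν, d ν * l ν (X J)) +
        lam * ∑ K, m K * (ℓ (X J - X K) + ℓ (X J + X K))) := by
    intro J
    have e1 := Fintype.sum_eq_add_sum_compl J
      (fun K => m J * m K * lam * (ℓ (X J - X K) + ℓ (X J + X K)))
    -- Completing the sum over K ≠ J by K = J adds m_J² lam ℓ(2X_J), which by duplication is the
    -- part lam m_J²/2 of the couplings.
    have e2 := h.dup J
    rw [sub_self, h.logDeriv_zero, ← two_mul, zero_add] at e1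
    have e3 : m J * (lam * ∑ K, m K * (ℓ (X J - X K) + ℓ (X J + X K))) =
        ∑ K, m J * m K * lam * (ℓ (X J - X K) + ℓ (X J + X K)) := by
      rw [Finset.mul_sum, Finset.mul_sum]
      exact Finset.sum_congr rfl fun K _ => by ring
    rw [mul_add, e3, e1]
    simp only [coupling, Fin.sum_univ_four] at e2 ⊢
    linear_combination -(m J ^ 2 * lam / 2) * e2
  -- the second derivatives
  have hB : ∀ J, 1 / m J * ((∑ ν, coupling lam d m ν J * (B - p ν (X J))) +
          ∑ K ∈ {J}ᶜ, m J * m K * lam * ((B - P (X J - X K)) + (B - P (X J + X K)))) =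
      (∑ ν, (d ν + lam / 2 * m J) * (B - p ν (X J))) +
        ∑ K ∈ {J}ᶜ, lam * m K * ((B - P (X J - X K)) + (B - P (X J + X K))) := by
    intro J
    have hmJ := hm J
    rw [mul_add, Finset.mul_sum, Finset.mul_sum]
    congr 1
    · refine Finset.sum_congr rfl fun ν _ => ?_
      rw [coupling]
      field_simp
    · refine Finset.sum_congr rfl fun K _ => ?_
      field_simp
  have hV : ∀ J, 1 / m J * ∑ ν, coupling lam d m ν J * (coupling lam d m ν J - 1) * p ν (X J) =
      ∑ ν, (m J * (d ν + lam / 2 * m J) ^ 2 * p ν (X J) - (d ν + lam / 2 * m J) * p ν (X J)) := by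
    intro J
    have hmJ := hm J
    rw [Finset.mul_sum]
    refine Finset.sum_congr rfl fun ν _ => ?_
    rw [coupling]
    field_simp
  have hJ : ∀ J, 1 / m J * (-(((∑ ν, coupling lam d m ν J * l ν (X J)) +
          ∑ K ∈ {J}ᶜ, m J * m K * lam * (ℓ (X J - X K) + ℓ (X J + X K))) ^ 2 +
        ((∑ ν, coupling lam d m ν J * (B - p ν (X J))) +
          ∑ K ∈ {J}ᶜ, m J * m K * lam * ((B - P (X J - X K)) + (B - P (X J + X K))))) +
        ∑ ν, coupling lam d m ν J * (coupling lam d m ν J - 1) * p ν (X J)) =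
      -(m J * ((∑ ν, d ν * l ν (X J)) +
        lam * ∑ K, m K * (ℓ (X J - X K) + ℓ (X J + X K))) ^ 2) -
      ((∑ ν, (d ν + lam / 2 * m J) * (B - p ν (X J))) +
        ∑ K ∈ {J}ᶜ, lam * m K * ((B - P (X J - X K)) + (B - P (X J + X K)))) +
      ∑ ν, (m J * (d ν + lam / 2 * m J) ^ 2 * p ν (X J) -
        (d ν + lam / 2 * m J) * p ν (X J)) := by
    intro J
    have hmJ := hm J
    rw [← hB, ← hV, hA]
    field_simp
    ring
  simp only [hJ, Finset.sum_add_distrib, Finset.sum_sub_distrib, Finset.sum_neg_distrib]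
  rw [key]
  -- sums over pairs
  have hoff := Finset.sum_sum_Ioi_add_eq_sum_sum_off_diag
    (fun K J => lam * m K * ((B - P (X J - X K)) + (B - P (X J + X K))))
  rw [← hoff]
  have hpair : ∑ J, ∑ K ∈ Finset.Ioi J, (lam * m K * ((B - P (X J - X K)) + (B - P (X J + X K))) +
      lam * m J * ((B - P (X K - X J)) + (B - P (X K + X J)))) =
      2 * B * lam * (∑ J, ∑ K ∈ Finset.Ioi J, (m J + m K)) -
      lam * ∑ J, ∑ K ∈ Finset.Ioi J, (m J + m K) * (P (X J - X K) + P (X J + X K)) := by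
    simp only [Finset.mul_sum, ← Finset.sum_sub_distrib]
    refine Finset.sum_congr rfl fun J _ => Finset.sum_congr rfl fun K _ => ?_
    rw [← neg_sub (X J) (X K), h.even, add_comm (X K)]
    ring
  rw [hpair]
  -- Each index lies in N - 1 pairs.
  have hcount : ∑ J : Fin N, ∑ K ∈ Finset.Ioi J, (m J + m K) = ((N : ℂ) - 1) * M := by
    have e := sum_sum_eq_diag_add (fun J _ : Fin N => m J)
    simp only [Finset.sum_const, Finset.card_univ, Fintype.card_fin, nsmul_eq_mul,
      ← Finset.mul_sum, ← hM] at e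
    linear_combination -e
  have hprod : 2 * ∑ J : Fin N, ∑ K ∈ Finset.Ioi J, m J * m K = M ^ 2 - ∑ J, m J ^ 2 := by
    have e := sum_sum_eq_diag_add (fun J K : Fin N => m J * m K)
    rw [← Finset.sum_mul_sum, ← hM] at e
    have e2 : ∑ J : Fin N, ∑ K ∈ Finset.Ioi J, (m J * m K + m K * m J) =
        2 * ∑ J : Fin N, ∑ K ∈ Finset.Ioi J, m J * m K := by
      simp only [Finset.mul_sum]
      exact Finset.sum_congr rfl fun J _ => Finset.sum_congr rfl fun K _ => by ring
    have e3 : ∑ J, m J * m J = ∑ J, m J ^ 2 := Finset.sum_congr rfl fun J _ => by ring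
    rw [e2, e3] at e
    linear_combination -e
  have hγ : ∑ J, ∑ K ∈ Finset.Ioi J, pairCoupling lam m J K * (P (X J - X K) + P (X J + X K)) =
      lam ^ 2 * (∑ J, ∑ K ∈ Finset.Ioi J, m J * m K * (m J + m K) *
        (P (X J - X K) + P (X J + X K))) -
      lam * ∑ J, ∑ K ∈ Finset.Ioi J, (m J + m K) * (P (X J - X K) + P (X J + X K)) := by
    simp only [Finset.mul_sum, ← Finset.sum_sub_distrib]
    refine Finset.sum_congr rfl fun J _ => Finset.sum_congr rfl fun K _ => ?_
    rw [pairCoupling]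
    ring
  rw [hγ, hcount]
  have hH1 : ∑ J, ∑ ν, coupling lam d m ν J * ((B - p ν (X J) + l ν (X J) ^ 2) / 2) =
      (∑ J, ∑ ν, (m J * d ν + lam / 2 * m J ^ 2) * (l ν (X J) ^ 2 - p ν (X J))) / 2 +
      B / 2 * (D * M + 2 * lam * ∑ J, m J ^ 2) := by
    have e : B / 2 * (D * M + 2 * lam * ∑ J, m J ^ 2) =
        ∑ J, ∑ ν, B / 2 * (m J * d ν + lam / 2 * m J ^ 2) := by
      have e1 : ∀ J, ∑ ν, B / 2 * (m J * d ν + lam / 2 * m J ^ 2) =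
          B / 2 * (D * m J + 2 * lam * m J ^ 2) := fun J => by
        rw [hD]
        simp only [Fin.sum_univ_four]
        ring
      simp only [e1, hM, Finset.mul_sum, ← Finset.sum_add_distrib]
    rw [e]
    simp only [Finset.sum_div, ← Finset.sum_add_distrib]
    refine Finset.sum_congr rfl fun J _ => Finset.sum_congr rfl fun ν _ => ?_
    rw [coupling]
    ring
  have hH2 : ∑ J, ∑ K ∈ Finset.Ioi J,
        (m J * m K * lam * ((B - P (X J - X K) + ℓ (X J - X K) ^ 2) / 2) +
          m J * m K * lam * ((B - P (X J + X K) + ℓ (X J + X K) ^ 2) / 2)) =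
      (lam * ∑ J, ∑ K ∈ Finset.Ioi J, m J * m K *
          ((ℓ (X J - X K) ^ 2 - P (X J - X K)) + (ℓ (X J + X K) ^ 2 - P (X J + X K)))) / 2 +
      B * lam * ∑ J : Fin N, ∑ K ∈ Finset.Ioi J, m J * m K := by
    simp only [Finset.mul_sum, Finset.sum_div, ← Finset.sum_add_distrib]
    exact Finset.sum_congr rfl fun J _ => Finset.sum_congr rfl fun K _ => by ring
  have hH2' := hH2
  simp only [Finset.sum_add_distrib] at hH2'
  rw [hH1, hH2']
  have hE : ∑ J, ∑ ν, (d ν + lam / 2 * m J) * (B - p ν (X J)) =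
      B * (N * D + 2 * lam * M) - ∑ J, ∑ ν, (d ν + lam / 2 * m J) * p ν (X J) := by
    have e1 : ∀ J, ∑ ν, (d ν + lam / 2 * m J) * (B - p ν (X J)) =
        B * (D + 2 * lam * m J) - ∑ ν, (d ν + lam / 2 * m J) * p ν (X J) := fun J => by
      rw [hD]
      simp only [Fin.sum_univ_four]
      ring
    simp only [e1, Finset.sum_sub_distrib, ← Finset.mul_sum, Finset.sum_add_distrib,
      Finset.sum_const, Finset.card_univ, Fintype.card_fin, nsmul_eq_mul, ← hM]
  rw [hE]
  -- Only the terms in B with Σ_{J<K} m_J m_K are left; `hprod` expresses them by |m|² and |m²|.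
  linear_combination (2 * lam * M + D) * B * lam * hprod

end SourceRelations

end SourceIdentity

/-! ### Branches of powers, and derivatives of their product along curves. -/

namespace SourceIdentity

open Filter Topology

section PowerBranch

/-- By continuity the imaginary part of ℓ(q) - ℓ(p) stays in (-π, π) near p, so ℓ(q) = ℓ(p) +
log(f(q)/f(p)) with the principal logarithm. -/
theorem differentiableAt_of_exp_eq {E : Type*} [NormedAddCommGroup E] [NormedSpace ℂ E]
    {ℓ f : E → ℂ} {p : E} (hℓ : ContinuousAt ℓ p) (h : ∀ᶠ q in 𝓝 p, Complex.exp (ℓ q) = f q)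
    (hf : DifferentiableAt ℂ f p) : DifferentiableAt ℂ ℓ p := by
  have hp : Complex.exp (ℓ p) = f p := h.self_of_nhds
  have h0 : f p ≠ 0 := hp ▸ Complex.exp_ne_zero _
  have him : Tendsto (fun q => (ℓ q - ℓ p).im) (𝓝 p) (𝓝 0) := by
    have : ContinuousAt (fun q => (ℓ q - ℓ p).im) p :=
      Complex.continuous_im.continuousAt.comp (hℓ.sub continuousAt_const)
    simpa [ContinuousAt] using this
  have heq : ℓ =ᶠ[𝓝 p] fun q => ℓ p + Complex.log (f q * (f p)⁻¹) := by
    filter_upwards [h, him.eventually (Ioo_mem_nhds (neg_lt_zero.mpr Real.pi_pos) Real.pi_pos)]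
      with q hq hq'
    rw [← hq, ← hp, ← Complex.exp_neg, ← Complex.exp_add, ← sub_eq_add_neg, Complex.log_exp hq'.1 hq'.2.le]
    ring
  refine DifferentiableAt.congr_of_eventuallyEq ?_ heq
  refine (differentiableAt_const _).add ((hf.mul_const _).clog ?_)
  rw [mul_inv_cancel₀ h0]
  exact Complex.one_mem_slitPlane

variable {E : Type*} {P f : E → ℂ} {a : ℂ} {U : Set E}

theorem IsPowerBranchOn.ne_zero [TopologicalSpace E] (h : IsPowerBranchOn P f a U) {p : E}
    (hp : p ∈ U) : f p ≠ 0 := by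
  obtain ⟨ℓ, -, h⟩ := h p hp
  rw [← h.self_of_nhds.1]
  exact Complex.exp_ne_zero _

theorem IsPowerBranchOn.differentiableAt [NormedAddCommGroup E] [NormedSpace ℂ E]
    (h : IsPowerBranchOn P f a U) {p : E} (hp : p ∈ U) (hf : DifferentiableAt ℂ f p) :
    DifferentiableAt ℂ P p := by
  obtain ⟨ℓ, hℓ, h⟩ := h p hp
  have hd := differentiableAt_of_exp_eq hℓ (h.mono fun _ hq => hq.1) hf
  exact (hd.const_mul a).cexp.congr_of_eventuallyEq (h.mono fun _ hq => hq.2)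

/-- A logarithmic derivative w of f along a curve becomes a·w for the power, whatever the branch.
The curve γ serves both for the variables X_J and for β. -/
theorem IsPowerBranchOn.hasDerivAt_comp [TopologicalSpace E] (h : IsPowerBranchOn P f a U)
    {γ : ℂ → E} {t w : ℂ} (hγ : ContinuousAt γ t) (ht : γ t ∈ U)
    (hf : HasDerivAt (fun s => f (γ s)) (f (γ t) * w) t) :
    HasDerivAt (fun s => P (γ s)) (P (γ t) * (a * w)) t := by
  obtain ⟨ℓ, hℓ, h⟩ := h (γ t) ht
  have h' := hγ.eventually h
  have hd : DifferentiableAt ℂ (fun s => ℓ (γ s)) t :=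
    differentiableAt_of_exp_eq (hℓ.comp hγ) (h'.mono fun _ hq => hq.1) hf.differentiableAt
  have hexp := hd.hasDerivAt.cexp
  have huniq := (hexp.congr_of_eventuallyEq
    (f₁ := fun s => f (γ s)) (h'.mono fun _ hq => hq.1.symm)).unique hf
  have hw : deriv (fun s => ℓ (γ s)) t = w := by
    rw [← h.self_of_nhds.1] at huniq
    exact mul_left_cancel₀ (Complex.exp_ne_zero _) huniq
  have := (hd.hasDerivAt.const_mul a).cexp.congr_of_eventuallyEq
    (f₁ := fun s => P (γ s)) (h'.mono fun _ hq => hq.2)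
  rwa [hw, ← h.self_of_nhds.2] at this

end PowerBranch

theorem hasDerivAt_finset_prod_mul {ι : Type*} (s : Finset ι) {F : ι → ℂ → ℂ} {w : ι → ℂ} {t : ℂ}
    (h : ∀ i ∈ s, HasDerivAt (F i) (F i t * w i) t) :
    HasDerivAt (fun x => ∏ i ∈ s, F i x) ((∏ i ∈ s, F i t) * ∑ i ∈ s, w i) t := by
  classical
  induction s using Finset.induction_on with
  | empty => simpa using hasDerivAt_const t (1 : ℂ)
  | insert i s hi ih =>
    have h1 := h i (Finset.mem_insert_self i s)
    have h2 := ih fun j hj => h j (Finset.mem_insert_of_mem hj)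
    simp only [Finset.prod_insert hi, Finset.sum_insert hi]
    exact (h1.fun_mul h2).congr_deriv (by ring)

theorem differentiableAt_fun_prod {E ι : Type*} [NormedAddCommGroup E] [NormedSpace ℂ E]
    {s : Finset ι} {F : ι → E → ℂ} {p : E} (h : ∀ i ∈ s, DifferentiableAt ℂ (F i) p) :
    DifferentiableAt ℂ (fun q => ∏ i ∈ s, F i q) p := by
  classical
  induction s using Finset.induction_on with
  | empty => simp
  | insert i s hi ih =>
    simp only [Finset.prod_insert hi]
    exact (h i (Finset.mem_insert_self i s)).fun_mul
      (ih fun j hj => h j (Finset.mem_insert_of_mem hj))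

section SourceFunction

variable {N : ℕ} {ω₁ lam : ℂ} {d : Fin 4 → ℂ} {m : Fin N → ℂ} {U : Set (ℂ × (Fin N → ℂ))}
  {Φ : ℂ × (Fin N → ℂ) → ℂ}

theorem IsSourceFunction.theta_ne_zero (hΦ : IsSourceFunction ω₁ lam d m U Φ)
    {β : ℂ} {X : Fin N → ℂ} (hp : (β, X) ∈ U) :
    (∀ ν J, theta ω₁ β ν (X J) ≠ 0) ∧ (∀ J K, J < K → theta ω₁ β 0 (X J - X K) ≠ 0) ∧
      ∀ J K, J < K → theta ω₁ β 0 (X J + X K) ≠ 0 := by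
  obtain ⟨T, S, S', hT, hS, hS', -⟩ := hΦ
  refine ⟨fun ν J => ?_, fun J K h => ?_, fun J K h => ?_⟩
  · have := (hT ν J).ne_zero hp
    exact this
  · have := (hS J K h).ne_zero hp
    exact this
  · have := (hS' J K h).ne_zero hp
    exact this

theorem IsSourceFunction.differentiableOn (hΦ : IsSourceFunction ω₁ lam d m U Φ)
    (hτ : ∀ p ∈ U, 0 < (tau ω₁ p.1).im) : DifferentiableOn ℂ Φ U := by
  obtain ⟨T, S, S', hT, hS, hS', hprod⟩ := hΦ
  have key : ∀ p ∈ U, ∀ ν, ∀ y : (Fin N → ℂ) → ℂ, DifferentiableAt ℂ y p.2 →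
      DifferentiableAt ℂ (fun q : ℂ × (Fin N → ℂ) => theta ω₁ q.1 ν (y q.2)) p := by
    intro p hp ν y hy
    exact DifferentiableAt.comp (g := fun q : ℂ × ℂ => theta ω₁ q.1 ν q.2)
      (f := fun q : ℂ × (Fin N → ℂ) => (q.1, y q.2)) p
      (differentiableAt_theta (hτ p hp) ν (y p.2))
      (differentiableAt_fst.prodMk
        (DifferentiableAt.comp (g := y) (f := Prod.snd) p hy differentiableAt_snd))
  refine DifferentiableOn.congr (fun p hp => DifferentiableAt.differentiableWithinAt ?_) hprod
  refine DifferentiableAt.fun_mul ?_ ?_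
  · refine differentiableAt_fun_prod fun J _ => differentiableAt_fun_prod fun ν _ => ?_
    exact (hT ν J).differentiableAt hp (key p hp ν (fun X => X J) (by fun_prop))
  · refine differentiableAt_fun_prod fun J _ => differentiableAt_fun_prod fun K hK => ?_
    have hJK := Finset.mem_Ioi.mp hK
    exact ((hS J K hJK).differentiableAt hp (key p hp 0 (fun X => X J - X K) (by fun_prop))).fun_mul
      ((hS' J K hJK).differentiableAt hp (key p hp 0 (fun X => X J + X K) (by fun_prop)))

theorem IsSourceFunction.hasDerivAt_comp (hΦ : IsSourceFunction ω₁ lam d m U Φ) (hU : IsOpen U)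
    {γ : ℂ → ℂ × (Fin N → ℂ)} {t : ℂ} (hγ : ContinuousAt γ t) (ht : γ t ∈ U)
    {u : Fin 4 → Fin N → ℂ} {v v' : Fin N → Fin N → ℂ}
    (hu : ∀ ν J, HasDerivAt (fun s => theta ω₁ (γ s).1 ν ((γ s).2 J))
      (theta ω₁ (γ t).1 ν ((γ t).2 J) * u ν J) t)
    (hv : ∀ J K, J < K → HasDerivAt (fun s => theta ω₁ (γ s).1 0 ((γ s).2 J - (γ s).2 K))
      (theta ω₁ (γ t).1 0 ((γ t).2 J - (γ t).2 K) * v J K) t)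
    (hv' : ∀ J K, J < K → HasDerivAt (fun s => theta ω₁ (γ s).1 0 ((γ s).2 J + (γ s).2 K))
      (theta ω₁ (γ t).1 0 ((γ t).2 J + (γ t).2 K) * v' J K) t) :
    HasDerivAt (fun s => Φ (γ s)) (Φ (γ t) *
      ((∑ J, ∑ ν, coupling lam d m ν J * u ν J) +
        ∑ J, ∑ K ∈ Finset.Ioi J, (m J * m K * lam * v J K + m J * m K * lam * v' J K))) t := by
  obtain ⟨T, S, S', hT, hS, hS', hprod⟩ := hΦ
  have heq : (fun s => Φ (γ s)) =ᶠ[𝓝 t] fun s => (∏ J, ∏ ν, T ν J (γ s)) *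
      ∏ J, ∏ K ∈ Finset.Ioi J, (S J K (γ s) * S' J K (γ s)) :=
    (hγ.eventually (hU.mem_nhds ht)).mono fun s hs => hprod _ hs
  refine HasDerivAt.congr_of_eventuallyEq ?_ heq
  rw [hprod _ ht]
  have h1 := hasDerivAt_finset_prod_mul Finset.univ
    (F := fun J s => ∏ ν, T ν J (γ s)) (t := t) fun J _ =>
    hasDerivAt_finset_prod_mul Finset.univ (F := fun ν s => T ν J (γ s)) (t := t) fun ν _ =>
      (hT ν J).hasDerivAt_comp hγ ht (hu ν J)
  have h2 := hasDerivAt_finset_prod_mul Finset.univ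
    (F := fun J s => ∏ K ∈ Finset.Ioi J, (S J K (γ s) * S' J K (γ s))) (t := t) fun J _ =>
    hasDerivAt_finset_prod_mul (Finset.Ioi J) (F := fun K s => S J K (γ s) * S' J K (γ s))
      (w := fun K => m J * m K * lam * v J K + m J * m K * lam * v' J K) (t := t) fun K hK =>
      (((hS J K (Finset.mem_Ioi.mp hK)).hasDerivAt_comp hγ ht (hv J K (Finset.mem_Ioi.mp hK))).fun_mul
      ((hS' J K (Finset.mem_Ioi.mp hK)).hasDerivAt_comp hγ ht
        (hv' J K (Finset.mem_Ioi.mp hK)))).congr_deriv (by ring)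
  exact (h1.fun_mul h2).congr_deriv (by ring)

end SourceFunction

end SourceIdentity

/-! ### Logarithmic derivatives of the theta functions and of Φ. -/

namespace SourceIdentity

open Filter Topology PeriodPair

section ThetaDerivatives

variable {ω₁ β : ℂ}

theorem hasDerivAt_theta_snd (h : 0 < (tau ω₁ β).im) {ν : Fin 4} {x : ℂ}
    (hx : theta ω₁ β ν x ≠ 0) :
    HasDerivAt (theta ω₁ β ν) (theta ω₁ β ν x *
      thetaLog (periodPair ω₁ (omega3 ω₁ β) h) (theta ω₁ β 0) ν x) x := by
  refine (differentiable_theta_snd h ν x).hasDerivAt.congr_deriv ?_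
  rw [← logDeriv_theta h hx, logDeriv_apply, mul_div_cancel₀ _ hx]

theorem hasDerivAt_thetaLog (h : 0 < (tau ω₁ β).im) {ν : Fin 4} {x : ℂ}
    (hx : theta ω₁ β ν x ≠ 0) :
    HasDerivAt (thetaLog (periodPair ω₁ (omega3 ω₁ β) h) (theta ω₁ β 0) ν)
      (-(eta (periodPair ω₁ (omega3 ω₁ β) h) 1 / halfPeriod (periodPair ω₁ (omega3 ω₁ β) h) 1) -
        ℘[periodPair ω₁ (omega3 ω₁ β) h] (x + halfPeriod (periodPair ω₁ (omega3 ω₁ β) h) ν)) x := by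
  have h1 := (isOddTheta_theta h).hasDerivAt_logDeriv ((theta_ne_zero_iff h ν x).mp hx)
  exact (h1.comp_add_const x _).add_const _

theorem deriv_deriv_theta (h : 0 < (tau ω₁ β).im) {ν : Fin 4} {x : ℂ}
    (hx : theta ω₁ β ν x ≠ 0) :
    deriv (deriv (theta ω₁ β ν)) x = theta ω₁ β ν x *
      (-(eta (periodPair ω₁ (omega3 ω₁ β) h) 1 / halfPeriod (periodPair ω₁ (omega3 ω₁ β) h) 1) -
        ℘[periodPair ω₁ (omega3 ω₁ β) h] (x + halfPeriod (periodPair ω₁ (omega3 ω₁ β) h) ν) +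
        thetaLog (periodPair ω₁ (omega3 ω₁ β) h) (theta ω₁ β 0) ν x ^ 2) := by
  have hnear : ∀ᶠ y in 𝓝 x, theta ω₁ β ν y ≠ 0 :=
    (differentiable_theta_snd h ν x).continuousAt.eventually_ne hx
  have heq : deriv (theta ω₁ β ν) =ᶠ[𝓝 x] fun y => theta ω₁ β ν y *
      thetaLog (periodPair ω₁ (omega3 ω₁ β) h) (theta ω₁ β 0) ν y :=
    hnear.mono fun y hy => (hasDerivAt_theta_snd h hy).deriv
  rw [heq.deriv_eq, ((hasDerivAt_theta_snd h hx).fun_mul (hasDerivAt_thetaLog h hx)).deriv]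
  ring

theorem hasDerivAt_theta_fst_of_ne_zero (h : 0 < (tau ω₁ β).im) {ν : Fin 4} {x : ℂ}
    (hx : theta ω₁ β ν x ≠ 0) :
    HasDerivAt (fun b => theta ω₁ b ν x) (theta ω₁ β ν x *
      ((-(eta (periodPair ω₁ (omega3 ω₁ β) h) 1 / halfPeriod (periodPair ω₁ (omega3 ω₁ β) h) 1) -
        ℘[periodPair ω₁ (omega3 ω₁ β) h] (x + halfPeriod (periodPair ω₁ (omega3 ω₁ β) h) ν) +
        thetaLog (periodPair ω₁ (omega3 ω₁ β) h) (theta ω₁ β 0) ν x ^ 2) / 2)) β := by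
  refine (hasDerivAt_theta_fst h ν x).congr_deriv ?_
  rw [deriv_deriv_theta h hx]
  ring

theorem logDeriv_theta_zero_eq_thetaLog (h : 0 < (tau ω₁ β).im) (x : ℂ) :
    thetaLog (periodPair ω₁ (omega3 ω₁ β) h) (theta ω₁ β 0) 0 x =
      logDeriv (theta ω₁ β 0) x := by simp

end ThetaDerivatives

/-- The direction X_J has components δ_K. By the parities of w and w' each ordered pair splits into
a term with δ_K and one with δ_L, so the sum over pairs becomes a sum over K ≠ J. -/
theorem sum_sum_Ioi_single {N : ℕ} (J : Fin N) {δ : Fin N → ℂ} (hδ : δ = Pi.single J 1)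
    (w w' : Fin N → Fin N → ℂ) (h : ∀ K L, w L K = -w K L) (h' : ∀ K L, w' L K = w' K L) :
    ∑ K, ∑ L ∈ Finset.Ioi K, (w K L * (δ K - δ L) + w' K L * (δ K + δ L)) =
      ∑ K ∈ {J}ᶜ, (w J K + w' J K) := by
  have key := Finset.sum_sum_Ioi_add_eq_sum_sum_off_diag
    (fun L K : Fin N => δ K * (w K L + w' K L))
  have hl : ∀ K L, w K L * (δ K - δ L) + w' K L * (δ K + δ L) =
      δ K * (w K L + w' K L) + δ L * (w L K + w' L K) := fun K L => by
    rw [h K L, h' K L]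
    ring
  simp only [hl]
  rw [key, Finset.sum_eq_single J]
  · simp [hδ]
  · intro K _ hK
    simp [hδ, hK]
  · simp

section SourceFunction

variable {N : ℕ} {ω₁ lam : ℂ} {d : Fin 4 → ℂ} {m : Fin N → ℂ} {U : Set (ℂ × (Fin N → ℂ))}
  {Φ : ℂ × (Fin N → ℂ) → ℂ}

/-- The logarithmic derivative of the source function in the direction of `X J`. -/
noncomputable def sourceLogDeriv (L : PeriodPair) (θ : ℂ → ℂ) (lam : ℂ) (d : Fin 4 → ℂ)
    (m : Fin N → ℂ) (J : Fin N) (X : Fin N → ℂ) : ℂ :=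
  (∑ ν, coupling lam d m ν J * thetaLog L θ ν (X J)) +
    ∑ K ∈ {J}ᶜ, m J * m K * lam * (logDeriv θ (X J - X K) + logDeriv θ (X J + X K))

theorem IsSourceFunction.hasDerivAt_update (hΦ : IsSourceFunction ω₁ lam d m U Φ) (hU : IsOpen U)
    {β : ℂ} {X : Fin N → ℂ} (h : 0 < (tau ω₁ β).im) (hp : (β, X) ∈ U) (J : Fin N) :
    HasDerivAt (fun t => Φ (β, Function.update X J t)) (Φ (β, X) *
      sourceLogDeriv (periodPair ω₁ (omega3 ω₁ β) h) (theta ω₁ β 0) lam d m J X) (X J) := by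
  obtain ⟨h1, h2, h3⟩ := hΦ.theta_ne_zero hp
  obtain ⟨δ, hδ⟩ : ∃ δ : Fin N → ℂ, δ = Pi.single J 1 := ⟨_, rfl⟩
  have hd : HasDerivAt (Function.update X J) δ (X J) := hδ ▸ _root_.hasDerivAt_update X J (X J)
  have hupd : ∀ K, HasDerivAt (fun t => Function.update X J t K) (δ K) (X J) :=
    hasDerivAt_pi.mp hd
  have hγ : ContinuousAt (fun t => (β, Function.update X J t)) (X J) :=
    continuousAt_const.prodMk hd.continuousAt
  have hcomp : ∀ (ν : Fin 4) (g : ℂ → ℂ) (g' y : ℂ), g (X J) = y → HasDerivAt g g' (X J) →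
      theta ω₁ β ν y ≠ 0 → HasDerivAt (fun t => theta ω₁ β ν (g t)) (theta ω₁ β ν y *
        (thetaLog (periodPair ω₁ (omega3 ω₁ β) h) (theta ω₁ β 0) ν y * g')) (X J) := by
    rintro ν g g' y rfl hg hy
    exact (HasDerivAt.comp (X J) (h₂ := theta ω₁ β ν) (hasDerivAt_theta_snd h hy) hg).congr_deriv
      (by ring)
  have key := hΦ.hasDerivAt_comp hU (γ := fun t => (β, Function.update X J t)) (t := X J) hγ
    (by simpa using hp)
    (u := fun ν K => thetaLog (periodPair ω₁ (omega3 ω₁ β) h) (theta ω₁ β 0) ν (X K) *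
      δ K)
    (v := fun K L => logDeriv (theta ω₁ β 0) (X K - X L) *
      (δ K - δ L))
    (v' := fun K L => logDeriv (theta ω₁ β 0) (X K + X L) *
      (δ K + δ L))
    (fun ν K => by
      simpa only [Function.update_eq_self] using
        hcomp ν _ _ (X K) (by simp) (hupd K) (h1 ν K))
    (fun K L hKL => by
      simpa only [Function.update_eq_self, logDeriv_theta_zero_eq_thetaLog] using
        hcomp 0 _ _ (X K - X L) (by simp) ((hupd K).fun_sub (hupd L)) (h2 K L hKL))
    (fun K L hKL => by
      simpa only [Function.update_eq_self, logDeriv_theta_zero_eq_thetaLog] using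
        hcomp 0 _ _ (X K + X L) (by simp) ((hupd K).fun_add (hupd L)) (h3 K L hKL))
  rw [Function.update_eq_self] at key
  refine key.congr_deriv ?_
  congr 1
  rw [sourceLogDeriv]
  congr 1
  · rw [Finset.sum_eq_single J]
    · simp [hδ]
    · intro K _ hK
      simp [hδ, hK]
    · simp
  · have hs := sum_sum_Ioi_single J hδ
      (fun K L => m K * m L * lam * logDeriv (theta ω₁ β 0) (X K - X L))
      (fun K L => m K * m L * lam * logDeriv (theta ω₁ β 0) (X K + X L))
      (fun K L => by
        rw [← neg_sub, (isOddTheta_theta h).logDeriv_neg_eq]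
        ring)
      (fun K L => by
        rw [add_comm (X L)]
        ring)
    simp only [mul_add, ← mul_assoc] at hs ⊢
    exact hs

end SourceFunction

end SourceIdentity

/-! ### Second derivatives, the β-derivative, and the relations at points of U. -/

namespace SourceIdentity

open Filter Topology PeriodPair

section SourceFunction

variable {N : ℕ} {ω₁ lam : ℂ} {d : Fin 4 → ℂ} {m : Fin N → ℂ} {U : Set (ℂ × (Fin N → ℂ))}
  {Φ : ℂ × (Fin N → ℂ) → ℂ}

theorem IsSourceFunction.add_halfPeriod_notMem (hΦ : IsSourceFunction ω₁ lam d m U Φ) {β : ℂ}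
    {X : Fin N → ℂ} (h : 0 < (tau ω₁ β).im) (hp : (β, X) ∈ U) (ν : Fin 4) (J : Fin N) :
    X J + halfPeriod (periodPair ω₁ (omega3 ω₁ β) h) ν ∉
      (periodPair ω₁ (omega3 ω₁ β) h).lattice :=
  (theta_ne_zero_iff h ν _).mp ((hΦ.theta_ne_zero hp).1 ν J)

theorem IsSourceFunction.sub_add_notMem (hΦ : IsSourceFunction ω₁ lam d m U Φ) {β : ℂ}
    {X : Fin N → ℂ} (h : 0 < (tau ω₁ β).im) (hp : (β, X) ∈ U) {J K : Fin N} (hJK : J ≠ K) :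
    X J - X K ∉ (periodPair ω₁ (omega3 ω₁ β) h).lattice ∧
      X J + X K ∉ (periodPair ω₁ (omega3 ω₁ β) h).lattice := by
  obtain ⟨-, h2, h3⟩ := hΦ.theta_ne_zero hp
  rcases hJK.lt_or_gt with hlt | hlt
  · exact ⟨(isOddTheta_theta h).ne_zero_iff.mp (h2 J K hlt),
      (isOddTheta_theta h).ne_zero_iff.mp (h3 J K hlt)⟩
  · refine ⟨fun hc => (isOddTheta_theta h).ne_zero_iff.mp (h2 K J hlt) ?_, ?_⟩
    · rw [← neg_sub]
      exact neg_mem hc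
    · rw [add_comm]
      exact (isOddTheta_theta h).ne_zero_iff.mp (h3 K J hlt)

theorem IsSourceFunction.hasDerivAt_sourceLogDeriv (hΦ : IsSourceFunction ω₁ lam d m U Φ) {β : ℂ}
    {X : Fin N → ℂ} (h : 0 < (tau ω₁ β).im) (hp : (β, X) ∈ U) (J : Fin N) {L : PeriodPair}
    (hL : L = periodPair ω₁ (omega3 ω₁ β) h) {B : ℂ} (hB : B = -(eta L 1 / halfPeriod L 1)) :
    HasDerivAt (fun t => sourceLogDeriv L (theta ω₁ β 0) lam d m J (Function.update X J t))
      ((∑ ν, coupling lam d m ν J * (B - ℘[L] (X J + halfPeriod L ν))) +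
        ∑ K ∈ {J}ᶜ, m J * m K * lam * ((B - ℘[L] (X J - X K)) + (B - ℘[L] (X J + X K)))) (X J) := by
  subst hL
  subst hB
  have hθ := isOddTheta_theta h
  have hfun : (fun t => sourceLogDeriv (periodPair ω₁ (omega3 ω₁ β) h) (theta ω₁ β 0) lam d m J
      (Function.update X J t)) = fun t =>
      (∑ ν, coupling lam d m ν J *
        thetaLog (periodPair ω₁ (omega3 ω₁ β) h) (theta ω₁ β 0) ν t) +
      ∑ K ∈ {J}ᶜ, m J * m K * lam *
        (logDeriv (theta ω₁ β 0) (t - X K) + logDeriv (theta ω₁ β 0) (t + X K)) := by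
    funext t
    rw [sourceLogDeriv, Function.update_self]
    congr 1
    refine Finset.sum_congr rfl fun K hK => ?_
    rw [Function.update_of_ne (by simpa using hK)]
  rw [hfun]
  refine HasDerivAt.fun_add (HasDerivAt.fun_sum fun ν _ => ?_) (HasDerivAt.fun_sum fun K hK => ?_)
  · exact (hasDerivAt_thetaLog h ((hΦ.theta_ne_zero hp).1 ν J)).const_mul _
  · have hKJ : J ≠ K := by
      rintro rfl
      simp at hK
    obtain ⟨h1, h2⟩ := hΦ.sub_add_notMem h hp hKJ
    exact (((hθ.hasDerivAt_logDeriv h1).comp_sub_const (X J) (X K)).fun_add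
      ((hθ.hasDerivAt_logDeriv h2).comp_add_const (X J) (X K))).const_mul _

theorem IsSourceFunction.iteratedDeriv_two_update (hΦ : IsSourceFunction ω₁ lam d m U Φ)
    (hU : IsOpen U) {β : ℂ}
    {X : Fin N → ℂ} (h : 0 < (tau ω₁ β).im) (hp : (β, X) ∈ U) (J : Fin N) {L : PeriodPair}
    (hL : L = periodPair ω₁ (omega3 ω₁ β) h) {B : ℂ} (hB : B = -(eta L 1 / halfPeriod L 1)) :
    iteratedDeriv 2 (fun t => Φ (β, Function.update X J t)) (X J) =
      (sourceLogDeriv L (theta ω₁ β 0) lam d m J X ^ 2 +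
        ((∑ ν, coupling lam d m ν J * (B - ℘[L] (X J + halfPeriod L ν))) +
        ∑ K ∈ {J}ᶜ, m J * m K * lam *
          ((B - ℘[L] (X J - X K)) + (B - ℘[L] (X J + X K))))) * Φ (β, X) := by
  have hcont : ContinuousAt (fun t => (β, Function.update X J t)) (X J) :=
    continuousAt_const.prodMk (_root_.hasDerivAt_update X J (X J)).continuousAt
  have hmem : ∀ᶠ t in 𝓝 (X J), (β, Function.update X J t) ∈ U :=
    hcont.eventually (hU.mem_nhds (by simpa using hp))
  have hfirst : deriv (fun t => Φ (β, Function.update X J t)) =ᶠ[𝓝 (X J)]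
      fun t => Φ (β, Function.update X J t) *
        sourceLogDeriv L (theta ω₁ β 0) lam d m J (Function.update X J t) := by
    filter_upwards [hmem] with t ht
    have := hΦ.hasDerivAt_update hU h ht J
    rw [← hL] at this
    simpa using this.deriv
  have h1 := hΦ.hasDerivAt_update hU h hp J
  rw [← hL] at h1
  have h2 := hΦ.hasDerivAt_sourceLogDeriv h hp J hL hB
  rw [iteratedDeriv_succ, iteratedDeriv_one, hfirst.deriv_eq, (h1.fun_mul h2).deriv,
    Function.update_eq_self]
  ring

theorem IsSourceFunction.deriv_fst (hΦ : IsSourceFunction ω₁ lam d m U Φ)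
    (hU : IsOpen U) {β : ℂ}
    {X : Fin N → ℂ} (h : 0 < (tau ω₁ β).im) (hp : (β, X) ∈ U) {L : PeriodPair}
    (hL : L = periodPair ω₁ (omega3 ω₁ β) h) {B : ℂ} (hB : B = -(eta L 1 / halfPeriod L 1)) :
    deriv (fun b => Φ (b, X)) β = Φ (β, X) *
      ((∑ J, ∑ ν, coupling lam d m ν J *
        ((B - ℘[L] (X J + halfPeriod L ν) + thetaLog L (theta ω₁ β 0) ν (X J) ^ 2) / 2)) +
        ∑ J, ∑ K ∈ Finset.Ioi J,
          (m J * m K * lam *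
            ((B - ℘[L] (X J - X K) + logDeriv (theta ω₁ β 0) (X J - X K) ^ 2) / 2) +
          m J * m K * lam *
            ((B - ℘[L] (X J + X K) + logDeriv (theta ω₁ β 0) (X J + X K) ^ 2) / 2))) := by
  subst hL
  subst hB
  obtain ⟨h1, h2, h3⟩ := hΦ.theta_ne_zero hp
  have hzero : ∀ x, theta ω₁ β 0 x ≠ 0 → HasDerivAt (fun b => theta ω₁ b 0 x) (theta ω₁ β 0 x *
      ((-(eta (periodPair ω₁ (omega3 ω₁ β) h) 1 / halfPeriod (periodPair ω₁ (omega3 ω₁ β) h) 1) -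
        ℘[periodPair ω₁ (omega3 ω₁ β) h] x + logDeriv (theta ω₁ β 0) x ^ 2) / 2)) β := by
    intro x hx
    have := hasDerivAt_theta_fst_of_ne_zero h hx
    have h0 : halfPeriod (periodPair ω₁ (omega3 ω₁ β) h) 0 = 0 := rfl
    rwa [logDeriv_theta_zero_eq_thetaLog, h0, add_zero] at this
  have key := hΦ.hasDerivAt_comp hU (γ := fun b => (b, X)) (t := β) (by fun_prop) hp
    (u := fun ν J => _) (v := fun J K => _) (v' := fun J K => _)
    (fun ν J => by simpa only using hasDerivAt_theta_fst_of_ne_zero h (h1 ν J))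
    (fun J K hJK => by simpa only using hzero _ (h2 J K hJK))
    (fun J K hJK => by simpa only using hzero _ (h3 J K hJK))
  exact key.deriv

theorem IsSourceFunction.sourceRelations (hΦ : IsSourceFunction ω₁ lam d m U Φ) {β : ℂ}
    {X : Fin N → ℂ} (h : 0 < (tau ω₁ β).im) (hp : (β, X) ∈ U) {L : PeriodPair}
    (hL : L = periodPair ω₁ (omega3 ω₁ β) h) :
    SourceRelations X (logDeriv (theta ω₁ β 0)) ℘[L] (thetaLog L (theta ω₁ β 0))
      (fun ν x => ℘[L] (x + halfPeriod L ν)) (e L 1) (e L 2) (e L 3) := by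
  have hθ : IsOddTheta L (theta ω₁ β 0) := hL ▸ isOddTheta_theta h
  have hhalf : ∀ ν J, X J + halfPeriod L ν ∉ L.lattice := fun ν J =>
    hL ▸ hΦ.add_halfPeriod_notMem h hp ν J
  have hsub : ∀ J K, J ≠ K → X J - X K ∉ L.lattice := fun J K hJK =>
    hL ▸ (hΦ.sub_add_notMem h hp hJK).1
  -- The product contains θ₁(X_J + X_K) only for J < K; for J = K, 2X_J avoids the lattice because
  -- all four θ_{ν+1}(X_J) are nonzero.
  have hadd : ∀ J K, X J + X K ∉ L.lattice := fun J K => by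
    by_cases hJK : J = K
    · subst hJK
      rw [← two_mul]
      exact IsOddTheta.two_mul_notMem fun ν => hhalf ν J
    · exact hL ▸ (hΦ.sub_add_notMem h hp hJK).2
  have hneg : ∀ {x}, -x ∉ L.lattice → x ∉ L.lattice := fun hx hc => hx (neg_mem hc)
  have hpm : ∀ i k : Fin N ⊕ Fin N, i ≠ k →
      Sum.elim X (-X) i - Sum.elim X (-X) k ∉ L.lattice := by
    rintro (J | J) (K | K) hne
    · exact hsub J K fun hc => hne (hc ▸ rfl)
    · simpa using hadd J K
    · refine hneg ?_
      simpa [add_comm] using hadd J K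
    · refine hneg ?_
      have := hsub J K fun hc => hne (hc ▸ rfl)
      rwa [Sum.elim_inr, Sum.elim_inr, Pi.neg_apply, Pi.neg_apply, neg_sub_neg, neg_sub]
  have heven : ∀ ν J, -X J + halfPeriod L ν =
      -(X J + halfPeriod L ν) + (⟨2 * halfPeriod L ν, halfPeriod_add_self_mem L ν⟩ : L.lattice) :=
    fun ν J => by
      push_cast
      ring
  have hhalf' : ∀ ν (i : Fin N ⊕ Fin N), Sum.elim X (-X) i + halfPeriod L ν ∉ L.lattice := by
    rintro ν (J | J)
    · exact hhalf ν J
    · rw [Sum.elim_inr, Pi.neg_apply, heven]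
      intro hc
      have := sub_mem hc (halfPeriod_add_self_mem L ν)
      rw [add_sub_cancel_right] at this
      exact hhalf ν J (by simpa using neg_mem this)
  obtain ⟨w10, w20, w30, w21, w31, w32⟩ := weierstrassP_halfPeriod_sub L
  have hsq : ∀ {μ ν : Fin 4} {c : ℂ}, μ ≠ ν → ℘[L] (halfPeriod L μ - halfPeriod L ν) = c →
      ∀ J, (thetaLog L (theta ω₁ β 0) μ (X J) - thetaLog L (theta ω₁ β 0) ν (X J)) ^ 2 =
        ℘[L] (X J + halfPeriod L μ) + ℘[L] (X J + halfPeriod L ν) + c :=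
    fun hne hc J => hc ▸ hθ.sq_thetaLog_sub hne (hhalf _ J) (hhalf _ J)
  exact
    { odd := hθ.logDeriv_neg_eq
      even := L.weierstrassP_neg
      zero := L.weierstrassP_zero
      sum_e := hθ.e_symmetric.1
      half_odd := fun ν J => hθ.thetaLog_neg ν (hhalf ν J)
      half_even := fun ν J => by
        rw [heven, L.weierstrassP_add_coe, L.weierstrassP_neg]
      triple := fun i k j hik hkj hji => hθ.sq_logDeriv_triple (hpm i k hik) (hpm k j hkj)
        (hpm j i hji)
      pair := fun ν i k hik => hθ.sq_thetaLog_sub_sub ν (hhalf' ν i) (hhalf' ν k) (hpm i k hik)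
      half10 := hsq (by decide) w10
      half20 := hsq (by decide) w20
      half30 := hsq (by decide) w30
      half21 := hsq (by decide) w21
      half31 := hsq (by decide) w31
      half32 := hsq (by decide) w32
      dup := fun J => hθ.two_mul_logDeriv_two_mul fun ν => hhalf ν J
      dup' := fun J => hθ.four_mul_weierstrassP_two_mul fun ν => hhalf ν J }

end SourceFunction

end SourceIdentity

/-! ### The source identity. -/

theorem theorem1 (N : ℕ) (hN : 0 < N) (ω₁ lam : ℂ) (d : Fin 4 → ℂ) (m : Fin N → ℂ)
    (hm : ∀ J, m J ≠ 0)
    (U : Set (ℂ × (Fin N → ℂ))) (hU : IsOpen U) (hτ : ∀ p ∈ U, 0 < (tau ω₁ p.1).im)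
    (Φ : ℂ × (Fin N → ℂ) → ℂ) (hΦ : IsSourceFunction ω₁ lam d m U Φ) :
    DifferentiableOn ℂ Φ U ∧
      ∀ (β : ℂ) (X : Fin N → ℂ) (hp : (β, X) ∈ U),
        (4 * lam * (∑ J, m J) + 2 * ∑ ν, d ν) * deriv (fun b : ℂ => Φ (b, X)) β +
          inozemtsev (periodPair ω₁ (omega3 ω₁ β) (hτ (β, X) hp)) lam d m
            (fun Y => Φ (β, Y)) X -
          energy (periodPair ω₁ (omega3 ω₁ β) (hτ (β, X) hp)) lam d m * Φ (β, X) = 0 := by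
  refine ⟨hΦ.differentiableOn hτ, fun β X hp => ?_⟩
  have h : 0 < (tau ω₁ β).im := hτ (β, X) hp
  obtain ⟨L, hL⟩ : ∃ L, L = periodPair ω₁ (omega3 ω₁ β) h := ⟨_, rfl⟩
  obtain ⟨B, hB⟩ : ∃ B, B = -(eta L 1 / halfPeriod L 1) := ⟨_, rfl⟩
  have key := (hΦ.sourceRelations h hp hL).identity hm d lam B
  rw [← hL, hΦ.deriv_fst hU h hp hL hB, inozemtsev, energy]
  -- The second derivative is Φ times (square of the logarithmic derivative + its derivative), so Φ
  -- factors out and `key` multiplied by Φ is the claim.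
  have hdd : ∀ J, 1 / m J *
      (-iteratedDeriv 2 (fun t : ℂ => Φ (β, Function.update X J t)) (X J) +
      (∑ ν, coupling lam d m ν J * (coupling lam d m ν J - 1) *
        L.weierstrassP (X J + halfPeriod L ν)) * Φ (β, X)) =
      1 / m J * (-(sourceLogDeriv L (theta ω₁ β 0) lam d m J X ^ 2 +
        ((∑ ν, coupling lam d m ν J * (B - L.weierstrassP (X J + halfPeriod L ν))) +
          ∑ K ∈ {J}ᶜ, m J * m K * lam *
            ((B - L.weierstrassP (X J - X K)) + (B - L.weierstrassP (X J + X K))))) +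
        ∑ ν, coupling lam d m ν J * (coupling lam d m ν J - 1) *
          L.weierstrassP (X J + halfPeriod L ν)) * Φ (β, X) := fun J => by
    rw [hΦ.iteratedDeriv_two_update hU h hp J hL hB]
    ring
  simp only [hdd, ← Finset.sum_mul]
  simp only [sourceLogDeriv]
  rw [show eta L 1 / halfPeriod L 1 = -B by rw [hB, neg_neg]]
  linear_combination Φ (β, X) * key
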